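/- Let $M\cong\mathbb Z^l$ ($l\ge 1$) be a lattice, let $\Delta\subset M$ be the set of lattice points of an integral convex polytope, and let $w=\{w_m\}_{m\in\Delta}$ be a real-valued convex function determining a simplicial decomposition of the polytope. That is, let $Z_{\rm top}$ be the set of $S\subset\Delta$ consisting of $l+1$ affinely independent points for which some affine function equals $w$ on $S$ and is $<w$ on $\Delta\setminus S$; the convex hulls of the $S\in Z_{\rm top}$ cover the convex hull of $\Delta\neq\emptyset$. For $t\in\mathbb C^*$ and a choice of $\log t$, put $t^{w_m}=e^{w_m\log t}$. Let $s_m$ be the monomial on $(\mathbb C^*)^l$ with exponent $m$, and let $$s_t=\sum_{m\in\Delta}t^{w_m}s_m,\qquad X_t=\{s_t=0\}\subset(\mathbb C^*)^l .$$ For $\kappa>0$ define $$\eta_m=\frac{|t^{w_m}s_m|^2}{\sum_{m'\in\Delta}|t^{w_{m'}}s_{m'}|^2},\qquad a_m=\kappa-\log\eta_m,\qquad h_t=\kappa^2\sum_{S\in Z_{\rm top}}\prod_{m\in S}a_m^{-2}.$$ Let $\Omega=\frac{dx_1}{x_1}\wedge\cdots\wedge\frac{dx_l}{x_l}$, let $\Omega_{t,m}=\big(t^{w_m}\,\Omega\otimes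 (d(s_t/s_m))^{-1}\big)|_{X_t}$ (a holomorphic $(l-1)$-form on $X_t$), and let $$V_t=h_t\sum_{m\in\Delta}\Omega_{t,m}\otimes\overline{\Omega_{t,m}},\qquad \omega_t=\frac{i}{2\pi}\partial\bar\partial\log V_t .$$ Here $V_t$ is regarded as a volume form, $\Omega\otimes\bar\Omega$ standing for $i^{(l-1)^2}\Omega\wedge\bar\Omega$, and $\log V_t$ means the logarithm of its density in local holomorphic coordinates. Then there is $\kappa_0>0$ such that for every $\kappa\ge\kappa_0$ there is $t_0>0$ such that for all $0<|t|<t_0$ and all choices of $\log t$: $X_t$ is smooth, $\omega_t$ is the Kähler form of a Kähler metric $g_t$ on $X_t$, and the Ricci potential $\phi_t$, given by $$e^{-\phi_t}=\frac{\omega_t^{l-1}}{V_t},$$ is a well-defined smooth real function on $X_t$. Moreover, $|\phi_t|$ is bounded on $X_t$ by a constant independent of $t$ (and of the choice of $\log t$), and for every $k$ the norm $\|\phi_t\|_{C^k,g_t}=\sup_{X_t}\sum_{j\le k}|\nabla^j\phi_t|_{g_t}$ (Levi-Civita connection and tensor norms of $g_t$) is bounded by a constant independent of $t$ (and of the choice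 of $\log t$). -/

import Mathlib

open scoped ContDiff

noncomputable section

namespace ToricHypersurface

/-! ### Lattice polytopes and convex functions inducing a simplicial decomposition

The lattice is `M = ℤ^l` with `l = n + 1`, so that hypersurfaces in the torus have complex
dimension `n = l - 1`.  A lattice polytope is recorded by the finite set `Δ` of its lattice points. -/

/-- The inclusion of the lattice `ℤ^l` in `ℝ^l`. -/
def toReal {l : ℕ} (m : Fin l → ℤ) : Fin l → ℝ := fun i => (m i : ℝ)

/-- `S` is (the vertex set of) a top dimensional simplex of the decomposition of `Δ` determined
by `w`: a full dimensional simplex on which `w` agrees with an affine function that is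
strictly smaller than `w` at all the other lattice points of `Δ`. -/
def IsTopSimplex {l : ℕ} (Δ : Finset (Fin l → ℤ)) (w : (Fin l → ℤ) → ℝ)
    (S : Finset (Fin l → ℤ)) : Prop :=
  S ⊆ Δ ∧ S.card = l + 1 ∧ AffineIndependent ℝ (fun m : S => toReal (m : Fin l → ℤ)) ∧
    ∃ (c : Fin l → ℝ) (b : ℝ),
      (∀ m ∈ S, w m = ∑ i, c i * (m i : ℝ) + b) ∧
      (∀ m ∈ Δ, m ∉ S → ∑ i, c i * (m i : ℝ) + b < w m)

open Classical in
/-- `Z_top`, the finite set of top dimensional simplices determined by `w`. -/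
def Ztop {l : ℕ} (Δ : Finset (Fin l → ℤ)) (w : (Fin l → ℤ) → ℝ) :
    Finset (Finset (Fin l → ℤ)) :=
  Δ.powerset.filter (IsTopSimplex Δ w)

/-- `Δ` is the set of lattice points of a (nonempty) integral convex polytope, and `w` is a convex
function on it that determines a simplicial decomposition of the polytope. -/
structure IsSimplicialData {l : ℕ} (Δ : Finset (Fin l → ℤ)) (w : (Fin l → ℤ) → ℝ) : Prop where
  nonempty : Δ.Nonempty
  saturated : ∀ m : Fin l → ℤ,
    toReal m ∈ convexHull ℝ (toReal '' (Δ : Set (Fin l → ℤ))) → m ∈ Δ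
  convex : ∃ f : (Fin l → ℝ) → ℝ,
    ConvexOn ℝ (convexHull ℝ (toReal '' (Δ : Set (Fin l → ℤ)))) f ∧ ∀ m ∈ Δ, f (toReal m) = w m
  cover : ∀ p ∈ convexHull ℝ (toReal '' (Δ : Set (Fin l → ℤ))),
    ∃ S ∈ Ztop Δ w, p ∈ convexHull ℝ (toReal '' (S : Set (Fin l → ℤ)))

/-! ### The hypersurfaces

The parameter `t ≠ 0` is given through a logarithm `ζ`, `t = exp ζ`; this fixes the branch of
the powers `t ^ w` with real exponent `w`, and letting `ζ` vary gives all branches. -/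

/-- `t ^ r` for `t = exp ζ`. -/
def tpow (ζ : ℂ) (r : ℝ) : ℂ := Complex.exp ((r : ℂ) * ζ)

/-- The Laurent monomial `s_m`. -/
def mono {l : ℕ} (m : Fin l → ℤ) (x : Fin l → ℂ) : ℂ := ∏ i, x i ^ m i

/-- `s_t = ∑ t ^ {w_m} s_m`. -/
def poly {l : ℕ} (Δ : Finset (Fin l → ℤ)) (w : (Fin l → ℤ) → ℝ) (ζ : ℂ) (x : Fin l → ℂ) : ℂ :=
  ∑ m ∈ Δ, tpow ζ (w m) * mono m x

/-- The hypersurface `X_t` in the complex torus. -/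
def hypersurface {l : ℕ} (Δ : Finset (Fin l → ℤ)) (w : (Fin l → ℤ) → ℝ) (ζ : ℂ) :
    Set (Fin l → ℂ) :=
  {x | (∀ i, x i ≠ 0) ∧ poly Δ w ζ x = 0}

/-- A local holomorphic parametrization (inverse of a holomorphic chart) of a subset `X` of
`ℂ^{n+1}` by an open subset of `ℂ^n`: a holomorphic immersion into `X`. -/
structure LocalParam (n : ℕ) (X : Set (Fin (n + 1) → ℂ)) where
  domain : Set (Fin n → ℂ)
  toFun : (Fin n → ℂ) → (Fin (n + 1) → ℂ)
  isOpen_domain : IsOpen domain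
  differentiableOn : DifferentiableOn ℂ toFun domain
  mapsTo : Set.MapsTo toFun domain X
  immersion : ∀ u ∈ domain, Function.Injective (fderiv ℂ toFun u)

/-! ### The functions `η_m`, `a_m`, `h_t` -/

/-- `η_m = |t^{w_m} s_m|² / ∑_{m'} |t^{w_{m'}} s_{m'}|²`. -/
def eta {l : ℕ} (Δ : Finset (Fin l → ℤ)) (w : (Fin l → ℤ) → ℝ) (ζ : ℂ) (m : Fin l → ℤ)
    (x : Fin l → ℂ) : ℝ :=
  ‖tpow ζ (w m) * mono m x‖ ^ 2 / ∑ m' ∈ Δ, ‖tpow ζ (w m') * mono m' x‖ ^ 2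

/-- `a_m = κ - log η_m`. -/
def aFun {l : ℕ} (Δ : Finset (Fin l → ℤ)) (w : (Fin l → ℤ) → ℝ) (κ : ℝ) (ζ : ℂ)
    (m : Fin l → ℤ) (x : Fin l → ℂ) : ℝ :=
  κ - Real.log (eta Δ w ζ m x)

/-- `h_t = κ² ∑_{S ∈ Z_top} A_S²` with `A_S = (∏_{m ∈ S} a_m)⁻¹`. -/
def hFun {l : ℕ} (Δ : Finset (Fin l → ℤ)) (w : (Fin l → ℤ) → ℝ) (κ : ℝ) (ζ : ℂ)
    (x : Fin l → ℂ) : ℝ :=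
  κ ^ 2 * ∑ S ∈ Ztop Δ w, ((∏ m ∈ S, aFun Δ w κ ζ m x)⁻¹) ^ 2

/-! ### Holomorphic volume forms -/

/-- The canonical holomorphic volume form `Ω = (dx_1/x_1) ∧ ⋯ ∧ (dx_l/x_l)` of the torus. -/
def Omega {l : ℕ} (x : Fin l → ℂ) (v : Fin l → Fin l → ℂ) : ℂ :=
  (Matrix.of v).det / ∏ i, x i

/-- The conjugate gradient of `σ` at `x`: a vector on which `dσ` does not vanish, unless
`dσ = 0`. -/
def conjGrad {l : ℕ} (σ : (Fin l → ℂ) → ℂ) (x : Fin l → ℂ) : Fin l → ℂ :=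
  fun i => starRingEnd ℂ (fderiv ℂ σ x (Pi.single i 1))

/-- The `n`-form `Ω ⊗ (dσ)⁻¹` on the hypersurface `σ = 0`, evaluated at tangent vectors
`v_1, …, v_n`: it is `Ω(ν, v_1, …, v_n) / dσ(ν)` for any transverse vector `ν`
(see `Omega_cons_eq_quotForm_mul`). -/
def quotForm {n : ℕ} (σ : (Fin (n + 1) → ℂ) → ℂ) (x : Fin (n + 1) → ℂ)
    (v : Fin n → Fin (n + 1) → ℂ) : ℂ :=
  Omega x (Fin.cons (conjGrad σ x) v : Fin (n + 1) → Fin (n + 1) → ℂ) /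
    fderiv ℂ σ x (conjGrad σ x)

lemma clm_apply_eq_sum {l : ℕ} (L : (Fin l → ℂ) →L[ℂ] ℂ) (y : Fin l → ℂ) :
    L y = ∑ i, y i * L (Pi.single i 1) := by
  conv_lhs => rw [pi_eq_sum_univ' y]
  simp [map_sum, map_smul]

lemma fderiv_conjGrad_ne_zero {l : ℕ} {σ : (Fin l → ℂ) → ℂ} {x : Fin l → ℂ}
    (h : fderiv ℂ σ x ≠ 0) : fderiv ℂ σ x (conjGrad σ x) ≠ 0 := by
  intro h0
  apply h
  have hsum : ∑ i, Complex.normSq (fderiv ℂ σ x (Pi.single i 1)) = 0 := by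
    rw [clm_apply_eq_sum] at h0
    have h1 : ((∑ i, Complex.normSq (fderiv ℂ σ x (Pi.single i 1)) : ℝ) : ℂ) = 0 := by
      rw [← h0, Complex.ofReal_sum]
      refine Finset.sum_congr rfl fun i _ => ?_
      rw [Complex.normSq_eq_conj_mul_self]
      rfl
    exact_mod_cast h1
  have hz := (Finset.sum_eq_zero_iff_of_nonneg fun i _ => Complex.normSq_nonneg _).1 hsum
  ext1 y
  rw [clm_apply_eq_sum _ y]
  refine Finset.sum_eq_zero fun i hi => ?_
  rw [Complex.normSq_eq_zero.1 (hz i hi), mul_zero]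

/-- `Ω = dσ ∧ (Ω ⊗ (dσ)⁻¹)`: the value of `quotForm` does not depend on the transverse vector. -/
lemma Omega_cons_eq_quotForm_mul {n : ℕ} {σ : (Fin (n + 1) → ℂ) → ℂ} {x : Fin (n + 1) → ℂ}
    (h : fderiv ℂ σ x ≠ 0) {v : Fin n → Fin (n + 1) → ℂ} (hv : ∀ j, fderiv ℂ σ x (v j) = 0)
    (ν : Fin (n + 1) → ℂ) :
    Omega x (Fin.cons ν v : Fin (n + 1) → Fin (n + 1) → ℂ) =
      quotForm σ x v * fderiv ℂ σ x ν := by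
  have h0 := fderiv_conjGrad_ne_zero h
  have key : ∀ μ, fderiv ℂ σ x μ = 0 →
      (Matrix.of (Fin.cons μ v : Fin (n + 1) → Fin (n + 1) → ℂ)).det = 0 := by
    intro μ hμ
    refine Matrix.exists_mulVec_eq_zero_iff.1 ⟨fun i => fderiv ℂ σ x (Pi.single i 1), ?_, ?_⟩
    · intro hz
      apply h
      ext1 y
      rw [clm_apply_eq_sum _ y]
      refine Finset.sum_eq_zero fun i _ => ?_
      rw [show fderiv ℂ σ x (Pi.single i 1) = 0 from congrFun hz i, mul_zero]
    · ext a
      simp only [Matrix.mulVec, dotProduct, Matrix.of_apply, ← clm_apply_eq_sum, Pi.zero_apply]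
      refine Fin.cases ?_ (fun j => ?_) a
      · simpa using hμ
      · simpa using hv j
  set c := conjGrad σ x with hc
  set r := fderiv ℂ σ x ν / fderiv ℂ σ x c with hr
  have hlin : ∀ μ, (Matrix.of (Fin.cons μ v : Fin (n + 1) → Fin (n + 1) → ℂ)).det =
      Matrix.detRowAlternating
        (Function.update (Fin.cons 0 v : Fin (n + 1) → Fin (n + 1) → ℂ) 0 μ) := by
    intro μ
    rw [Fin.update_cons_zero]
    rfl
  have hk := key (ν - r • c) (by rw [map_sub, map_smul, hr, smul_eq_mul, div_mul_cancel₀ _ h0,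
    sub_self])
  rw [hlin, AlternatingMap.map_update_sub, AlternatingMap.map_update_smul, ← hlin, ← hlin,
    sub_eq_zero] at hk
  unfold quotForm Omega
  rw [hk, hr, smul_eq_mul]
  ring

/-- The holomorphic section `Ω_{t,m} = t^{w_m} Ω ⊗ (d(s_t/s_m))⁻¹` of the canonical bundle of
`X_t`, at the point `x`. -/
def OmegaT {n : ℕ} (Δ : Finset (Fin (n + 1) → ℤ)) (w : (Fin (n + 1) → ℤ) → ℝ) (ζ : ℂ)
    (m : Fin (n + 1) → ℤ) (x : Fin (n + 1) → ℂ) (v : Fin n → Fin (n + 1) → ℂ) : ℂ :=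
  tpow ζ (w m) * quotForm (fun y => poly Δ w ζ y / mono m y) x v

/-! ### The Levi form and the Riemannian geometry of a Kähler metric, in a chart -/

/-- The second derivative of a real function on `ℂ^n`, as a real vector space. -/
def hess {n : ℕ} (ρ : (Fin n → ℂ) → ℝ) (u X Y : Fin n → ℂ) : ℝ :=
  fderiv ℝ (fun v => fderiv ℝ ρ v Y) u X

/-- The Levi form `∑ (∂²ρ / ∂u_j ∂ū_k) X_j conj(Y_k)`. -/
def levi {n : ℕ} (ρ : (Fin n → ℂ) → ℝ) (u X Y : Fin n → ℂ) : ℂ :=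
  (((hess ρ u X Y + hess ρ u (Complex.I • X) (Complex.I • Y) : ℝ) : ℂ) +
    Complex.I * ((hess ρ u X (Complex.I • Y) - hess ρ u (Complex.I • X) Y : ℝ) : ℂ)) / 4

/-- The matrix `∂²ρ / ∂u_j ∂ū_k`. -/
def leviMatrix {n : ℕ} (ρ : (Fin n → ℂ) → ℝ) (u : Fin n → ℂ) : Matrix (Fin n) (Fin n) ℂ :=
  Matrix.of fun j k => levi ρ u (Pi.single j 1) (Pi.single k 1)

/-- The Riemannian metric `g(X, Y) = ω(X, iY)` of `ω = (i/2π) ∂∂̄ρ`. -/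
def kahlerMetric {n : ℕ} (ρ : (Fin n → ℂ) → ℝ) (u X Y : Fin n → ℂ) : ℝ :=
  (levi ρ u X Y).re / Real.pi

/-- The density of `ω^n` with respect to `∏ (i du_j ∧ dū_j)`, for `ω = (i/2π) ∂∂̄ρ`. -/
def kahlerVolume {n : ℕ} (ρ : (Fin n → ℂ) → ℝ) (u : Fin n → ℂ) : ℝ :=
  (n.factorial : ℝ) * ((2 * Real.pi)⁻¹) ^ n * (leviMatrix ρ u).det.re

/-- The right-hand side of the Koszul formula for constant vector fields:
`(X g(Y,Z) + Y g(X,Z) - Z g(X,Y)) / 2`. -/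
def koszul {E : Type*} [NormedAddCommGroup E] [NormedSpace ℝ E] (g : E → E → E → ℝ)
    (u X Y Z : E) : ℝ :=
  (fderiv ℝ (fun v => g v Y Z) u X + fderiv ℝ (fun v => g v X Z) u Y
    - fderiv ℝ (fun v => g v X Y) u Z) / 2

/-- The Christoffel symbols `Γ(X, Y) = ∇_X Y` (for constant vector fields `X`, `Y`) of the
Levi-Civita connection of `g`: the vector with `g(Γ(X, Y), Z) = koszul g X Y Z` for all `Z`. -/
def christoffel {E : Type*} [NormedAddCommGroup E] [NormedSpace ℝ E] (g : E → E → E → ℝ)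
    (u X Y : E) : E :=
  Classical.epsilon fun V => ∀ Z, g u V Z = koszul g u X Y Z

/-- The defining property of `christoffel` holds when `g` is a positive definite bilinear form
at `u` and `koszul` is linear in its last argument, in particular for smooth metrics. -/
lemma christoffel_spec {E : Type*} [NormedAddCommGroup E] [NormedSpace ℝ E]
    [FiniteDimensional ℝ E] {g : E → E → E → ℝ} {u X Y : E} (B : E →ₗ[ℝ] E →ₗ[ℝ] ℝ)
    (hB : ∀ V Z, g u V Z = B V Z) (hpos : ∀ V, V ≠ 0 → 0 < B V V)
    (K : E →ₗ[ℝ] ℝ) (hK : ∀ Z, koszul g u X Y Z = K Z) (Z : E) :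
    g u (christoffel g u X Y) Z = koszul g u X Y Z := by
  have hinj : Function.Injective B := by
    rw [← LinearMap.ker_eq_bot, LinearMap.ker_eq_bot']
    intro V hV
    by_contra hne
    have := hpos V hne
    simp [hV] at this
  have hsurj : Function.Surjective B :=
    (LinearMap.injective_iff_surjective_of_finrank_eq_finrank
      (Subspace.dual_finrank_eq (K := ℝ) (V := E)).symm).1 hinj
  obtain ⟨V, hV⟩ := hsurj K
  exact Classical.epsilon_spec (p := fun V => ∀ Z, g u V Z = koszul g u X Y Z)
    ⟨V, fun Z => by rw [hB, hK, hV]⟩ Z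

/-- The iterated covariant derivatives `∇^k f` of a function, as covariant `k`-tensors:
`(∇T)(X_0, …, X_k) = X_0 (T(X_1, …, X_k)) - ∑_i T(X_1, …, Γ(X_0, X_i), …, X_k)` for constant
vector fields. -/
def iterNabla {E : Type*} [NormedAddCommGroup E] [NormedSpace ℝ E] (g : E → E → E → ℝ)
    (f : E → ℝ) : (k : ℕ) → E → (Fin k → E) → ℝ
  | 0, u, _ => f u
  | k + 1, u, X =>
      fderiv ℝ (fun v => iterNabla g f k v (Fin.tail X)) u (X 0) -
        ∑ i : Fin k, iterNabla g f k u
          (Function.update (Fin.tail X) i (christoffel g u (X 0) (X i.succ)))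

/-- `e` is an orthonormal frame at `u` for `g`. -/
def IsOrthonormalFrame {E ι : Type*} [DecidableEq ι] (g : E → E → E → ℝ) (u : E)
    (e : ι → E) : Prop :=
  ∀ a b, g u (e a) (e b) = if a = b then 1 else 0

/-- The norm `|T|` of a `k`-tensor, in an orthonormal frame `e`. -/
def frameNorm {E ι : Type*} [Fintype ι] {k : ℕ} (e : ι → E) (T : (Fin k → E) → ℝ) : ℝ :=
  Real.sqrt (∑ I : Fin k → ι, T (fun i => e (I i)) ^ 2)

/-! ### The approximate metric and the Ricci potential -/

/-- The density of `V_t = h_t ∑_m Ω_{t,m} ⊗ conj(Ω_{t,m})` with respect to `∏ (i du_j ∧ dū_j)`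
in the chart `F`. -/
def volDensity {n : ℕ} (Δ : Finset (Fin (n + 1) → ℤ)) (w : (Fin (n + 1) → ℤ) → ℝ) (κ : ℝ)
    (ζ : ℂ) (F : LocalParam n (hypersurface Δ w ζ)) (u : Fin n → ℂ) : ℝ :=
  hFun Δ w κ ζ (F.toFun u) *
    ∑ m ∈ Δ, ‖OmegaT Δ w ζ m (F.toFun u) (fun j => fderiv ℂ F.toFun u (Pi.single j 1))‖ ^ 2

/-- The Kähler potential `log V_t` of `ω_t = (i/2π) ∂∂̄ log V_t` in the chart `F`. -/
def potential {n : ℕ} (Δ : Finset (Fin (n + 1) → ℤ)) (w : (Fin (n + 1) → ℤ) → ℝ) (κ : ℝ)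
    (ζ : ℂ) (F : LocalParam n (hypersurface Δ w ζ)) (u : Fin n → ℂ) : ℝ :=
  Real.log (volDensity Δ w κ ζ F u)

/-- The approximate metric `g_t` on `X_t` in the chart `F`. -/
def metric {n : ℕ} (Δ : Finset (Fin (n + 1) → ℤ)) (w : (Fin (n + 1) → ℤ) → ℝ) (κ : ℝ)
    (ζ : ℂ) (F : LocalParam n (hypersurface Δ w ζ)) : (Fin n → ℂ) → (Fin n → ℂ) → (Fin n → ℂ) → ℝ :=
  kahlerMetric (potential Δ w κ ζ F)

/-- The quotient `ω_t^{l-1} / V_t` in the chart `F`. -/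
def volRatio {n : ℕ} (Δ : Finset (Fin (n + 1) → ℤ)) (w : (Fin (n + 1) → ℤ) → ℝ) (κ : ℝ)
    (ζ : ℂ) (F : LocalParam n (hypersurface Δ w ζ)) (u : Fin n → ℂ) : ℝ :=
  kahlerVolume (potential Δ w κ ζ F) u / volDensity Δ w κ ζ F u

/-- `φ` is the Ricci potential of `g_t`, i.e. `exp (-φ) = ω_t^{l-1} / V_t` on `X_t`. -/
def IsRicciPotential {n : ℕ} (Δ : Finset (Fin (n + 1) → ℤ)) (w : (Fin (n + 1) → ℤ) → ℝ) (κ : ℝ)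
    (ζ : ℂ) (φ : (Fin (n + 1) → ℂ) → ℝ) : Prop :=
  ∀ F : LocalParam n (hypersurface Δ w ζ), ∀ u ∈ F.domain,
    Real.exp (-φ (F.toFun u)) = volRatio Δ w κ ζ F u

/-- The norm `‖φ‖_{C^k, g_t} = sup_{X_t} ∑_{j ≤ k} |∇^j φ|_{g_t}`. -/
def ckNorm {n : ℕ} (Δ : Finset (Fin (n + 1) → ℤ)) (w : (Fin (n + 1) → ℤ) → ℝ) (κ : ℝ)
    (ζ : ℂ) (k : ℕ) (φ : (Fin (n + 1) → ℂ) → ℝ) : ENNReal :=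
  ⨆ (F : LocalParam n (hypersurface Δ w ζ)) (u : Fin n → ℂ) (_ : u ∈ F.domain)
    (e : Fin (2 * n) → Fin n → ℂ) (_ : IsOrthonormalFrame (metric Δ w κ ζ F) u e),
    ∑ j ∈ Finset.range (k + 1),
      ENNReal.ofReal (frameNorm e (iterNabla (metric Δ w κ ζ F) (fun v => φ (F.toFun v)) j u))

end ToricHypersurface

end

open scoped ContDiff Topology

noncomputable section

namespace ToricHypersurface

section Geometry

variable {P E : Type*} [NormedAddCommGroup P] [NormedSpace ℝ P] [NormedAddCommGroup E]
  [NormedSpace ℝ E]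

/-- `g` is a family of Riemannian metrics, given on `U` by the smooth family `B` of positive definite
symmetric bilinear forms. -/
structure IsSmoothMetricOn (U : Set (P × E)) (g : P → E → E → E → ℝ)
    (B : P × E → E →L[ℝ] E →L[ℝ] ℝ) : Prop where
  isOpen : IsOpen U
  smooth : ContDiffOn ℝ ∞ B U
  eq : ∀ z ∈ U, ∀ X Y, g z.1 z.2 X Y = B z X Y
  symm : ∀ z ∈ U, ∀ X Y, B z X Y = B z Y X
  pos : ∀ z ∈ U, ∀ X, X ≠ 0 → 0 < B z X X

/-- The derivative of a family of bilinear forms in the direction of `E`. -/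
def spatialDeriv (B : P × E → E →L[ℝ] E →L[ℝ] ℝ) (z : P × E) : E →L[ℝ] E →L[ℝ] E →L[ℝ] ℝ :=
  (fderiv ℝ B z).comp (ContinuousLinearMap.inr ℝ P E)

/-- The right-hand side of the Koszul formula, as a continuous linear form. -/
def koszulForm (B : P × E → E →L[ℝ] E →L[ℝ] ℝ) (z : P × E) (X Y : E) : E →L[ℝ] ℝ :=
  (2⁻¹ : ℝ) • (spatialDeriv B z X Y + spatialDeriv B z Y X -
    ((ContinuousLinearMap.flipₗᵢ ℝ E E ℝ)
      ((ContinuousLinearMap.flipₗᵢ ℝ E E (E →L[ℝ] ℝ)) (spatialDeriv B z) X) Y))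

variable {U : Set (P × E)} {g : P → E → E → E → ℝ} {B : P × E → E →L[ℝ] E →L[ℝ] ℝ}

lemma IsSmoothMetricOn.fderiv_eq (h : IsSmoothMetricOn U g B) {z : P × E} (hz : z ∈ U)
    (X Y Z : E) : fderiv ℝ (fun v => g z.1 v Y Z) z.2 X = spatialDeriv B z X Y Z := by
  have hB : HasFDerivAt B (fderiv ℝ B z) z :=
    ((h.smooth.contDiffAt (h.isOpen.mem_nhds hz)).differentiableAt (by simp)).hasFDerivAt
  have hin : HasFDerivAt (fun v : E => (z.1, v)) (ContinuousLinearMap.inr ℝ P E) z.2 :=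
    hasFDerivAt_prodMk_right z.1 z.2
  have h1 : HasFDerivAt (fun v : E => B (z.1, v)) (spatialDeriv B z) z.2 :=
    HasFDerivAt.comp z.2 (f := fun v : E => (z.1, v)) (g := B) hB hin
  have h2 := (h1.clm_apply (hasFDerivAt_const Y z.2)).clm_apply (hasFDerivAt_const Z z.2)
  have hev : (fun v => g z.1 v Y Z) =ᶠ[𝓝 z.2] fun v => B (z.1, v) Y Z := by
    have : ∀ᶠ v in 𝓝 z.2, (z.1, v) ∈ U :=
      (Continuous.prodMk_right z.1).continuousAt.eventually (h.isOpen.mem_nhds hz)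
    filter_upwards [this] with v hv using h.eq _ hv Y Z
  rw [hev.fderiv_eq, h2.fderiv]
  simp

lemma IsSmoothMetricOn.koszul_eq (h : IsSmoothMetricOn U g B) {z : P × E} (hz : z ∈ U)
    (X Y Z : E) : koszul (g z.1) z.2 X Y Z = koszulForm B z X Y Z := by
  unfold koszul koszulForm
  rw [h.fderiv_eq hz, h.fderiv_eq hz, h.fderiv_eq hz]
  change _ = 2⁻¹ * (spatialDeriv B z X Y Z + spatialDeriv B z Y X Z - spatialDeriv B z Z X Y)
  ring

lemma koszulForm_add_left (z : P × E) (X X' Y : E) :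
    koszulForm B z (X + X') Y = koszulForm B z X Y + koszulForm B z X' Y := by
  unfold koszulForm
  ext Z
  simp
  ring

lemma koszulForm_smul_left (z : P × E) (c : ℝ) (X Y : E) :
    koszulForm B z (c • X) Y = c • koszulForm B z X Y := by
  unfold koszulForm
  ext Z
  simp
  ring

lemma koszulForm_add_right (z : P × E) (X Y Y' : E) :
    koszulForm B z X (Y + Y') = koszulForm B z X Y + koszulForm B z X Y' := by
  unfold koszulForm
  ext Z
  simp
  ring

lemma koszulForm_smul_right (z : P × E) (c : ℝ) (X Y : E) :
    koszulForm B z X (c • Y) = c • koszulForm B z X Y := by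
  unfold koszulForm
  ext Z
  simp
  ring

variable [FiniteDimensional ℝ E]

lemma IsSmoothMetricOn.isInvertible (h : IsSmoothMetricOn U g B) {z : P × E} (hz : z ∈ U) :
    (B z).IsInvertible := by
  have hinj : Function.Injective (B z) := by
    rw [injective_iff_map_eq_zero]
    intro V hV
    by_contra hne
    have := h.pos z hz V hne
    simp [hV] at this
  have hfr : Module.finrank ℝ E = Module.finrank ℝ (E →L[ℝ] ℝ) := by
    rw [← (LinearMap.toContinuousLinearMap (𝕜 := ℝ) (E := E) (F' := ℝ)).finrank_eq]
    exact (Subspace.dual_finrank_eq (K := ℝ) (V := E)).symm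
  have hsurj : Function.Surjective (B z) :=
    (LinearMap.injective_iff_surjective_of_finrank_eq_finrank (f := (B z : E →ₗ[ℝ] (E →L[ℝ] ℝ)))
      hfr).1 hinj
  exact ⟨ContinuousLinearEquiv.ofBijective (B z) (LinearMap.ker_eq_bot.2 hinj)
    (LinearMap.range_eq_top.2 hsurj), rfl⟩

lemma IsSmoothMetricOn.christoffel_spec' (h : IsSmoothMetricOn U g B) {z : P × E} (hz : z ∈ U)
    (X Y Z : E) : B z (christoffel (g z.1) z.2 X Y) Z = koszulForm B z X Y Z := by
  have := christoffel_spec (g := g z.1) (u := z.2) (X := X) (Y := Y)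
    (ContinuousLinearMap.coeLMₛₗ (RingHom.id ℝ) ∘ₗ (B z : E →ₗ[ℝ] E →L[ℝ] ℝ))
    (fun V Z => h.eq z hz V Z) (fun V hV => h.pos z hz V hV)
    (koszulForm B z X Y : E →ₗ[ℝ] ℝ) (fun Z => h.koszul_eq hz X Y Z) Z
  rw [h.eq z hz, h.koszul_eq hz] at this
  exact this

lemma IsSmoothMetricOn.ext (h : IsSmoothMetricOn U g B) {z : P × E} (hz : z ∈ U) {V W : E}
    (hVW : ∀ Z, B z V Z = B z W Z) : V = W := by
  obtain ⟨e, he⟩ := h.isInvertible hz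
  apply e.injective
  have : B z V = B z W := by ext Z; exact hVW Z
  rwa [← he] at this

lemma IsSmoothMetricOn.christoffel_eq (h : IsSmoothMetricOn U g B) {z : P × E} (hz : z ∈ U)
    (X Y : E) : christoffel (g z.1) z.2 X Y = (B z).inverse (koszulForm B z X Y) := by
  obtain ⟨e, he⟩ := h.isInvertible hz
  have h1 : B z (christoffel (g z.1) z.2 X Y) = koszulForm B z X Y := by
    ext Z; exact h.christoffel_spec' hz X Y Z
  rw [← h1, ← he, ContinuousLinearMap.inverse_equiv]
  simp

set_option maxSynthPendingDepth 3 in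
lemma IsSmoothMetricOn.contDiffOn_christoffel (h : IsSmoothMetricOn U g B) :
    ContDiffOn ℝ ∞ (fun q : (P × E) × E × E => christoffel (g q.1.1) q.1.2 q.2.1 q.2.2)
      (U ×ˢ Set.univ) := by
  have hcongr : ∀ q ∈ U ×ˢ (Set.univ : Set (E × E)),
      (fun q : (P × E) × E × E => christoffel (g q.1.1) q.1.2 q.2.1 q.2.2) q =
        (B q.1).inverse (koszulForm B q.1 q.2.1 q.2.2) := fun q hq =>
    h.christoffel_eq hq.1 _ _
  refine ContDiffOn.congr ?_ hcongr
  have hfst : Set.MapsTo (Prod.fst : (P × E) × E × E → P × E) (U ×ˢ Set.univ) U := fun q hq => hq.1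
  have hD : ContDiffOn ℝ ∞ (spatialDeriv B) U := by
    unfold spatialDeriv
    exact (h.smooth.fderiv_of_isOpen h.isOpen (by simp)).clm_comp contDiffOn_const
  have hD' := hD.comp (contDiff_fst (E := P × E) (F := E × E)).contDiffOn hfst
  have hX : ContDiffOn ℝ ∞ (fun q : (P × E) × E × E => q.2.1) (U ×ˢ Set.univ) :=
    (contDiff_fst.comp contDiff_snd).contDiffOn
  have hY : ContDiffOn ℝ ∞ (fun q : (P × E) × E × E => q.2.2) (U ×ˢ Set.univ) :=
    (contDiff_snd.comp contDiff_snd).contDiffOn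
  have hinv : ContDiffOn ℝ ∞ (fun q : (P × E) × E × E => (B q.1).inverse) (U ×ˢ Set.univ) := by
    intro q hq
    obtain ⟨e, he⟩ := h.isInvertible hq.1
    have h1 : ContDiffAt ℝ ∞ ContinuousLinearMap.inverse (B q.1) := by
      rw [← he]; exact contDiffAt_map_inverse e
    exact (h1.comp (x := q) (f := fun q : (P × E) × E × E => B q.1)
      (((h.smooth.contDiffAt (h.isOpen.mem_nhds hq.1))).comp q contDiffAt_fst)).contDiffWithinAt
  refine hinv.clm_apply ?_
  unfold koszulForm
  refine ContDiffOn.const_smul _ (((hD'.clm_apply hX).clm_apply hY).add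
    ((hD'.clm_apply hY).clm_apply hX) |>.sub ?_)
  refine ContDiffOn.clm_apply ?_ hY
  refine (ContinuousLinearMap.flipₗᵢ ℝ E E ℝ).contDiff.comp_contDiffOn ?_
  refine ContDiffOn.clm_apply ?_ hX
  exact (ContinuousLinearMap.flipₗᵢ ℝ E E (E →L[ℝ] ℝ)).contDiff.comp_contDiffOn hD'

variable {f : P → E → ℝ}

/-- The iterated covariant derivatives of a smooth family of functions with respect to a smooth
family of metrics depend smoothly on all arguments. -/
lemma IsSmoothMetricOn.contDiffOn_iterNabla (h : IsSmoothMetricOn U g B)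
    (hf : ContDiffOn ℝ ∞ (fun z : P × E => f z.1 z.2) U) (k : ℕ) :
    ContDiffOn ℝ ∞ (fun q : (P × E) × (Fin k → E) =>
      iterNabla (g q.1.1) (f q.1.1) k q.1.2 q.2) (U ×ˢ Set.univ) := by
  induction k with
  | zero =>
    exact hf.comp (contDiff_fst (E := P × E) (F := Fin 0 → E)).contDiffOn fun q hq => hq.1
  | succ k ih =>
    simp only [iterNabla]
    have hopen : IsOpen (U ×ˢ (Set.univ : Set (Fin k → E))) := h.isOpen.prod isOpen_univ
    have htail : ContDiff ℝ ∞ (fun X : Fin (k + 1) → E => Fin.tail X) := by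
      refine contDiff_pi.2 fun i => ?_
      exact contDiff_apply ℝ E i.succ
    refine ContDiffOn.sub ?_ (ContDiffOn.sum fun i _ => ?_)
    · intro q hq
      refine ContDiffAt.contDiffWithinAt ?_
      refine ContDiffAt.clm_apply ?_
        ((contDiff_apply ℝ E (0 : Fin (k + 1))).contDiffAt.comp q contDiffAt_snd)
      refine ContDiffAt.fderiv (n := ∞) (m := ∞)
        (f := fun (q : (P × E) × (Fin (k + 1) → E)) (v : E) =>
          iterNabla (g q.1.1) (f q.1.1) k v (Fin.tail q.2)) (g := fun q => q.1.2) ?_ ?_ (by simp)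
      · have h1 := ih.contDiffAt (hopen.mem_nhds
          (show ((q.1.1, q.1.2), Fin.tail q.2) ∈ U ×ˢ (Set.univ : Set (Fin k → E)) from
            ⟨hq.1, trivial⟩))
        have h2 : ContDiffAt ℝ ∞ (fun r : ((P × E) × (Fin (k + 1) → E)) × E =>
            ((r.1.1.1, r.2), Fin.tail r.1.2)) (q, q.1.2) := by
          refine ContDiffAt.prodMk (ContDiffAt.prodMk (by fun_prop) (by fun_prop)) ?_
          exact htail.contDiffAt.comp (q, q.1.2)
            (f := fun r : ((P × E) × (Fin (k + 1) → E)) × E => r.1.2) (by fun_prop)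
        exact ContDiffAt.comp (q, q.1.2)
          (f := fun r : ((P × E) × (Fin (k + 1) → E)) × E => ((r.1.1.1, r.2), Fin.tail r.1.2))
          h1 h2
      · fun_prop
    · have hΓ : ContDiffOn ℝ ∞ (fun q : (P × E) × (Fin (k + 1) → E) =>
          christoffel (g q.1.1) q.1.2 (q.2 0) (q.2 i.succ)) (U ×ˢ Set.univ) :=
        h.contDiffOn_christoffel.comp
          (s := U ×ˢ (Set.univ : Set (Fin (k + 1) → E)))
          (f := fun q : (P × E) × (Fin (k + 1) → E) => (q.1, q.2 0, q.2 i.succ))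
          (by fun_prop) fun q hq => ⟨hq.1, trivial⟩
      refine ih.comp (s := U ×ˢ (Set.univ : Set (Fin (k + 1) → E)))
        (f := fun q : (P × E) × (Fin (k + 1) → E) => (q.1, Function.update (Fin.tail q.2) i
          (christoffel (g q.1.1) q.1.2 (q.2 0) (q.2 i.succ)))) ?_ fun q hq => ⟨hq.1, trivial⟩
      refine contDiffOn_fst.prodMk (contDiffOn_pi.2 fun j => ?_)
      by_cases hj : j = i
      · subst hj
        simpa using hΓ
      · simp only [Function.update_of_ne hj]
        exact ((contDiff_apply ℝ E j.succ).comp contDiff_snd).contDiffOn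

lemma IsSmoothMetricOn.christoffel_add_left (h : IsSmoothMetricOn U g B) {z : P × E} (hz : z ∈ U)
    (X X' Y : E) : christoffel (g z.1) z.2 (X + X') Y =
      christoffel (g z.1) z.2 X Y + christoffel (g z.1) z.2 X' Y := by
  simp only [h.christoffel_eq hz, koszulForm_add_left, map_add]

lemma IsSmoothMetricOn.christoffel_smul_left (h : IsSmoothMetricOn U g B) {z : P × E} (hz : z ∈ U)
    (c : ℝ) (X Y : E) : christoffel (g z.1) z.2 (c • X) Y = c • christoffel (g z.1) z.2 X Y := by
  simp only [h.christoffel_eq hz, koszulForm_smul_left, map_smul]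

lemma IsSmoothMetricOn.christoffel_add_right (h : IsSmoothMetricOn U g B) {z : P × E} (hz : z ∈ U)
    (X Y Y' : E) : christoffel (g z.1) z.2 X (Y + Y') =
      christoffel (g z.1) z.2 X Y + christoffel (g z.1) z.2 X Y' := by
  simp only [h.christoffel_eq hz, koszulForm_add_right, map_add]

lemma IsSmoothMetricOn.christoffel_smul_right (h : IsSmoothMetricOn U g B) {z : P × E} (hz : z ∈ U)
    (c : ℝ) (X Y : E) : christoffel (g z.1) z.2 X (c • Y) = c • christoffel (g z.1) z.2 X Y := by
  simp only [h.christoffel_eq hz, koszulForm_smul_right, map_smul]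

lemma IsSmoothMetricOn.differentiableAt_iterNabla (h : IsSmoothMetricOn U g B)
    (hf : ContDiffOn ℝ ∞ (fun z : P × E => f z.1 z.2) U) (k : ℕ) {z : P × E} (hz : z ∈ U)
    (X : Fin k → E) :
    DifferentiableAt ℝ (fun v => iterNabla (g z.1) (f z.1) k v X) z.2 := by
  have h1 := ((h.contDiffOn_iterNabla hf k).contDiffAt ((h.isOpen.prod isOpen_univ).mem_nhds
    (show (z, X) ∈ U ×ˢ (Set.univ : Set (Fin k → E)) from ⟨hz, trivial⟩))).differentiableAt
    (by simp)
  exact DifferentiableAt.comp z.2 (f := fun v : E => ((z.1, v), X)) h1 (by fun_prop)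

end Geometry

set_option maxSynthPendingDepth 3 in
/-- Positive definite forms are uniformly positive definite near a given parameter. -/
lemma exists_pos_le_of_continuousAt {Z E : Type*} [TopologicalSpace Z] [NormedAddCommGroup E]
    [NormedSpace ℝ E] [FiniteDimensional ℝ E] {B : Z → E →L[ℝ] E →L[ℝ] ℝ} {z : Z}
    (hcont : ContinuousAt B z) (hpos : ∀ X, X ≠ 0 → 0 < B z X X) :
    ∃ c > 0, ∀ᶠ y in 𝓝 z, ∀ X, c * ‖X‖ ^ 2 ≤ B y X X := by
  obtain ⟨c, hc, hcB⟩ : ∃ c > 0, ∀ X, c * ‖X‖ ^ 2 ≤ B z X X := by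
    by_cases hE : Subsingleton E
    · exact ⟨1, one_pos, fun X => by simp [Subsingleton.elim X 0]⟩
    rw [not_subsingleton_iff_nontrivial] at hE
    obtain ⟨Y, hY, hmin⟩ := (isCompact_sphere (0 : E) 1).exists_isMinOn
      (NormedSpace.sphere_nonempty.2 zero_le_one) (f := fun X => B z X X) (by fun_prop)
    have hYn : ‖Y‖ = 1 := by simpa using hY
    refine ⟨B z Y Y, hpos Y (by rintro rfl; simp at hYn), fun X => ?_⟩
    by_cases hX : X = 0
    · simp [hX]
    have hXn : 0 < ‖X‖ := norm_pos_iff.2 hX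
    have := hmin (show ‖X‖⁻¹ • X ∈ Metric.sphere (0 : E) 1 by
      simp [norm_smul, hXn.ne'])
    simp only [map_smul, FunLike.coe_smul, Pi.smul_apply, smul_eq_mul,
      Set.mem_ofPred_eq] at this
    calc B z Y Y * ‖X‖ ^ 2 ≤ (‖X‖⁻¹ * (‖X‖⁻¹ * B z X X)) * ‖X‖ ^ 2 := by gcongr
      _ = B z X X := by field_simp
  refine ⟨c / 2, by positivity, ?_⟩
  have := hcont (Metric.ball_mem_nhds (B z) (half_pos hc))
  filter_upwards [this] with y hy X
  have h1 : ‖B y - B z‖ < c / 2 := (dist_eq_norm (B y) (B z)).symm.trans_lt hy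
  have h2 : |(B y - B z) X X| ≤ ‖B y - B z‖ * ‖X‖ * ‖X‖ := (B y - B z).le_opNorm₂ X X
  have h3 : (B y - B z) X X = B y X X - B z X X := by simp
  have h4 := (abs_le.1 h2).1
  have h5 := hcB X
  have h6 : ‖B y - B z‖ * ‖X‖ * ‖X‖ ≤ c / 2 * ‖X‖ ^ 2 := by
    rw [mul_assoc, ← sq]; gcongr
  rw [h3] at h4
  linarith

section Covariance

variable {P E : Type*} [NormedAddCommGroup P] [NormedSpace ℝ P] [NormedAddCommGroup E]
  [NormedSpace ℝ E]
  {U : Set (P × E)} {g : P → E → E → E → ℝ} {B : P × E → E →L[ℝ] E →L[ℝ] ℝ} {f : P → E → ℝ}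

lemma IsSmoothMetricOn.eventually_mem (h : IsSmoothMetricOn U g B) {z : P × E} (hz : z ∈ U) :
    ∀ᶠ v in 𝓝 z.2, (z.1, v) ∈ U :=
  (Continuous.prodMk_right z.1).continuousAt.eventually (h.isOpen.mem_nhds hz)

lemma hasFDerivAt_fderiv_of_contDiffOn {ψ : E → E} {O : Set E} (hO : IsOpen O) (hψ : ContDiffOn ℝ ∞ ψ O) {u : E}
    (hu : u ∈ O) : HasFDerivAt (fderiv ℝ ψ) (fderiv ℝ (fderiv ℝ ψ) u) u :=
  (((hψ.fderiv_of_isOpen hO (m := ∞) (by simp)).contDiffAt (hO.mem_nhds hu)).differentiableAt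
    (by simp)).hasFDerivAt

variable {p : P} {ψ : E → E} {O : Set E} {g' : E → E → E → ℝ} {f' : E → ℝ}

lemma IsSmoothMetricOn.fderiv_pullback (h : IsSmoothMetricOn U g B) (hO : IsOpen O)
    (hψ : ContDiffOn ℝ ∞ ψ O) (hU : ∀ u ∈ O, (p, ψ u) ∈ U)
    (hg' : ∀ u ∈ O, ∀ X Y, g' u X Y = B (p, ψ u) (fderiv ℝ ψ u X) (fderiv ℝ ψ u Y))
    {u : E} (hu : u ∈ O) (X Y Z : E) :
    fderiv ℝ (fun v => g' v Y Z) u X =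
      spatialDeriv B (p, ψ u) (fderiv ℝ ψ u X) (fderiv ℝ ψ u Y) (fderiv ℝ ψ u Z) +
      B (p, ψ u) (fderiv ℝ (fderiv ℝ ψ) u X Y) (fderiv ℝ ψ u Z) +
      B (p, ψ u) (fderiv ℝ ψ u Y) (fderiv ℝ (fderiv ℝ ψ) u X Z) := by
  have hB : HasFDerivAt B (fderiv ℝ B (p, ψ u)) (p, ψ u) :=
    ((h.smooth.contDiffAt (h.isOpen.mem_nhds (hU u hu))).differentiableAt (by simp)).hasFDerivAt
  have hψu : HasFDerivAt ψ (fderiv ℝ ψ u) u :=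
    ((hψ.contDiffAt (hO.mem_nhds hu)).differentiableAt (by simp)).hasFDerivAt
  have h1 : HasFDerivAt (fun v : E => B (p, ψ v))
      ((spatialDeriv B (p, ψ u)).comp (fderiv ℝ ψ u)) u := by
    have hin : HasFDerivAt (fun v : E => (p, ψ v))
        ((ContinuousLinearMap.inr ℝ P E).comp (fderiv ℝ ψ u)) u :=
      HasFDerivAt.comp (g := fun w => (p, w)) u (hasFDerivAt_prodMk_right p (ψ u)) hψu
    exact HasFDerivAt.comp u (f := fun v : E => (p, ψ v)) (g := B) hB hin
  have hD := hasFDerivAt_fderiv_of_contDiffOn hO hψ hu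
  have h2 := (h1.clm_apply (hD.clm_apply (hasFDerivAt_const Y u))).clm_apply
    (hD.clm_apply (hasFDerivAt_const Z u))
  have hev : (fun v => g' v Y Z) =ᶠ[𝓝 u]
      fun v => B (p, ψ v) (fderiv ℝ ψ v Y) (fderiv ℝ ψ v Z) := by
    filter_upwards [hO.mem_nhds hu] with v hv using hg' v hv Y Z
  rw [hev.fderiv_eq, h2.fderiv]
  simp
  ring

variable [FiniteDimensional ℝ E]

lemma IsSmoothMetricOn.iterNabla_update (h : IsSmoothMetricOn U g B)
    (hf : ContDiffOn ℝ ∞ (fun z : P × E => f z.1 z.2) U) (k : ℕ) :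
    ∀ {z : P × E}, z ∈ U → ∀ (X : Fin k → E) (i : Fin k) (c : ℝ) (x y : E),
    iterNabla (g z.1) (f z.1) k z.2 (Function.update X i (c • x + y)) =
      c * iterNabla (g z.1) (f z.1) k z.2 (Function.update X i x) +
        iterNabla (g z.1) (f z.1) k z.2 (Function.update X i y) := by
  induction k with
  | zero => intro z _ X i; exact i.elim0
  | succ k ih =>
    intro z hz X i c x y
    refine Fin.cases ?_ (fun i => ?_) i
    · simp only [iterNabla, Fin.tail_update_zero, Function.update_self, ne_eq,
        Fin.succ_ne_zero, not_false_eq_true, Function.update_of_ne, map_add, map_smul,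
        h.christoffel_add_left hz, h.christoffel_smul_left hz, ih hz, Finset.sum_add_distrib,
        ← Finset.mul_sum, smul_eq_mul]
      ring
    · have h0 : ∀ v, Function.update X i.succ v 0 = X 0 := fun v =>
        Function.update_of_ne (Fin.succ_ne_zero i).symm _ _
      simp only [iterNabla, Fin.tail_update_succ, h0]
      have hd : ∀ Y : Fin k → E, DifferentiableAt ℝ
          (fun v => iterNabla (g z.1) (f z.1) k v Y) z.2 :=
        fun Y => h.differentiableAt_iterNabla hf k hz Y
      have e1 : (fun v => iterNabla (g z.1) (f z.1) k v
            (Function.update (Fin.tail X) i (c • x + y))) =ᶠ[𝓝 z.2]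
          (fun v => c * iterNabla (g z.1) (f z.1) k v (Function.update (Fin.tail X) i x) +
            iterNabla (g z.1) (f z.1) k v (Function.update (Fin.tail X) i y)) := by
        filter_upwards [h.eventually_mem hz] with v hv
        exact ih (z := (z.1, v)) hv _ _ _ _ _
      rw [e1.fderiv_eq, fderiv_fun_add ((hd _).const_mul c) (hd _), fderiv_const_mul (hd _)]
      have e2 : ∀ j : Fin k, iterNabla (g z.1) (f z.1) k z.2
          (Function.update (Function.update (Fin.tail X) i (c • x + y)) j
            (christoffel (g z.1) z.2 (X 0) (Function.update X i.succ (c • x + y) j.succ))) =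
          c * iterNabla (g z.1) (f z.1) k z.2
          (Function.update (Function.update (Fin.tail X) i x) j
            (christoffel (g z.1) z.2 (X 0) (Function.update X i.succ x j.succ))) +
          iterNabla (g z.1) (f z.1) k z.2
          (Function.update (Function.update (Fin.tail X) i y) j
            (christoffel (g z.1) z.2 (X 0) (Function.update X i.succ y j.succ))) := by
        intro j
        by_cases hj : j = i
        · subst hj
          simp only [Function.update_idem, Function.update_self]
          rw [h.christoffel_add_right hz, h.christoffel_smul_right hz, ih hz]
        · have hj' : j.succ ≠ i.succ := fun e => hj (Fin.succ_injective _ e)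
          simp only [Function.update_of_ne hj']
          rw [Function.update_comm (Ne.symm hj), Function.update_comm (Ne.symm hj),
            Function.update_comm (Ne.symm hj), ih hz]
      rw [Finset.sum_congr rfl fun j _ => e2 j, Finset.sum_add_distrib, ← Finset.mul_sum]
      simp only [_root_.add_apply, FunLike.coe_smul, Pi.smul_apply,
        smul_eq_mul]
      ring

lemma IsSmoothMetricOn.iterNabla_update_add (h : IsSmoothMetricOn U g B)
    (hf : ContDiffOn ℝ ∞ (fun z : P × E => f z.1 z.2) U) (k : ℕ)
    {z : P × E} (hz : z ∈ U) (X : Fin k → E) (i : Fin k) (x y : E) :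
    iterNabla (g z.1) (f z.1) k z.2 (Function.update X i (x + y)) =
      iterNabla (g z.1) (f z.1) k z.2 (Function.update X i x) +
        iterNabla (g z.1) (f z.1) k z.2 (Function.update X i y) := by
  simpa using h.iterNabla_update hf k hz X i 1 x y

lemma IsSmoothMetricOn.iterNabla_update_smul (h : IsSmoothMetricOn U g B)
    (hf : ContDiffOn ℝ ∞ (fun z : P × E => f z.1 z.2) U) (k : ℕ)
    {z : P × E} (hz : z ∈ U) (X : Fin k → E) (i : Fin k) (c : ℝ) (x : E) :
    iterNabla (g z.1) (f z.1) k z.2 (Function.update X i (c • x)) =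
      c * iterNabla (g z.1) (f z.1) k z.2 (Function.update X i x) := by
  have h0 : iterNabla (g z.1) (f z.1) k z.2 (Function.update X i 0) = 0 := by
    simpa using h.iterNabla_update hf k hz X i 1 0 0
  simpa [h0] using h.iterNabla_update hf k hz X i c x 0

lemma IsSmoothMetricOn.contDiffAt_iterNabla (h : IsSmoothMetricOn U g B)
    (hf : ContDiffOn ℝ ∞ (fun z : P × E => f z.1 z.2) U) (k : ℕ) {z : P × E} (hz : z ∈ U)
    (X : Fin k → E) : ContDiffAt ℝ ∞ (fun q : (P × E) × (Fin k → E) =>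
      iterNabla (g q.1.1) (f q.1.1) k q.1.2 q.2) (z, X) :=
  (h.contDiffOn_iterNabla hf k).contDiffAt ((h.isOpen.prod isOpen_univ).mem_nhds
    (show (z, X) ∈ U ×ˢ (Set.univ : Set (Fin k → E)) from ⟨hz, trivial⟩))

/-- The covariant derivatives at a point as a continuous multilinear map. -/
def IsSmoothMetricOn.iterNablaMultilinear (h : IsSmoothMetricOn U g B)
    (hf : ContDiffOn ℝ ∞ (fun z : P × E => f z.1 z.2) U) (k : ℕ) {z : P × E} (hz : z ∈ U) :
    ContinuousMultilinearMap ℝ (fun _ : Fin k => E) ℝ where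
  toFun X := iterNabla (g z.1) (f z.1) k z.2 X
  map_update_add' X i x y := by
    convert h.iterNabla_update_add hf k hz X i x y
  map_update_smul' X i c x := by
    rw [smul_eq_mul]
    convert h.iterNabla_update_smul hf k hz X i c x
  cont := by
    rw [continuous_iff_continuousAt]
    intro X
    exact ContinuousAt.comp (f := fun X : Fin k → E => (z, X))
      (h.contDiffAt_iterNabla hf k hz X).continuousAt (by fun_prop)

lemma IsSmoothMetricOn.christoffel_pullback (h : IsSmoothMetricOn U g B) (hO : IsOpen O)
    (hψ : ContDiffOn ℝ ∞ ψ O) (hU : ∀ u ∈ O, (p, ψ u) ∈ U)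
    (hinj : ∀ u ∈ O, Function.Injective (fderiv ℝ ψ u))
    (hg' : ∀ u ∈ O, ∀ X Y, g' u X Y = B (p, ψ u) (fderiv ℝ ψ u X) (fderiv ℝ ψ u Y))
    {u : E} (hu : u ∈ O) (X Y : E) :
    fderiv ℝ ψ u (christoffel g' u X Y) =
      fderiv ℝ (fderiv ℝ ψ) u X Y +
        christoffel (g p) (ψ u) (fderiv ℝ ψ u X) (fderiv ℝ ψ u Y) := by
  set D := fderiv ℝ ψ u with hD
  have hsymm : ∀ V W, fderiv ℝ (fderiv ℝ ψ) u V W = fderiv ℝ (fderiv ℝ ψ) u W V :=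
    (hψ.contDiffAt (hO.mem_nhds hu)).isSymmSndFDerivAt (by simp only [minSmoothness_of_isRCLikeNormedField]; exact ENat.LEInfty.out)
  have hK : ∀ Z, koszul g' u X Y Z =
      ((koszulForm B (p, ψ u) (D X) (D Y) + B (p, ψ u) (fderiv ℝ (fderiv ℝ ψ) u X Y)).comp D) Z := by
    intro Z
    unfold koszul
    rw [h.fderiv_pullback hO hψ hU hg' hu, h.fderiv_pullback hO hψ hU hg' hu,
      h.fderiv_pullback hO hψ hU hg' hu, hsymm Y X, hsymm Z X, hsymm Z Y,
      h.symm _ (hU u hu) (fderiv ℝ (fderiv ℝ ψ) u X Z)]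
    change _ = 2⁻¹ * (spatialDeriv B (p, ψ u) (D X) (D Y) (D Z) +
      spatialDeriv B (p, ψ u) (D Y) (D X) (D Z) - spatialDeriv B (p, ψ u) (D Z) (D X) (D Y)) +
        B (p, ψ u) (fderiv ℝ (fderiv ℝ ψ) u X Y) (D Z)
    simp only [← hD]
    ring
  have hsurj : Function.Surjective D :=
    (LinearMap.injective_iff_surjective (f := (D : E →ₗ[ℝ] E))).1 (hinj u hu)
  have hspec := christoffel_spec (g := g') (u := u) (X := X) (Y := Y)
    ((ContinuousLinearMap.coeLMₛₗ (RingHom.id ℝ) ∘ₗ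
      (B (p, ψ u) : E →ₗ[ℝ] E →L[ℝ] ℝ)).compl₁₂ (D : E →ₗ[ℝ] E) (D : E →ₗ[ℝ] E))
    (fun V Z => hg' u hu V Z)
    (fun V hV => h.pos _ (hU u hu) (D V) fun h0 => hV (hinj u hu (by rw [← hD, h0, map_zero])))
    ((koszulForm B (p, ψ u) (D X) (D Y) + B (p, ψ u) (fderiv ℝ (fderiv ℝ ψ) u X Y)).comp D :
      E →ₗ[ℝ] ℝ) hK
  refine h.ext (hU u hu) fun W => ?_
  obtain ⟨Z, rfl⟩ := hsurj W
  have h1 := hspec Z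
  rw [hK, hg' u hu] at h1
  rw [h1, map_add]
  have h2 := h.christoffel_spec' (hU u hu) (D X) (D Y) (D Z)
  simp only [ContinuousLinearMap.comp_apply, _root_.add_apply] at h2 ⊢
  rw [h2]
  ring

/-- The iterated covariant derivatives are natural under local diffeomorphisms. -/
lemma IsSmoothMetricOn.iterNabla_pullback (h : IsSmoothMetricOn U g B)
    (hf : ContDiffOn ℝ ∞ (fun z : P × E => f z.1 z.2) U) (hO : IsOpen O)
    (hψ : ContDiffOn ℝ ∞ ψ O) (hU : ∀ u ∈ O, (p, ψ u) ∈ U)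
    (hinj : ∀ u ∈ O, Function.Injective (fderiv ℝ ψ u))
    (hg' : ∀ u ∈ O, ∀ X Y, g' u X Y = B (p, ψ u) (fderiv ℝ ψ u X) (fderiv ℝ ψ u Y))
    (hf' : ∀ u ∈ O, f' u = f p (ψ u)) (k : ℕ) :
    ∀ u ∈ O, ∀ X : Fin k → E, iterNabla g' f' k u X =
      iterNabla (g p) (f p) k (ψ u) (fun i => fderiv ℝ ψ u (X i)) := by
  induction k with
  | zero => intro u hu X; exact hf' u hu
  | succ k ih =>
    intro u hu X
    set D := fderiv ℝ ψ u with hD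
    set Y : Fin k → E := fun i => D (X i.succ) with hY
    set H : Fin k → E := fun i => fderiv ℝ (fderiv ℝ ψ) u (X 0) (X i.succ) with hH
    simp only [iterNabla]
    have hψu : HasFDerivAt ψ D u :=
      ((hψ.contDiffAt (hO.mem_nhds hu)).differentiableAt (by simp)).hasFDerivAt
    have hTd : DifferentiableAt ℝ (fun q : E × (Fin k → E) =>
        iterNabla (g p) (f p) k q.1 q.2) (ψ u, Y) := by
      have := (h.contDiffAt_iterNabla hf k (hU u hu) Y).differentiableAt (by simp)
      exact DifferentiableAt.comp (ψ u, Y) (f := fun q : E × (Fin k → E) => ((p, q.1), q.2))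
        this (by fun_prop)
    set T := fderiv ℝ (fun q : E × (Fin k → E) => iterNabla (g p) (f p) k q.1 q.2) (ψ u, Y) with hT
    have hTf : HasFDerivAt (fun q : E × (Fin k → E) =>
        iterNabla (g p) (f p) k q.1 q.2) T (ψ u, Y) := hTd.hasFDerivAt
    have hDY : HasFDerivAt (fun v => fun i : Fin k => fderiv ℝ ψ v (X i.succ))
        (ContinuousLinearMap.pi fun i : Fin k => (fderiv ℝ (fderiv ℝ ψ) u).flip (X i.succ)) u := by
      rw [hasFDerivAt_pi]
      intro i
      have := (hasFDerivAt_fderiv_of_contDiffOn hO hψ hu).clm_apply (hasFDerivAt_const (X i.succ) u)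
      convert this using 1
      ext V
      simp
    have hcomp := HasFDerivAt.comp u (f := fun v => (ψ v, fun i : Fin k => fderiv ℝ ψ v (X i.succ)))
      hTf (hψu.prodMk hDY)
    have hev : (fun v => iterNabla g' f' k v (Fin.tail X)) =ᶠ[𝓝 u]
        (fun q : E × (Fin k → E) => iterNabla (g p) (f p) k q.1 q.2) ∘
          fun v => (ψ v, fun i : Fin k => fderiv ℝ ψ v (X i.succ)) := by
      filter_upwards [hO.mem_nhds hu] with v hv using ih v hv _
    have hlhs : fderiv ℝ (fun v => iterNabla g' f' k v (Fin.tail X)) u (X 0) =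
        T (D (X 0), H) := by
      rw [hev.fderiv_eq, hcomp.fderiv]
      rfl
    have hsplit : T (D (X 0), H) = T (D (X 0), 0) + T (0, H) := by
      rw [← map_add]
      simp
    have h1 : fderiv ℝ (fun v => iterNabla (g p) (f p) k v Y) (ψ u) (D (X 0)) =
        T (D (X 0), 0) := by
      have := HasFDerivAt.comp (ψ u) (f := fun v : E => (v, Y)) hTf
        (hasFDerivAt_prodMk_left (ψ u) Y)
      have h2 : fderiv ℝ (fun v => iterNabla (g p) (f p) k v Y) (ψ u) =
          T.comp (ContinuousLinearMap.inl ℝ E (Fin k → E)) := this.fderiv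
      rw [h2]
      simp
    have h2 : T (0, H) = ∑ i, iterNabla (g p) (f p) k (ψ u) (Function.update Y i (H i)) := by
      have e1 := HasFDerivAt.comp Y (f := fun W : Fin k → E => (ψ u, W)) hTf
        (hasFDerivAt_prodMk_right (ψ u) Y)
      have e2 := (h.iterNablaMultilinear hf k (hU u hu)).hasFDerivAt Y
      have e3 := congrArg (fun L => L H) (e1.unique e2)
      simp only [ContinuousLinearMap.comp_apply, ContinuousLinearMap.inr_apply] at e3
      rw [e3, ContinuousMultilinearMap.linearDeriv_apply]
      rfl
    have h3 : ∀ i : Fin k, iterNabla g' f' k u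
          (Function.update (Fin.tail X) i (christoffel g' u (X 0) (X i.succ))) =
        iterNabla (g p) (f p) k (ψ u) (Function.update Y i (H i)) +
        iterNabla (g p) (f p) k (ψ u) (Function.update Y i
          (christoffel (g p) (ψ u) (D (X 0)) (D (X i.succ)))) := by
      intro i
      rw [ih u hu, ← h.iterNabla_update_add hf k (hU u hu),
        ← h.christoffel_pullback hO hψ hU hinj hg' hu]
      congr 1
      ext j
      by_cases hj : j = i
      · subst hj; simp
      · simp [Function.update_of_ne hj, hY, Fin.tail, hD]
    rw [hlhs, hsplit, h2, Finset.sum_congr rfl fun i _ => h3 i, Finset.sum_add_distrib, ← h1]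
    change _ = fderiv ℝ (fun v => iterNabla (g p) (f p) k v Y) (ψ u) (D (X 0)) -
      ∑ i, iterNabla (g p) (f p) k (ψ u) (Function.update Y i
          (christoffel (g p) (ψ u) (D (X 0)) (D (X i.succ))))
    ring

/-- Near a given parameter, the norms of the covariant derivatives are bounded. -/
lemma IsSmoothMetricOn.exists_frameNorm_le (h : IsSmoothMetricOn U g B)
    (hf : ContDiffOn ℝ ∞ (fun z : P × E => f z.1 z.2) U) (k : ℕ) (ι : Type*) [Fintype ι]
    [DecidableEq ι] {p₀ : P} {u₀ : E} (hz : (p₀, u₀) ∈ U) :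
    ∃ C, ∀ᶠ p in 𝓝 p₀, ∀ e : ι → E, IsOrthonormalFrame (g p) u₀ e →
      frameNorm e (iterNabla (g p) (f p) k u₀) ≤ C := by
  obtain ⟨c, hc, hcB⟩ := exists_pos_le_of_continuousAt
    (h.smooth.contDiffAt (h.isOpen.mem_nhds hz)).continuousAt (h.pos _ hz)
  have hslice : Filter.Tendsto (fun p : P => (p, u₀)) (𝓝 p₀) (𝓝 (p₀, u₀)) :=
    (Continuous.prodMk_left u₀).continuousAt
  have hU := hslice.eventually (h.isOpen.mem_nhds hz)
  have hK : ∃ C, ∀ᶠ p in 𝓝 p₀, ∀ X ∈ Metric.closedBall (0 : Fin k → E) (Real.sqrt c⁻¹),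
      |iterNabla (g p) (f p) k u₀ X| ≤ C := by
    refine (isCompact_closedBall (0 : Fin k → E) (Real.sqrt c⁻¹)).induction_on
      (p := fun s => ∃ C, ∀ᶠ p in 𝓝 p₀, ∀ X ∈ s, |iterNabla (g p) (f p) k u₀ X| ≤ C) ?_ ?_ ?_ ?_
    · exact ⟨0, by simp⟩
    · rintro s t hst ⟨C, hC⟩
      exact ⟨C, hC.mono fun p hp X hX => hp X (hst hX)⟩
    · rintro s t ⟨C, hC⟩ ⟨C', hC'⟩
      refine ⟨max C C', ?_⟩
      filter_upwards [hC, hC'] with p h1 h2 X hX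
      rcases hX with hX | hX
      · exact (h1 X hX).trans (le_max_left _ _)
      · exact (h2 X hX).trans (le_max_right _ _)
    · intro X _
      have hcont : ContinuousAt (fun q : P × (Fin k → E) =>
          iterNabla (g q.1) (f q.1) k u₀ q.2) (p₀, X) :=
        ContinuousAt.comp (x := (p₀, X)) (f := fun q : P × (Fin k → E) => ((q.1, u₀), q.2))
          (g := fun q : (P × E) × (Fin k → E) => iterNabla (g q.1.1) (f q.1.1) k q.1.2 q.2)
          (h.contDiffAt_iterNabla hf k hz X).continuousAt (by fun_prop)
      have hb : ∀ᶠ q in 𝓝 p₀ ×ˢ 𝓝 X, |iterNabla (g q.1) (f q.1) k u₀ q.2| <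
          |iterNabla (g p₀) (f p₀) k u₀ X| + 1 := by
        rw [← nhds_prod_eq]
        exact hcont.abs.eventually (gt_mem_nhds (lt_add_one _))
      obtain ⟨pa, hpa, pb, hpb, hab⟩ := Filter.eventually_prod_iff.1 hb
      exact ⟨_, mem_nhdsWithin_of_mem_nhds hpb, |iterNabla (g p₀) (f p₀) k u₀ X| + 1,
        hpa.mono fun p hp Y hY => (hab hp hY).le⟩
  obtain ⟨C, hC⟩ := hK
  refine ⟨Real.sqrt (∑ _I : Fin k → ι, C ^ 2), ?_⟩
  filter_upwards [hC, hU, hslice.eventually hcB] with p hp hpU hpc e he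
  refine Real.sqrt_le_sqrt (Finset.sum_le_sum fun I _ => ?_)
  rw [← sq_abs]
  refine pow_le_pow_left₀ (abs_nonneg _) (hp _ ?_) 2
  rw [mem_closedBall_zero_iff, pi_norm_le_iff_of_nonneg (Real.sqrt_nonneg _)]
  intro i
  refine Real.le_sqrt_of_sq_le ?_
  have h1 := hpc (e (I i))
  have h2 := he (I i) (I i)
  rw [h.eq (p, u₀) hpU, if_pos rfl] at h2
  rw [h2] at h1
  rw [← one_div, le_div_iff₀ hc]
  linarith

end Covariance

section Holomorphic

variable {n : ℕ} {G : Type} [NormedAddCommGroup G] [NormedSpace ℂ G] [FiniteDimensional ℂ G]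

open MeasureTheory in
lemma differentiableAt_fderiv_apply {f : (Fin n → ℂ) → G} {u₀ : Fin n → ℂ}
    (hf : ∀ᶠ u in 𝓝 u₀, DifferentiableAt ℂ f u) (Y : Fin n → ℂ) :
    DifferentiableAt ℂ (fun v => fderiv ℂ f v Y) u₀ := by
  have : CompleteSpace G := FiniteDimensional.complete ℂ G
  obtain ⟨ε, hε, hball⟩ : ∃ ε > 0, ∀ u ∈ Metric.ball u₀ ε, DifferentiableAt ℂ f u ∧
      ‖f u‖ ≤ ‖f u₀‖ + 1 := by
    have hcont : ContinuousAt f u₀ := hf.self_of_nhds.continuousAt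
    have := hf.and (hcont.norm.eventually (ge_mem_nhds (lt_add_one ‖f u₀‖)))
    exact Metric.eventually_nhds_iff_ball.1 this
  set M := ‖f u₀‖ + 1
  have hM : 0 ≤ M := by positivity
  -- Cauchy estimate
  have hder : ∀ v, ∀ Z : Fin n → ℂ, v ∈ Metric.ball u₀ ε →
      deriv (fun s : ℂ => f (v + s • Z)) 0 = fderiv ℂ f v Z := by
    intro v Z hv
    have h1 : HasFDerivAt f (fderiv ℂ f v) (v + (0 : ℂ) • Z) := by
      simpa using (hball v hv).1.hasFDerivAt
    have h2 : HasDerivAt (fun s : ℂ => v + s • Z) Z 0 := by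
      simpa using ((hasDerivAt_id (0 : ℂ)).smul_const Z).const_add v
    exact (h1.comp_hasDerivAt (0 : ℂ) h2).deriv
  have hmem : ∀ v ∈ Metric.ball u₀ (ε / 2), ∀ Z : Fin n → ℂ, ∀ s : ℂ, ‖s • Z‖ ≤ ε / 4 →
      v + s • Z ∈ Metric.ball u₀ (ε * (3 / 4)) := by
    intro v hv Z s hs
    rw [mem_ball_iff_norm] at hv ⊢
    calc ‖v + s • Z - u₀‖ = ‖(v - u₀) + s • Z‖ := by congr 1; abel
      _ ≤ ‖v - u₀‖ + ‖s • Z‖ := norm_add_le _ _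
      _ < ε * (3 / 4) := by linarith
  have hsub : Metric.ball u₀ (ε * (3 / 4)) ⊆ Metric.ball u₀ ε :=
    Metric.ball_subset_ball (by linarith)
  have hdiff : ∀ v ∈ Metric.ball u₀ (ε / 2), ∀ Z : Fin n → ℂ, ∀ s : ℂ, ‖s • Z‖ ≤ ε / 4 →
      DifferentiableAt ℂ (fun s : ℂ => f (v + s • Z)) s := by
    intro v hv Z s hs
    exact DifferentiableAt.comp s (f := fun s : ℂ => v + s • Z)
      (hball _ (hsub (hmem v hv Z s hs))).1 (by fun_prop)
  by_cases hY : Y = 0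
  · simp [hY]
  have hYn : 0 < ‖Y‖ := norm_pos_iff.2 hY
  set r := ε / 8 / ‖Y‖ with hr
  have hr0 : 0 < r := by positivity
  have hrY : r * ‖Y‖ = ε / 8 := by rw [hr]; field_simp
  have hdc : ∀ v ∈ Metric.ball u₀ (ε / 2), ∀ Z : Fin n → ℂ, ∀ R : ℝ, 0 < R → R * ‖Z‖ ≤ ε / 4 →
      DiffContOnCl ℂ (fun s : ℂ => f (v + s • Z)) (Metric.ball 0 R) := by
    intro v hv Z R hR hRZ
    refine DifferentiableOn.diffContOnCl ?_
    rw [closure_ball _ hR.ne']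
    intro s hs
    refine (hdiff v hv Z s ?_).differentiableWithinAt
    rw [norm_smul]
    refine (mul_le_mul_of_nonneg_right ?_ (norm_nonneg _)).trans hRZ
    simpa using hs
  have hbd : ∀ v ∈ Metric.ball u₀ (ε / 2), ‖fderiv ℂ f v‖ ≤ M / (ε / 4) := by
    intro v hv
    refine ContinuousLinearMap.opNorm_le_of_unit_norm (by positivity) fun Z hZ => ?_
    rw [← hder v Z (Metric.ball_subset_ball (by linarith) hv)]
    refine Complex.norm_deriv_le_of_forall_mem_sphere_norm_le (by positivity)
      (hdc v hv Z (ε / 4) (by positivity) (by rw [hZ]; linarith)) fun s hs => ?_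
    refine (hball _ (hsub (hmem v hv Z s ?_))).2
    rw [norm_smul, hZ, mul_one]
    simpa using (le_of_eq (by simpa using hs))
  have hcauchy : ∀ v ∈ Metric.ball u₀ (ε / 4), fderiv ℂ f v Y =
      (2 * Real.pi * Complex.I : ℂ)⁻¹ • ∫ θ in (0 : ℝ)..2 * Real.pi,
        deriv (circleMap 0 r) θ • ((1 / (circleMap 0 r θ - 0) ^ 2) •
          f (v + circleMap 0 r θ • Y)) := by
    intro v hv
    have key := DiffContOnCl.deriv_eq_smul_circleIntegral hr0
      (hdc v (Metric.ball_subset_ball (by linarith) hv) Y r hr0 (by rw [hrY]; linarith))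
    rw [hder v Y (Metric.ball_subset_ball (by linarith) hv)] at key
    rw [eq_inv_smul_iff₀ (by simp [Real.pi_ne_zero]), ← key]
    rfl
  have hcY : ∀ θ, ‖circleMap 0 r θ • Y‖ ≤ ε / 4 := by
    intro θ
    rw [norm_smul, norm_circleMap_zero, abs_of_pos hr0, hrY]
    linarith
  set wt : ℝ → ℂ := fun θ => deriv (circleMap 0 r) θ * (1 / (circleMap 0 r θ - 0) ^ 2) with hwt
  have hwtc : Continuous wt := by
    rw [hwt]
    simp only [deriv_circleMap, sub_zero]
    refine ((continuous_circleMap 0 r).mul continuous_const).mul ?_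
    exact continuous_const.div ((continuous_circleMap 0 r).pow 2) fun θ =>
      pow_ne_zero 2 (circleMap_ne_center hr0.ne')
  have hcF : ∀ v ∈ Metric.ball u₀ (ε / 4), Continuous
      fun θ => wt θ • f (v + circleMap 0 r θ • Y) := by
    intro v hv
    refine hwtc.smul ?_
    rw [continuous_iff_continuousAt]
    intro θ
    have h1 := (hball _ (hsub (hmem v (Metric.ball_subset_ball (by linarith) hv) Y _
      (hcY θ)))).1.continuousAt
    exact ContinuousAt.comp (f := fun θ => v + circleMap 0 r θ • Y) h1
      ((continuous_const.add ((continuous_circleMap 0 r).smul continuous_const)).continuousAt)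
  have hintegral : HasFDerivAt (fun v => ∫ θ in (0 : ℝ)..2 * Real.pi,
      wt θ • f (v + circleMap 0 r θ • Y))
      (∫ θ in (0 : ℝ)..2 * Real.pi, wt θ • fderiv ℂ f (u₀ + circleMap 0 r θ • Y)) u₀ := by
    refine intervalIntegral.hasFDerivAt_integral_of_dominated_of_fderiv_le
      (bound := fun θ => ‖wt θ‖ * (M / (ε / 4)))
      (F' := fun v θ => wt θ • fderiv ℂ f (v + circleMap 0 r θ • Y))
      (Metric.ball_mem_nhds u₀ (show 0 < ε / 4 by positivity)) ?_ ?_ ?_ ?_ ?_ ?_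
    · filter_upwards [Metric.ball_mem_nhds u₀ (show 0 < ε / 4 by positivity)] with v hv
      exact (hcF v hv).aestronglyMeasurable
    · exact (hcF u₀ (Metric.mem_ball_self (by positivity))).intervalIntegrable _ _
    · have : ProperSpace ((Fin n → ℂ) →L[ℂ] G) := FiniteDimensional.proper ℂ _
      refine AEStronglyMeasurable.smul hwtc.aestronglyMeasurable ?_
      refine Measurable.aestronglyMeasurable ?_
      exact (measurable_fderiv ℂ f).comp (continuous_const.add
        ((continuous_circleMap 0 r).smul continuous_const)).measurable
    · refine Filter.Eventually.of_forall fun θ _ v hv => ?_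
      rw [norm_smul]
      refine mul_le_mul_of_nonneg_left (hbd _ ?_) (norm_nonneg _)
      rw [mem_ball_iff_norm] at hv ⊢
      have := hcY θ
      calc ‖v + circleMap 0 r θ • Y - u₀‖ = ‖(v - u₀) + circleMap 0 r θ • Y‖ := by congr 1; abel
        _ ≤ ‖v - u₀‖ + ‖circleMap 0 r θ • Y‖ := norm_add_le _ _
        _ < ε / 2 := by linarith
    · exact (hwtc.norm.mul continuous_const).intervalIntegrable _ _
    · refine Filter.Eventually.of_forall fun θ _ v hv => ?_
      have h1 := (hball _ (hsub (hmem v (Metric.ball_subset_ball (by linarith) hv) Y _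
        (hcY θ)))).1.hasFDerivAt
      have h2 : HasFDerivAt (fun x => f (x + circleMap 0 r θ • Y))
          (fderiv ℂ f (v + circleMap 0 r θ • Y)) v :=
        (hasFDerivAt_comp_add_right (circleMap 0 r θ • Y)).2 h1
      exact h2.const_smul (wt θ)
  refine
    (hintegral.differentiableAt.const_smul (2 * Real.pi * Complex.I : ℂ)⁻¹).congr_of_eventuallyEq ?_
  filter_upwards [Metric.ball_mem_nhds u₀ (show 0 < ε / 4 by positivity)] with v hv
  rw [hcauchy v hv]
  simp only [hwt, smul_smul]
  rfl

/-- Complex differentiable functions of several variables are smooth. -/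
theorem contDiffOn_of_differentiableOn_complex {f : (Fin n → ℂ) → G} {s : Set (Fin n → ℂ)}
    (hs : IsOpen s) (hf : DifferentiableOn ℂ f s) : ContDiffOn ℂ ∞ f s := by
  rw [contDiffOn_infty]
  intro k
  induction k generalizing G with
  | zero => exact contDiffOn_zero.2 hf.continuousOn
  | succ k ih =>
    rw [Nat.cast_succ, contDiffOn_succ_iff_fderiv_of_isOpen hs]
    refine ⟨hf, by simp, ih fun u hu => ?_⟩
    refine DifferentiableAt.differentiableWithinAt ?_
    have hev : ∀ᶠ v in 𝓝 u, DifferentiableAt ℂ f v := by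
      filter_upwards [hs.mem_nhds hu] with v hv using (hf v hv).differentiableAt (hs.mem_nhds hv)
    have hrep : fderiv ℂ f = fun v => ∑ i, (ContinuousLinearMap.proj (R := ℂ) (φ := fun _ : Fin n => ℂ)
        i).smulRight (fderiv ℂ f v (Pi.single i 1)) := by
      ext1 v
      ext1 y
      conv_lhs => rw [pi_eq_sum_univ' y]
      simp [map_sum]
    rw [hrep]
    refine DifferentiableAt.fun_sum fun i _ => ?_
    exact ((ContinuousLinearMap.smulRightL ℂ (Fin n → ℂ) G) (ContinuousLinearMap.proj i)
      ).differentiableAt.comp u (differentiableAt_fderiv_apply hev _)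

end Holomorphic

section Levi

variable {n : ℕ}

lemma hess_eq_fderiv_fderiv {ρ : (Fin n → ℂ) → ℝ} {u : Fin n → ℂ} (hρ : ContDiffAt ℝ 2 ρ u)
    (X Y : Fin n → ℂ) : hess ρ u X Y = fderiv ℝ (fderiv ℝ ρ) u X Y := by
  have h1 : HasFDerivAt (fderiv ℝ ρ) (fderiv ℝ (fderiv ℝ ρ) u) u :=
    ((hρ.fderiv_right (m := 1) (by norm_num)).differentiableAt (by simp)).hasFDerivAt
  unfold hess
  rw [(h1.clm_apply (hasFDerivAt_const Y u)).fderiv]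
  simp

/-- The chain rule for second derivatives. -/
lemma fderiv_fderiv_comp {E V W : Type*} [NormedAddCommGroup E] [NormedSpace ℝ E]
    [NormedAddCommGroup V] [NormedSpace ℝ V] [NormedAddCommGroup W] [NormedSpace ℝ W]
    {f : V → W} {τ : E → V} {u : E} (hf : ContDiffAt ℝ 2 f (τ u)) (hτ : ContDiffAt ℝ 2 τ u)
    (X Y : E) : fderiv ℝ (fderiv ℝ (fun v => f (τ v))) u X Y =
      fderiv ℝ (fderiv ℝ f) (τ u) (fderiv ℝ τ u X) (fderiv ℝ τ u Y) +
        fderiv ℝ f (τ u) (fderiv ℝ (fderiv ℝ τ) u X Y) := by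
  have hf1 : HasFDerivAt (fderiv ℝ f) (fderiv ℝ (fderiv ℝ f) (τ u)) (τ u) :=
    ((hf.fderiv_right (m := 1) (by norm_num)).differentiableAt (by simp)).hasFDerivAt
  have hτ1 : HasFDerivAt (fderiv ℝ τ) (fderiv ℝ (fderiv ℝ τ) u) u :=
    ((hτ.fderiv_right (m := 1) (by norm_num)).differentiableAt (by simp)).hasFDerivAt
  have hτ0 : HasFDerivAt τ (fderiv ℝ τ u) u := (hτ.differentiableAt (by simp)).hasFDerivAt
  have hev : fderiv ℝ (fun v => f (τ v)) =ᶠ[𝓝 u]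
      fun v => (fderiv ℝ f (τ v)).comp (fderiv ℝ τ v) := by
    have e1 : ∀ᶠ v in 𝓝 u, ContDiffAt ℝ 2 τ v := hτ.eventually (by simp)
    have e2 : ∀ᶠ v in 𝓝 u, ContDiffAt ℝ 2 f (τ v) :=
      hτ.continuousAt.eventually (hf.eventually (by simp))
    filter_upwards [e1, e2] with v h1 h2
    exact fderiv_comp v (h2.differentiableAt (by simp)) (h1.differentiableAt (by simp))
  have hc := HasFDerivAt.clm_comp (HasFDerivAt.comp u hf1 hτ0) hτ1
  rw [hev.fderiv_eq]
  have := hc.fderiv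
  simp only [Function.comp_def] at this
  rw [this]
  simp [add_comm]

lemma fderiv_real_eq_complex {E V : Type*} [NormedAddCommGroup E] [NormedSpace ℂ E]
    [NormedAddCommGroup V] [NormedSpace ℂ V] {τ : E → V} {u : E} (hτ : DifferentiableAt ℂ τ u)
    (X : E) : fderiv ℝ τ u X = fderiv ℂ τ u X := by
  rw [hτ.fderiv_restrictScalars ℝ]
  rfl

lemma fderiv_fderiv_real_eq_complex {E V : Type*} [NormedAddCommGroup E] [NormedSpace ℂ E]
    [NormedAddCommGroup V] [NormedSpace ℂ V] {τ : E → V} {u : E} (hτ : ContDiffAt ℂ 2 τ u)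
    (X Y : E) : fderiv ℝ (fderiv ℝ τ) u X Y = fderiv ℂ (fderiv ℂ τ) u X Y := by
  have h1 : HasFDerivAt (fderiv ℂ τ) (fderiv ℂ (fderiv ℂ τ) u) u :=
    ((hτ.fderiv_right (m := 1) (by norm_num)).differentiableAt (by simp)).hasFDerivAt
  have h2 := (h1.clm_apply (hasFDerivAt_const Y u)).restrictScalars ℝ
  have hτR : ContDiffAt ℝ 2 τ u := hτ.restrict_scalars ℝ
  have h3 : HasFDerivAt (fderiv ℝ τ) (fderiv ℝ (fderiv ℝ τ) u) u :=
    ((hτR.fderiv_right (m := 1) (by norm_num)).differentiableAt (by simp)).hasFDerivAt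
  have h4 := h3.clm_apply (hasFDerivAt_const Y u)
  have hev : (fun v => fderiv ℝ τ v Y) =ᶠ[𝓝 u] fun v => fderiv ℂ τ v Y := by
    filter_upwards [hτ.eventually (by simp)] with v hv
    exact fderiv_real_eq_complex (hv.differentiableAt (by simp)) Y
  have h5 := congrArg (fun L => L X) ((h4.congr_of_eventuallyEq hev.symm).unique h2)
  simpa using h5

lemma levi_comp {k : ℕ} {ρ : (Fin k → ℂ) → ℝ} {ψ : (Fin n → ℂ) → (Fin k → ℂ)} {u : Fin n → ℂ}
    (hρ : ContDiffAt ℝ 2 ρ (ψ u)) (hψ : ContDiffAt ℂ 2 ψ u) (X Y : Fin n → ℂ) :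
    levi (fun v => ρ (ψ v)) u X Y = levi ρ (ψ u) (fderiv ℂ ψ u X) (fderiv ℂ ψ u Y) := by
  have hψR : ContDiffAt ℝ 2 ψ u := hψ.restrict_scalars ℝ
  have hc : ContDiffAt ℝ 2 (fun v => ρ (ψ v)) u := hρ.comp u hψR
  unfold levi
  simp only [hess_eq_fderiv_fderiv hc, hess_eq_fderiv_fderiv hρ, fderiv_fderiv_comp hρ hψR,
    fderiv_real_eq_complex (hψ.differentiableAt (by simp)), fderiv_fderiv_real_eq_complex hψ,
    map_smul]
  simp only [FunLike.coe_smul, Pi.smul_apply, smul_smul, Complex.I_mul_I, neg_smul, one_smul, map_neg]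
  push_cast
  ring

lemma levi_re_comp {V : Type*} [NormedAddCommGroup V] [NormedSpace ℝ V] {W : Type*}
    [NormedAddCommGroup W] [NormedSpace ℂ W] (T : W →L[ℝ] V)
    {G : V → ℝ} {lam : (Fin n → ℂ) → W} {u : Fin n → ℂ}
    (hG : ContDiffAt ℝ 2 G (T (lam u))) (hlam : ContDiffAt ℂ 2 lam u) (X : Fin n → ℂ) :
    (levi (fun v => G (T (lam v))) u X X).re =
      (fderiv ℝ (fderiv ℝ G) (T (lam u)) (T (fderiv ℂ lam u X)) (T (fderiv ℂ lam u X)) +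
      fderiv ℝ (fderiv ℝ G) (T (lam u)) (T (Complex.I • fderiv ℂ lam u X))
        (T (Complex.I • fderiv ℂ lam u X))) / 4 := by
  have hlR : ContDiffAt ℝ 2 lam u := hlam.restrict_scalars ℝ
  have hT : ContDiffAt ℝ 2 T (lam u) := T.contDiff.contDiffAt
  have hTl : ContDiffAt ℝ 2 (fun v => T (lam v)) u := hT.comp u hlR
  have hc : ContDiffAt ℝ 2 (fun v => G (T (lam v))) u := ContDiffAt.comp u hG hTl
  have hd1 : ∀ Y, fderiv ℝ (fun v => T (lam v)) u Y = T (fderiv ℂ lam u Y) := by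
    intro Y
    have := (T.hasFDerivAt.comp u (hlR.differentiableAt (by simp)).hasFDerivAt).fderiv
    simp only [Function.comp_def] at this
    rw [this]
    simp [fderiv_real_eq_complex (hlam.differentiableAt (by simp))]
  have hd2 : ∀ Y Z, fderiv ℝ (fderiv ℝ (fun v => T (lam v))) u Y Z =
      T (fderiv ℂ (fderiv ℂ lam) u Y Z) := by
    intro Y Z
    rw [fderiv_fderiv_comp hT hlR, fderiv_fderiv_real_eq_complex hlam]
    have h0 : fderiv ℝ (fderiv ℝ (T : W → V)) (lam u) = 0 := by
      have : fderiv ℝ (T : W → V) = fun _ => T := by ext1 v; exact T.fderiv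
      rw [this]; simp
    rw [h0, T.fderiv]
    simp
  unfold levi
  simp only [hess_eq_fderiv_fderiv hc,
    fderiv_fderiv_comp (f := G) (τ := fun v => T (lam v)) hG hTl, hd1, hd2, map_smul]
  simp only [FunLike.coe_smul, Pi.smul_apply, smul_smul, Complex.I_mul_I, neg_smul, one_smul, map_neg]
  have e2 : ∀ a b : ℝ, ((((a : ℝ) : ℂ) + Complex.I * ((b : ℝ) : ℂ)) / 4).re = a / 4 := by
    intro a b
    simp [Complex.add_re]
  rw [e2]
  ring

lemma levi_congr {ρ ρ' : (Fin n → ℂ) → ℝ} {u : Fin n → ℂ} (h : ρ =ᶠ[𝓝 u] ρ') (X Y : Fin n → ℂ) :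
    levi ρ u X Y = levi ρ' u X Y := by
  have : ∀ X Y, hess ρ u X Y = hess ρ' u X Y := by
    intro X Y
    unfold hess
    have : (fun v => fderiv ℝ ρ v Y) =ᶠ[𝓝 u] fun v => fderiv ℝ ρ' v Y := by
      filter_upwards [h.eventuallyEq_nhds] with v hv
      rw [hv.fderiv_eq]
    rw [this.fderiv_eq]
  simp only [levi, this]

lemma levi_add {ρ ρ' : (Fin n → ℂ) → ℝ} {u : Fin n → ℂ} (h : ContDiffAt ℝ 2 ρ u)
    (h' : ContDiffAt ℝ 2 ρ' u) (X Y : Fin n → ℂ) :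
    levi (fun v => ρ v + ρ' v) u X Y = levi ρ u X Y + levi ρ' u X Y := by
  have : ∀ X Y, hess (fun v => ρ v + ρ' v) u X Y = hess ρ u X Y + hess ρ' u X Y := by
    intro X Y
    have hev : fderiv ℝ (fun v => ρ v + ρ' v) =ᶠ[𝓝 u] fun v => fderiv ℝ ρ v + fderiv ℝ ρ' v := by
      filter_upwards [h.eventually (by simp), h'.eventually (by simp)] with v h1 h2
      exact fderiv_fun_add (h1.differentiableAt (by simp)) (h2.differentiableAt (by simp))
    rw [hess_eq_fderiv_fderiv h, hess_eq_fderiv_fderiv h', hess_eq_fderiv_fderiv (h.add h'),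
      hev.fderiv_eq, fderiv_fun_add]
    · rfl
    · exact (h.fderiv_right (m := 1) (by norm_num)).differentiableAt (by simp)
    · exact (h'.fderiv_right (m := 1) (by norm_num)).differentiableAt (by simp)
  simp only [levi, this]
  push_cast
  ring

lemma levi_re_eq_zero {τ : (Fin n → ℂ) → ℂ} {u : Fin n → ℂ} (hτ : ContDiffAt ℂ 2 τ u) (a c : ℝ)
    (X Y : Fin n → ℂ) : levi (fun v => a * (τ v).re + c) u X Y = 0 := by
  have hτR : ContDiffAt ℝ 2 τ u := hτ.restrict_scalars ℝ
  have hr : ContDiff ℝ 2 (fun z : ℂ => a * z.re + c) :=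
    (contDiff_const.mul Complex.reCLM.contDiff).add contDiff_const
  have hf1 : fderiv ℝ (fun z : ℂ => a * z.re + c) = fun _ => a • Complex.reCLM := by
    ext1 z
    exact ((Complex.reCLM.hasFDerivAt.const_mul a).add_const c).fderiv
  have hc : ContDiffAt ℝ 2 (fun v => a * (τ v).re + c) u := hr.contDiffAt.comp u hτR
  have : ∀ X Y, hess (fun v => a * (τ v).re + c) u X Y =
      a * (fderiv ℂ (fderiv ℂ τ) u X Y).re := by
    intro X Y
    rw [hess_eq_fderiv_fderiv hc, fderiv_fderiv_comp (f := fun z : ℂ => a * z.re + c)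
      hr.contDiffAt hτR, fderiv_fderiv_real_eq_complex hτ, hf1]
    simp
  simp only [levi, this, map_smul]
  simp

lemma levi_log_norm_sq_eq_zero {τ : (Fin n → ℂ) → ℂ} {u : Fin n → ℂ} (hτ : ContDiffAt ℂ 2 τ u)
    (h0 : τ u ≠ 0) (X Y : Fin n → ℂ) : levi (fun v => Real.log (‖τ v‖ ^ 2)) u X Y = 0 := by
  have h1 : ContDiffAt ℂ 2 (fun v => Complex.log (τ v / τ u)) u := by
    refine ContDiffAt.comp u (Complex.contDiffAt_log ?_) (hτ.div_const (τ u))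
    rw [div_self h0]
    exact Complex.one_mem_slitPlane
  have hev : (fun v => Real.log (‖τ v‖ ^ 2)) =ᶠ[𝓝 u]
      fun v => 2 * (Complex.log (τ v / τ u)).re + 2 * Real.log ‖τ u‖ := by
    filter_upwards [hτ.continuousAt.eventually_ne h0] with v hv
    rw [Complex.log_re, norm_div, Real.log_div (norm_ne_zero_iff.2 hv) (norm_ne_zero_iff.2 h0),
      Real.log_pow]
    push_cast
    ring
  rw [levi_congr hev, levi_re_eq_zero h1]

lemma contDiffAt_log_norm_sq {τ : (Fin n → ℂ) → ℂ} {u : Fin n → ℂ} {k : ℕ∞ω}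
    (hτ : ContDiffAt ℝ k τ u) (h0 : τ u ≠ 0) :
    ContDiffAt ℝ k (fun v => Real.log (‖τ v‖ ^ 2)) u := by
  refine ContDiffAt.log (ContDiffAt.norm_sq ℝ hτ) ?_
  simpa using h0

end Levi

section LeviMatrix

open scoped ComplexConjugate Matrix

variable {n : ℕ} {ρ : (Fin n → ℂ) → ℝ} {u : Fin n → ℂ}

lemma levi_add_left (h : ContDiffAt ℝ 2 ρ u) (X X' Y : Fin n → ℂ) :
    levi ρ u (X + X') Y = levi ρ u X Y + levi ρ u X' Y := by
  simp only [levi, hess_eq_fderiv_fderiv h, smul_add, map_add, _root_.add_apply]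
  push_cast
  ring

lemma levi_smul_left (h : ContDiffAt ℝ 2 ρ u) (c : ℂ) (X Y : Fin n → ℂ) :
    levi ρ u (c • X) Y = c * levi ρ u X Y := by
  have hc : ∀ Z : Fin n → ℂ, c • Z = c.re • Z + c.im • (Complex.I • Z) := by
    intro Z
    ext i
    simp only [Pi.smul_apply, Pi.add_apply, smul_eq_mul, Complex.real_smul]
    conv_lhs => rw [← Complex.re_add_im c]
    ring
  have hI : Complex.I • (c • X) = c.re • (Complex.I • X) - c.im • X := by
    rw [hc]
    ext i
    simp only [Pi.smul_apply, Pi.add_apply, Pi.sub_apply, smul_eq_mul, Complex.real_smul]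
    linear_combination ((c.im : ℂ) * X i) * Complex.I_mul_I
  simp only [levi, hess_eq_fderiv_fderiv h]
  rw [hI, hc X]
  simp only [map_add, map_sub, map_smul, _root_.add_apply, _root_.sub_apply, FunLike.coe_smul,
    Pi.smul_apply, smul_eq_mul]
  conv_rhs => rw [← Complex.re_add_im c]
  push_cast
  linear_combination (-(fderiv ℝ (fderiv ℝ ρ) u X (Complex.I • Y) : ℂ) * c.im / 4 +
    (fderiv ℝ (fderiv ℝ ρ) u (Complex.I • X) Y : ℂ) * c.im / 4) * Complex.I_mul_I

lemma levi_conj_symm (h : ContDiffAt ℝ 2 ρ u) (X Y : Fin n → ℂ) :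
    conj (levi ρ u X Y) = levi ρ u Y X := by
  have hs : ∀ V W, fderiv ℝ (fderiv ℝ ρ) u V W = fderiv ℝ (fderiv ℝ ρ) u W V :=
    h.isSymmSndFDerivAt (by simp)
  simp only [levi, hess_eq_fderiv_fderiv h]
  rw [hs Y X, hs (Complex.I • Y) (Complex.I • X), hs Y (Complex.I • X), hs (Complex.I • Y) X]
  simp only [map_div₀, map_add, map_mul, Complex.conj_ofReal, Complex.conj_I, map_ofNat]
  push_cast
  ring

lemma levi_sum_left (h : ContDiffAt ℝ 2 ρ u) (X Y : Fin n → ℂ) :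
    levi ρ u X Y = ∑ j, X j * levi ρ u (Pi.single j 1) Y := by
  let L : (Fin n → ℂ) →ₗ[ℂ] ℂ :=
    { toFun := fun X => levi ρ u X Y
      map_add' := fun X X' => levi_add_left h X X' Y
      map_smul' := fun c X => levi_smul_left h c X Y }
  change L X = ∑ j, X j * L (Pi.single j 1)
  conv_lhs => rw [pi_eq_sum_univ' X]
  simp [map_sum]

lemma levi_eq_sum (h : ContDiffAt ℝ 2 ρ u) (X Y : Fin n → ℂ) :
    levi ρ u X Y = ∑ j, ∑ k, X j * leviMatrix ρ u j k * conj (Y k) := by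
  rw [levi_sum_left h]
  refine Finset.sum_congr rfl fun j _ => ?_
  rw [← levi_conj_symm h Y, levi_sum_left h, map_sum, Finset.mul_sum]
  refine Finset.sum_congr rfl fun k _ => ?_
  rw [map_mul, levi_conj_symm h]
  simp only [leviMatrix, Matrix.of_apply]
  ring

/-- The determinant of the Levi matrix transforms by the squared modulus of the Jacobian. -/
lemma det_leviMatrix_comp {ψ : (Fin n → ℂ) → (Fin n → ℂ)}
    (hρ : ContDiffAt ℝ 2 ρ (ψ u)) (hψ : ContDiffAt ℂ 2 ψ u) :
    (leviMatrix (fun v => ρ (ψ v)) u).det.re =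
      ‖(Matrix.of fun j => fderiv ℂ ψ u (Pi.single j 1)).det‖ ^ 2 *
        (leviMatrix ρ (ψ u)).det.re := by
  set J : Matrix (Fin n) (Fin n) ℂ := Matrix.of fun j => fderiv ℂ ψ u (Pi.single j 1) with hJ
  have hmat : leviMatrix (fun v => ρ (ψ v)) u = J * leviMatrix ρ (ψ u) * Jᴴ := by
    ext j k
    simp only [leviMatrix, Matrix.of_apply, levi_comp hρ hψ]
    rw [levi_eq_sum hρ]
    simp only [Matrix.mul_apply, Finset.sum_mul, Matrix.conjTranspose_apply, hJ, Matrix.of_apply]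
    rw [Finset.sum_comm]
    rfl
  rw [hmat, Matrix.det_mul, Matrix.det_mul, Matrix.det_conjTranspose]
  have : J.det * (leviMatrix ρ (ψ u)).det * star J.det =
      ((‖J.det‖ ^ 2 : ℝ) : ℂ) * (leviMatrix ρ (ψ u)).det := by
    rw [Complex.ofReal_pow, ← Complex.mul_conj']
    change _ = J.det * star J.det * _
    ring
  rw [this, Complex.re_ofReal_mul]

lemma det_leviMatrix_congr {ρ' : (Fin n → ℂ) → ℝ} (h : ∀ X Y, levi ρ u X Y = levi ρ' u X Y) :
    leviMatrix ρ u = leviMatrix ρ' u := by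
  ext j k
  exact h _ _

lemma levi_self_im (h : ContDiffAt ℝ 2 ρ u) (X : Fin n → ℂ) : (levi ρ u X X).im = 0 :=
  Complex.conj_eq_iff_im.1 (levi_conj_symm h X X)

lemma det_leviMatrix_pos (h : ContDiffAt ℝ 2 ρ u)
    (hpos : ∀ X, X ≠ 0 → 0 < (levi ρ u X X).re) : 0 < (leviMatrix ρ u).det.re := by
  open scoped ComplexOrder in
  have hpd : (leviMatrix ρ u).PosDef := by
    refine Matrix.PosDef.of_dotProduct_mulVec_pos ?_ fun x hx => ?_
    · ext j k
      exact levi_conj_symm h _ _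
    · have hx' : star x ≠ 0 := by simpa using hx
      have : star x ⬝ᵥ (leviMatrix ρ u *ᵥ x) = levi ρ u (star x) (star x) := by
        rw [levi_eq_sum h]
        simp only [dotProduct, Matrix.mulVec, Finset.mul_sum]
        refine Finset.sum_congr rfl fun j _ => Finset.sum_congr rfl fun k _ => ?_
        simp [mul_assoc]
      rw [this, Complex.lt_def]
      exact ⟨hpos _ hx', (levi_self_im h _).symm⟩
  open scoped ComplexOrder in
  have := hpd.det_pos
  exact (Complex.lt_def.1 this).1

end LeviMatrix

section KahlerBilin

variable {n : ℕ}

/-- Multiplication by the imaginary unit, as a real linear map. -/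
def mulI (n : ℕ) : (Fin n → ℂ) →L[ℝ] (Fin n → ℂ) :=
  (Complex.I • ContinuousLinearMap.id ℂ (Fin n → ℂ)).restrictScalars ℝ

/-- The hermitian symmetrization of a real bilinear form. -/
def symmetrize (L : (Fin n → ℂ) →L[ℝ] (Fin n → ℂ) →L[ℝ] ℝ) :
    (Fin n → ℂ) →L[ℝ] (Fin n → ℂ) →L[ℝ] ℝ :=
  (4 * Real.pi)⁻¹ • (L + ((ContinuousLinearMap.compL ℝ (Fin n → ℂ) (Fin n → ℂ) ℝ).flip
    (mulI n)).comp (L.comp (mulI n)))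

lemma symmetrize_apply (L : (Fin n → ℂ) →L[ℝ] (Fin n → ℂ) →L[ℝ] ℝ) (X Y : Fin n → ℂ) :
    symmetrize L X Y = (4 * Real.pi)⁻¹ * (L X Y + L (Complex.I • X) (Complex.I • Y)) := rfl

lemma kahlerMetric_eq_symmetrize {ρ : (Fin n → ℂ) → ℝ} {u : Fin n → ℂ} (h : ContDiffAt ℝ 2 ρ u)
    (X Y : Fin n → ℂ) :
    kahlerMetric ρ u X Y = symmetrize (fderiv ℝ (fderiv ℝ ρ) u) X Y := by
  rw [symmetrize_apply, kahlerMetric, levi, hess_eq_fderiv_fderiv h, hess_eq_fderiv_fderiv h]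
  have e2 : ∀ a b : ℝ, ((((a : ℝ) : ℂ) + Complex.I * ((b : ℝ) : ℂ)) / 4).re = a / 4 := by
    intro a b
    simp [Complex.add_re]
  rw [e2]
  have := Real.pi_ne_zero
  field_simp

variable {P : Type*} [NormedAddCommGroup P] [NormedSpace ℝ P]

/-- The second derivative depends smoothly on parameters. -/
lemma contDiffAt_fderiv_fderiv {Φ : P → (Fin n → ℂ) → ℝ} {z : P × (Fin n → ℂ)}
    (hΦ : ContDiffAt ℝ ∞ (fun z : P × (Fin n → ℂ) => Φ z.1 z.2) z) :
    ContDiffAt ℝ ∞ (fun z : P × (Fin n → ℂ) => fderiv ℝ (fderiv ℝ (Φ z.1)) z.2) z := by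
  have hd1 : ContDiffAt ℝ ∞ (fun z : P × (Fin n → ℂ) => fderiv ℝ (Φ z.1) z.2) z := by
    refine ContDiffAt.fderiv (n := ∞) (m := ∞) (f := fun (z : P × (Fin n → ℂ)) v => Φ z.1 v)
      (g := fun z => z.2) ?_ contDiffAt_snd (by simp)
    exact ContDiffAt.comp (z, z.2) (f := fun r : (P × (Fin n → ℂ)) × (Fin n → ℂ) => (r.1.1, r.2))
      hΦ (by fun_prop)
  refine ContDiffAt.fderiv (n := ∞) (m := ∞)
    (f := fun (z : P × (Fin n → ℂ)) v => fderiv ℝ (Φ z.1) v)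
    (g := fun z => z.2) ?_ contDiffAt_snd (by simp)
  exact ContDiffAt.comp (z, z.2) (f := fun r : (P × (Fin n → ℂ)) × (Fin n → ℂ) => (r.1.1, r.2))
    hd1 (by fun_prop)

lemma contDiffAt_symmetrize {Φ : P → (Fin n → ℂ) → ℝ} {z : P × (Fin n → ℂ)}
    (hΦ : ContDiffAt ℝ ∞ (fun z : P × (Fin n → ℂ) => Φ z.1 z.2) z) :
    ContDiffAt ℝ ∞ (fun z : P × (Fin n → ℂ) => symmetrize (fderiv ℝ (fderiv ℝ (Φ z.1)) z.2)) z := by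
  unfold symmetrize
  refine ContDiffAt.const_smul _ ((contDiffAt_fderiv_fderiv hΦ).add ?_)
  exact contDiffAt_const.clm_comp ((contDiffAt_fderiv_fderiv hΦ).clm_comp contDiffAt_const)

/-- A smooth family of potentials with positive definite Levi forms gives a smooth family of
metrics. -/
lemma isSmoothMetricOn_kahlerMetric {U : Set (P × (Fin n → ℂ))} (hU : IsOpen U)
    {Φ : P → (Fin n → ℂ) → ℝ} (hΦ : ContDiffOn ℝ ∞ (fun z : P × (Fin n → ℂ) => Φ z.1 z.2) U)
    (hpos : ∀ z ∈ U, ∀ X, X ≠ 0 → 0 < kahlerMetric (Φ z.1) z.2 X X) :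
    IsSmoothMetricOn U (fun p => kahlerMetric (Φ p))
      (fun z => symmetrize (fderiv ℝ (fderiv ℝ (Φ z.1)) z.2)) := by
  have hat : ∀ z ∈ U, ContDiffAt ℝ ∞ (fun z : P × (Fin n → ℂ) => Φ z.1 z.2) z :=
    fun z hz => hΦ.contDiffAt (hU.mem_nhds hz)
  have hslice : ∀ z ∈ U, ContDiffAt ℝ 2 (Φ z.1) z.2 := by
    intro z hz
    have h1 : ContDiffAt ℝ ∞ (Φ z.1) z.2 :=
      ContDiffAt.comp z.2 (f := fun v : Fin n → ℂ => (z.1, v)) (hat z hz) (by fun_prop)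
    exact h1.of_le ENat.LEInfty.out
  refine ⟨hU, fun z hz => ContDiffAt.contDiffWithinAt ?_, fun z hz X Y =>
    kahlerMetric_eq_symmetrize (hslice z hz) X Y, fun z hz X Y => ?_, fun z hz X hX => ?_⟩
  · exact contDiffAt_symmetrize (hat z hz)
  · have hs : ∀ V W, fderiv ℝ (fderiv ℝ (Φ z.1)) z.2 V W = fderiv ℝ (fderiv ℝ (Φ z.1)) z.2 W V :=
      (hslice z hz).isSymmSndFDerivAt (by simp)
    rw [symmetrize_apply, symmetrize_apply, hs X, hs (Complex.I • X)]
  · rw [← kahlerMetric_eq_symmetrize (hslice z hz)]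
    exact hpos z hz X hX

/-- The Levi form depends smoothly on parameters. -/
lemma contDiffAt_levi {Φ : P → (Fin n → ℂ) → ℝ} {z : P × (Fin n → ℂ)}
    (hΦ : ContDiffAt ℝ ∞ (fun z : P × (Fin n → ℂ) => Φ z.1 z.2) z)
    (X Y : Fin n → ℂ) : ContDiffAt ℝ ∞ (fun z : P × (Fin n → ℂ) => levi (Φ z.1) z.2 X Y) z := by
  have hhess : ∀ X Y, ContDiffAt ℝ ∞ (fun z : P × (Fin n → ℂ) => hess (Φ z.1) z.2 X Y) z := by
    intro X Y
    unfold hess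
    have hd1 : ContDiffAt ℝ ∞ (fun z : P × (Fin n → ℂ) => fderiv ℝ (Φ z.1) z.2 Y) z := by
      refine ContDiffAt.clm_apply ?_ contDiffAt_const
      refine ContDiffAt.fderiv (n := ∞) (m := ∞) (f := fun (z : P × (Fin n → ℂ)) v => Φ z.1 v)
        (g := fun z => z.2) ?_ contDiffAt_snd (by simp)
      exact ContDiffAt.comp (z, z.2) (f := fun r : (P × (Fin n → ℂ)) × (Fin n → ℂ) => (r.1.1, r.2))
        hΦ (by fun_prop)
    refine ContDiffAt.clm_apply ?_ contDiffAt_const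
    refine ContDiffAt.fderiv (n := ∞) (m := ∞)
      (f := fun (z : P × (Fin n → ℂ)) v => fderiv ℝ (Φ z.1) v Y)
      (g := fun z => z.2) ?_ contDiffAt_snd (by simp)
    exact ContDiffAt.comp (z, z.2) (f := fun r : (P × (Fin n → ℂ)) × (Fin n → ℂ) => (r.1.1, r.2))
      hd1 (by fun_prop)
  unfold levi
  have hof : ContDiff ℝ ∞ (fun r : ℝ => (r : ℂ)) := Complex.ofRealCLM.contDiff
  exact ((hof.contDiffAt.comp z ((hhess _ _).add (hhess _ _))).add (contDiffAt_const.mul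
    (hof.contDiffAt.comp z ((hhess _ _).sub (hhess _ _))))).div_const 4

/-- The determinant of the Levi matrix depends smoothly on parameters. -/
lemma contDiffAt_det_leviMatrix {Φ : P → (Fin n → ℂ) → ℝ} {z : P × (Fin n → ℂ)}
    (hΦ : ContDiffAt ℝ ∞ (fun z : P × (Fin n → ℂ) => Φ z.1 z.2) z) :
    ContDiffAt ℝ ∞ (fun z : P × (Fin n → ℂ) => (leviMatrix (Φ z.1) z.2).det.re) z := by
  refine Complex.reCLM.contDiff.contDiffAt.comp z ?_
  simp only [Matrix.det_apply]
  refine ContDiffAt.sum fun σ _ => ContDiffAt.const_smul _ ?_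
  exact contDiffAt_prod fun i _ => contDiffAt_levi hΦ _ _

end KahlerBilin

section Glue

/-- The function `β ^ (-k) exp (-c / β)` for `β > 0`, extended by zero to `β ≤ 0`. -/
def expGlue (k : ℕ) (q : ℝ × ℂ) : ℂ :=
  if 0 < q.1 then ((q.1 : ℂ)⁻¹) ^ k * Complex.exp (-(q.2 * (q.1 : ℂ)⁻¹)) else 0

/-- The derivative of `expGlue k`. -/
def expGlueDeriv (k : ℕ) (q : ℝ × ℂ) : ℝ × ℂ →L[ℝ] ℂ :=
  (-(k : ℂ) * expGlue (k + 1) q + q.2 * expGlue (k + 2) q) •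
    (Complex.ofRealCLM.comp (ContinuousLinearMap.fst ℝ ℝ ℂ)) -
    expGlue (k + 1) q • ContinuousLinearMap.snd ℝ ℝ ℂ

lemma norm_expGlue_le (k : ℕ) {δ : ℝ} (hδ : 0 < δ) {q : ℝ × ℂ} (hq : δ ≤ q.2.re) :
    ‖expGlue k q‖ ≤ (k + 2).factorial / δ ^ (k + 2) * |q.1| ^ 2 := by
  unfold expGlue
  split_ifs with h
  · rw [norm_mul, norm_pow, norm_inv, Complex.norm_real, Real.norm_of_nonneg h.le,
      Complex.norm_exp, abs_of_pos h]
    have hre : (-(q.2 * (q.1 : ℂ)⁻¹)).re = -(q.2.re / q.1) := by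
      rw [← Complex.ofReal_inv, Complex.neg_re, Complex.re_mul_ofReal]; rfl
    rw [hre]
    have h1 : Real.exp (-(q.2.re / q.1)) ≤ Real.exp (-(δ / q.1)) := by
      gcongr
    have h2 := Real.pow_div_factorial_le_exp (δ / q.1) (by positivity) (k + 2)
    have h3 : Real.exp (-(δ / q.1)) ≤ (k + 2).factorial / (δ / q.1) ^ (k + 2) := by
      rw [Real.exp_neg, ← inv_div ((δ / q.1) ^ (k + 2))]
      exact inv_anti₀ (by positivity) h2
    calc (q.1)⁻¹ ^ k * Real.exp (-(q.2.re / q.1))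
        ≤ (q.1)⁻¹ ^ k * ((k + 2).factorial / (δ / q.1) ^ (k + 2)) := by
          gcongr; exact h1.trans h3
      _ = (k + 2).factorial / δ ^ (k + 2) * q.1 ^ 2 := by
          rw [div_pow, inv_pow, pow_add q.1 k 2]
          field_simp
  · simp only [norm_zero]; positivity

lemma hasFDerivAt_expGlue (k : ℕ) {q : ℝ × ℂ} (hq : 0 < q.2.re) :
    HasFDerivAt (expGlue k) (expGlueDeriv k q) q := by
  rcases lt_trichotomy q.1 0 with h | h | h
  · have hev : expGlue k =ᶠ[𝓝 q] fun _ => 0 := by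
      filter_upwards [continuousAt_fst.eventually (gt_mem_nhds h)] with r hr
      simp [expGlue, not_lt.2 (le_of_lt hr)]
    have h0 : expGlueDeriv k q = 0 := by
      ext <;> simp [expGlueDeriv, expGlue, not_lt.2 h.le]
    rw [h0]
    exact (hasFDerivAt_const (0 : ℂ) q).congr_of_eventuallyEq hev
  · have h0 : expGlueDeriv k q = 0 := by
      ext <;> simp [expGlueDeriv, expGlue, h]
    rw [h0]
    refine Asymptotics.IsBigO.hasFDerivAt (n := 2) ?_ (by norm_num)
    refine Asymptotics.IsBigO.of_bound ((k + 2).factorial / (q.2.re / 2) ^ (k + 2)) ?_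
    have hev : ∀ᶠ r : ℝ × ℂ in 𝓝 q, q.2.re / 2 < r.2.re :=
      (Complex.continuous_re.comp continuous_snd).continuousAt.eventually
        (lt_mem_nhds (show q.2.re / 2 < q.2.re by linarith))
    filter_upwards [hev] with r hr
    refine (norm_expGlue_le k (by positivity) hr.le).trans ?_
    have h1 : |r.1| ≤ ‖r - q‖ := by
      have := norm_fst_le (r - q)
      simpa [h] using this
    rw [Real.norm_of_nonneg (by positivity)]
    gcongr
  · have hne : (q.1 : ℂ) ≠ 0 := by exact_mod_cast h.ne'
    have hev : expGlue k =ᶠ[𝓝 q]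
        fun r => ((r.1 : ℂ)⁻¹) ^ k * Complex.exp (-(r.2 * (r.1 : ℂ)⁻¹)) := by
      filter_upwards [continuousAt_fst.eventually (lt_mem_nhds h)] with r hr
      have hr' : 0 < r.1 := hr
      simp [expGlue, hr']
    refine HasFDerivAt.congr_of_eventuallyEq ?_ hev
    have hb : HasFDerivAt (fun r : ℝ × ℂ => (r.1 : ℂ))
        (Complex.ofRealCLM.comp (ContinuousLinearMap.fst ℝ ℝ ℂ)) q :=
      (Complex.ofRealCLM.comp (ContinuousLinearMap.fst ℝ ℝ ℂ)).hasFDerivAt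
    have hinv : HasFDerivAt (fun r : ℝ × ℂ => (r.1 : ℂ)⁻¹)
        ((-((q.1 : ℂ) ^ 2)⁻¹) • (Complex.ofRealCLM.comp (ContinuousLinearMap.fst ℝ ℝ ℂ))) q := by
      have := ((hasDerivAt_inv hne).hasFDerivAt.restrictScalars ℝ).comp q hb
      refine this.congr_fderiv ?_
      ext <;> simp [mul_comm]
    have hc : HasFDerivAt (fun r : ℝ × ℂ => r.2) (ContinuousLinearMap.snd ℝ ℝ ℂ) q :=
      hasFDerivAt_snd
    have hexp := ((hc.mul hinv).neg).cexp
    have := (hinv.pow k).mul hexp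
    refine this.congr_fderiv ?_
    rcases k with _ | k
    · ext <;> simp [expGlueDeriv, expGlue, h] <;> field_simp
    · ext <;> simp [expGlueDeriv, expGlue, h] <;> field_simp <;> ring

lemma contDiffOn_expGlue (k : ℕ) : ContDiffOn ℝ ∞ (expGlue k) {q : ℝ × ℂ | 0 < q.2.re} := by
  have hopen : IsOpen {q : ℝ × ℂ | 0 < q.2.re} :=
    isOpen_lt continuous_const (Complex.continuous_re.comp continuous_snd)
  rw [contDiffOn_infty]
  intro N
  induction N generalizing k with
  | zero =>
    exact contDiffOn_zero.2 fun q hq => (hasFDerivAt_expGlue k hq).continuousAt.continuousWithinAt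
  | succ N ih =>
    rw [Nat.cast_succ, contDiffOn_succ_iff_fderiv_of_isOpen hopen]
    refine ⟨fun q hq => (hasFDerivAt_expGlue k hq).differentiableAt.differentiableWithinAt,
      by simp, ?_⟩
    refine ContDiffOn.congr (f := expGlueDeriv k) ?_ fun q hq => (hasFDerivAt_expGlue k hq).fderiv
    unfold expGlueDeriv
    exact (((contDiffOn_const.mul (ih _)).add (contDiff_snd.contDiffOn.mul (ih _))).smul
      contDiffOn_const).sub ((ih _).smul contDiffOn_const)

end Glue

section RealEstimate

/-- The first two derivatives of `log ∑ q_j exp B_j`. -/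
lemma hasDerivAt_log_sum_exp {K : Type*} [Fintype K] {q : K → ℝ} (hq : ∀ j, 0 ≤ q j)
    (hQ : 0 < ∑ j, q j) {B B' : K → ℝ → ℝ} {B'' : K → ℝ}
    (hB : ∀ j, ∀ᶠ s in 𝓝 (0 : ℝ), HasDerivAt (B j) (B' j s) s)
    (hB' : ∀ j, HasDerivAt (B' j) (B'' j) 0) (hB0 : ∀ j, B j 0 = 0) :
    (∀ᶠ s in 𝓝 (0 : ℝ), HasDerivAt (fun s => Real.log (∑ j, q j * Real.exp (B j s)))
      ((∑ j, q j * (Real.exp (B j s) * B' j s)) / ∑ j, q j * Real.exp (B j s)) s) ∧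
    HasDerivAt (fun s => (∑ j, q j * (Real.exp (B j s) * B' j s)) / ∑ j, q j * Real.exp (B j s))
      ((∑ j, q j * (B'' j + B' j 0 ^ 2)) / (∑ j, q j) -
        ((∑ j, q j * B' j 0) / ∑ j, q j) ^ 2) 0 := by
  have hpos : ∀ s, 0 < ∑ j, q j * Real.exp (B j s) := by
    intro s
    obtain ⟨j, hj, hj0⟩ := Finset.exists_lt_of_sum_lt (f := fun _ => (0 : ℝ)) (by simpa using hQ)
    exact Finset.sum_pos' (fun j _ => mul_nonneg (hq j) (Real.exp_pos _).le)
      ⟨j, hj, mul_pos hj0 (Real.exp_pos _)⟩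
  have hh : ∀ s, (∀ j, HasDerivAt (B j) (B' j s) s) →
      HasDerivAt (fun s => ∑ j, q j * Real.exp (B j s))
        (∑ j, q j * (Real.exp (B j s) * B' j s)) s := fun s hs =>
    HasDerivAt.fun_sum fun j _ => ((hs j).exp).const_mul (q j)
  have hall : ∀ᶠ s in 𝓝 (0 : ℝ), ∀ j, HasDerivAt (B j) (B' j s) s :=
    Filter.eventually_all.2 hB
  refine ⟨?_, ?_⟩
  · filter_upwards [hall] with s hs
    exact (hh s hs).log (hpos s).ne'
  · have h0 := hall.self_of_nhds
    have h1 : HasDerivAt (fun s => ∑ j, q j * (Real.exp (B j s) * B' j s))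
        (∑ j, q j * (Real.exp (B j 0) * B' j 0 * B' j 0 + Real.exp (B j 0) * B'' j)) 0 :=
      HasDerivAt.fun_sum fun j _ => (((h0 j).exp).mul (hB' j)).const_mul (q j)
    have h2 := h1.div (hh 0 h0) (hpos 0).ne'
    refine h2.congr_deriv ?_
    simp only [hB0, Real.exp_zero, one_mul, mul_one]
    rw [show ∑ j, q j * (B'' j + B' j 0 ^ 2) = ∑ j, q j * (B' j 0 * B' j 0 + B'' j) from
      Finset.sum_congr rfl fun j _ => by ring]
    field_simp

variable {ι J : Type*} [Fintype ι] [Fintype J]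

/-- The potential as a function of the logarithms of the squared moduli of the monomials. -/
def logPotential (e β : ι → ℝ) (q : J → ℝ) (S : J → Finset ι) (τ : ι → ℝ) : ℝ :=
  Real.log (∑ j, q j * ((∏ m ∈ S j,
    (1 + β m * (Real.log (∑ m', e m' * Real.exp (τ m')) - τ m)))⁻¹) ^ 2) +
    Real.log (∑ m', e m' * Real.exp (τ m'))

variable {e β : ι → ℝ} {q : J → ℝ} {S : J → Finset ι}

lemma contDiffAt_logPotential (he1 : ∑ m, e m = 1) (hQ : 0 < ∑ j, q j) :
    ContDiffAt ℝ ∞ (logPotential e β q S) 0 := by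
  have hN : ContDiffAt ℝ ∞ (fun τ : ι → ℝ => Real.log (∑ m', e m' * Real.exp (τ m'))) 0 := by
    refine ContDiffAt.log ?_ (by simp [he1])
    refine ContDiffAt.sum fun m _ => contDiffAt_const.mul ?_
    exact (contDiff_apply ℝ ℝ m).exp.contDiffAt
  refine ContDiffAt.add (ContDiffAt.log ?_ ?_) hN
  · refine ContDiffAt.sum fun j _ => contDiffAt_const.mul (ContDiffAt.pow (ContDiffAt.inv ?_ ?_) 2)
    · exact contDiffAt_prod fun m _ => contDiffAt_const.add
        (contDiffAt_const.mul (hN.sub (contDiff_apply ℝ ℝ m).contDiffAt))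
    · simp [he1]
  · simp [he1, hQ.ne']

/-- The lower bound for the Hessian of the potential. -/
lemma le_hessian_logPotential (he : ∀ m, 0 ≤ e m) (he1 : ∑ m, e m = 1)
    (hq : ∀ j, 0 ≤ q j) (hQ : 0 < ∑ j, q j) (hβ : ∀ j, ∑ m ∈ S j, β m ≤ 1 / 4)
    (j₀ : J) (L : ι → ℝ) :
    1 / 2 * ∑ m, e m * (L m - ∑ m', e m' * L m') ^ 2 +
      2 * (q j₀ / ∑ j, q j) * ∑ m ∈ S j₀, (β m * (L m - ∑ m', e m' * L m')) ^ 2 ≤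
    fderiv ℝ (fderiv ℝ (logPotential e β q S)) 0 L L := by
  classical
  set E := ∑ m', e m' * L m' with hE
  set Var := ∑ m, e m * (L m - E) ^ 2 with hVar
  have hVar0 : 0 ≤ Var := Finset.sum_nonneg fun m _ => mul_nonneg (he m) (sq_nonneg _)
  have hVar' : ∑ m, e m * L m ^ 2 - E ^ 2 = Var := by
    have : ∀ m, e m * (L m - E) ^ 2 = e m * L m ^ 2 - 2 * E * (e m * L m) + E ^ 2 * e m := by
      intro m; ring
    rw [hVar, Finset.sum_congr rfl fun m _ => this m, Finset.sum_add_distrib,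
      Finset.sum_sub_distrib, ← Finset.mul_sum, ← Finset.mul_sum, he1, ← hE]
    ring
  -- the logarithm of the sum along the line
  set ν : ℝ → ℝ := fun s => Real.log (∑ m, e m * Real.exp (s * L m)) with hν
  set ν' : ℝ → ℝ := fun s => (∑ m, e m * (Real.exp (s * L m) * L m)) /
    ∑ m, e m * Real.exp (s * L m) with hν'
  obtain ⟨hν1, hν2⟩ := hasDerivAt_log_sum_exp (q := e) he (by rw [he1]; exact one_pos)
    (B := fun m s => s * L m) (B' := fun m _ => L m) (B'' := fun _ => 0)
    (fun m => Filter.Eventually.of_forall fun s => by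
      simpa using (hasDerivAt_id s).mul_const (L m))
    (fun m => hasDerivAt_const _ _) (fun m => by simp)
  have hν2' : HasDerivAt ν' Var 0 := by
    refine hν2.congr_deriv ?_
    simp only [he1, div_one, zero_add]
    rw [← hVar', hE]
  have hν00 : ν 0 = 0 := by simp [hν, he1]
  have hν'0 : ν' 0 = E := by simp [hν', he1, hE]
  have hνc : ContinuousAt ν 0 := hν1.self_of_nhds.continuousAt
  -- the functions `A m`
  set A : ι → ℝ → ℝ := fun m s => 1 + β m * (ν s - s * L m) with hA
  have hA0 : ∀ m, A m 0 = 1 := by intro m; simp [hA, hν00]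
  have hApos : ∀ m, ∀ᶠ s in 𝓝 (0 : ℝ), 0 < A m s := by
    intro m
    have : ContinuousAt (A m) 0 := by
      refine continuousAt_const.add (continuousAt_const.mul (hνc.sub ?_))
      fun_prop
    exact this.eventually (lt_mem_nhds (by rw [hA0]; exact one_pos))
  have hA1 : ∀ m, ∀ᶠ s in 𝓝 (0 : ℝ), HasDerivAt (A m) (β m * (ν' s - L m)) s := by
    intro m
    filter_upwards [hν1] with s hs
    have h1 : HasDerivAt (fun s => s * L m) (L m) s := by
      simpa using (hasDerivAt_id s).mul_const (L m)
    exact ((hs.sub h1).const_mul (β m)).const_add 1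
  have hA2 : ∀ m, HasDerivAt (fun s => β m * (ν' s - L m)) (β m * Var) 0 := fun m =>
    (hν2'.sub_const (L m)).const_mul (β m)
  obtain ⟨hF1, hF2⟩ := hasDerivAt_log_sum_exp (q := q) hq hQ
    (B := fun j s => ∑ m ∈ S j, -2 * Real.log (A m s))
    (B' := fun j s => ∑ m ∈ S j, -2 * (β m * (ν' s - L m) / A m s))
    (B'' := fun j => ∑ m ∈ S j, -2 * (β m * Var - (β m * (E - L m)) ^ 2))
    (fun j => by
      have h1 := (S j).eventually_all.2 fun m _ => hApos m
      have h2 := (S j).eventually_all.2 fun m _ => hA1 m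
      filter_upwards [h1, h2] with s hs1 hs2
      exact HasDerivAt.fun_sum fun m hm => ((hs2 m hm).log (hs1 m hm).ne').const_mul _)
    (fun j => by
      refine HasDerivAt.fun_sum fun m hm => HasDerivAt.const_mul _ ?_
      have := (hA2 m).div (hA1 m).self_of_nhds (by rw [hA0]; exact one_ne_zero)
      refine this.congr_deriv ?_
      simp only [hA0, hν'0]
      ring)
    (fun j => by simp [hA0])
  -- the potential along the line
  have hline : (fun s : ℝ => logPotential e β q S (s • L)) =ᶠ[𝓝 0]
      fun s => Real.log (∑ j, q j * Real.exp (∑ m ∈ S j, -2 * Real.log (A m s))) + ν s := by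
    have h1 : ∀ᶠ s in 𝓝 (0 : ℝ), ∀ m, 0 < A m s := Filter.eventually_all.2 hApos
    filter_upwards [h1] with s hs
    simp only [logPotential, Pi.smul_apply, smul_eq_mul]
    congr 2
    refine Finset.sum_congr rfl fun j _ => ?_
    congr 1
    rw [Real.exp_sum, inv_pow, ← Finset.prod_pow, ← Finset.prod_inv_distrib]
    refine Finset.prod_congr rfl fun m _ => ?_
    rw [show -2 * Real.log (A m s) = Real.log ((A m s ^ 2)⁻¹) by
      rw [Real.log_inv, Real.log_pow]; push_cast; ring,
      Real.exp_log (inv_pos.2 (pow_pos (hs m) 2))]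
  have hsmooth : ContDiffAt ℝ 2 (logPotential e β q S) ((0 : ℝ) • L) := by
    rw [zero_smul]
    exact (contDiffAt_logPotential he1 hQ).of_le ENat.LEInfty.out
  have hsl : ContDiffAt ℝ 2 (fun s : ℝ => s • L) 0 := by fun_prop
  have hsnd : fderiv ℝ (fderiv ℝ (fun s : ℝ => logPotential e β q S (s • L))) 0 1 1 =
      fderiv ℝ (fderiv ℝ (logPotential e β q S)) 0 L L := by
    rw [fderiv_fderiv_comp (f := logPotential e β q S) (τ := fun s : ℝ => s • L) hsmooth hsl]
    have hd : fderiv ℝ (fun s : ℝ => s • L) = fun _ => (ContinuousLinearMap.id ℝ ℝ).smulRight L := by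
      ext1 s
      exact ((ContinuousLinearMap.id ℝ ℝ).smulRight L).fderiv
    rw [hd]
    simp
  have hderiv : (fun s => fderiv ℝ (fun s : ℝ => logPotential e β q S (s • L)) s 1) =ᶠ[𝓝 0]
      fun s => (∑ j, q j * (Real.exp (∑ m ∈ S j, -2 * Real.log (A m s)) *
        ∑ m ∈ S j, -2 * (β m * (ν' s - L m) / A m s))) /
        (∑ j, q j * Real.exp (∑ m ∈ S j, -2 * Real.log (A m s))) + ν' s := by
    filter_upwards [hline.eventuallyEq_nhds, hF1, hν1] with s h1 h2 h3
    rw [h1.fderiv_eq, fderiv_apply_one_eq_deriv]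
    exact (h2.add h3).deriv
  have htwo : fderiv ℝ (fderiv ℝ (fun s : ℝ => logPotential e β q S (s • L))) 0 1 1 =
      (∑ j, q j * ((∑ m ∈ S j, -2 * (β m * Var - (β m * (E - L m)) ^ 2)) +
        (∑ m ∈ S j, -2 * (β m * (ν' 0 - L m) / A m 0)) ^ 2)) / (∑ j, q j) -
        ((∑ j, q j * ∑ m ∈ S j, -2 * (β m * (ν' 0 - L m) / A m 0)) / ∑ j, q j) ^ 2 + Var := by
    have hcd : ContDiffAt ℝ 2 (fun s : ℝ => logPotential e β q S (s • L)) 0 :=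
      ContDiffAt.comp (0 : ℝ) (f := fun s : ℝ => s • L) hsmooth hsl
    have h1 : HasFDerivAt (fderiv ℝ (fun s : ℝ => logPotential e β q S (s • L)))
        (fderiv ℝ (fderiv ℝ (fun s : ℝ => logPotential e β q S (s • L))) 0) 0 :=
      ((hcd.fderiv_right (m := 1) (by norm_num)).differentiableAt (by simp)).hasFDerivAt
    have h2 := h1.clm_apply (hasFDerivAt_const (1 : ℝ) (0 : ℝ))
    have h3 := (hF2.add hν2').hasFDerivAt.congr_of_eventuallyEq hderiv
    have h4 := congrArg (fun M => M (1 : ℝ)) (h2.unique h3)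
    simpa using h4
  rw [← hsnd, htwo]
  clear_value Var
  set Q := ∑ j, q j with hQdef
  set b : J → ℝ := fun j => ∑ m ∈ S j, -2 * (β m * (ν' 0 - L m) / A m 0) with hb
  have hCS : ((∑ j, q j * b j) / Q) ^ 2 ≤ (∑ j, q j * b j ^ 2) / Q := by
    have hcs := Finset.sum_mul_sq_le_sq_mul_sq Finset.univ (fun j => Real.sqrt (q j))
      (fun j => Real.sqrt (q j) * b j)
    have e1 : ∀ j, Real.sqrt (q j) * (Real.sqrt (q j) * b j) = q j * b j := by
      intro j; rw [← mul_assoc, Real.mul_self_sqrt (hq j)]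
    have e2 : ∀ j, Real.sqrt (q j) ^ 2 = q j := fun j => Real.sq_sqrt (hq j)
    have e3 : ∀ j, (Real.sqrt (q j) * b j) ^ 2 = q j * b j ^ 2 := by
      intro j; rw [mul_pow, e2]
    simp only [e1, e2, e3] at hcs
    rw [div_pow, div_le_div_iff₀ (by positivity) hQ]
    calc (∑ j, q j * b j) ^ 2 * Q ≤ (Q * ∑ j, q j * b j ^ 2) * Q := by gcongr
      _ = (∑ j, q j * b j ^ 2) * Q ^ 2 := by ring
  have hsplit : (∑ j, q j * ((∑ m ∈ S j, -2 * (β m * Var - (β m * (E - L m)) ^ 2)) + b j ^ 2)) / Q =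
      (∑ j, q j * ∑ m ∈ S j, -2 * (β m * Var - (β m * (E - L m)) ^ 2)) / Q +
        (∑ j, q j * b j ^ 2) / Q := by
    rw [← add_div, ← Finset.sum_add_distrib]
    congr 1
    exact Finset.sum_congr rfl fun j _ => by ring
  have hlow : ∀ j, -(1 / 2) * Var + 2 * ∑ m ∈ S j, (β m * (L m - E)) ^ 2 ≤
      ∑ m ∈ S j, -2 * (β m * Var - (β m * (E - L m)) ^ 2) := by
    intro j
    have : ∑ m ∈ S j, -2 * (β m * Var - (β m * (E - L m)) ^ 2) =
        -2 * (∑ m ∈ S j, β m) * Var + 2 * ∑ m ∈ S j, (β m * (L m - E)) ^ 2 := by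
      rw [Finset.mul_sum, Finset.mul_sum, Finset.sum_mul, ← Finset.sum_add_distrib]
      exact Finset.sum_congr rfl fun m _ => by ring
    rw [this]
    have := mul_le_mul_of_nonneg_right (hβ j) hVar0
    linarith
  have hsum : -(1 / 2) * Var + 2 * (q j₀ / Q) * ∑ m ∈ S j₀, (β m * (L m - E)) ^ 2 ≤
      (∑ j, q j * ∑ m ∈ S j, -2 * (β m * Var - (β m * (E - L m)) ^ 2)) / Q := by
    rw [le_div_iff₀ hQ]
    have h1 : ∑ j, q j * (-(1 / 2) * Var + 2 * ∑ m ∈ S j, (β m * (L m - E)) ^ 2) ≤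
        ∑ j, q j * ∑ m ∈ S j, -2 * (β m * Var - (β m * (E - L m)) ^ 2) :=
      Finset.sum_le_sum fun j _ => mul_le_mul_of_nonneg_left (hlow j) (hq j)
    refine le_trans ?_ h1
    have h2 : q j₀ * (2 * ∑ m ∈ S j₀, (β m * (L m - E)) ^ 2) ≤
        ∑ j, q j * (2 * ∑ m ∈ S j, (β m * (L m - E)) ^ 2) :=
      Finset.single_le_sum (f := fun j => q j * (2 * ∑ m ∈ S j, (β m * (L m - E)) ^ 2))
        (fun j _ => mul_nonneg (hq j) (mul_nonneg (by norm_num)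
          (Finset.sum_nonneg fun m _ => sq_nonneg _))) (Finset.mem_univ j₀)
    have h3 : ∑ j, q j * (-(1 / 2) * Var + 2 * ∑ m ∈ S j, (β m * (L m - E)) ^ 2) =
        -(1 / 2) * Var * Q + ∑ j, q j * (2 * ∑ m ∈ S j, (β m * (L m - E)) ^ 2) := by
      rw [hQdef, Finset.mul_sum, ← Finset.sum_add_distrib]
      exact Finset.sum_congr rfl fun j _ => by ring
    rw [h3]
    have h4 : (-(1 / 2) * Var + 2 * (q j₀ / Q) * ∑ m ∈ S j₀, (β m * (L m - E)) ^ 2) * Q =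
        -(1 / 2) * Var * Q + q j₀ * (2 * ∑ m ∈ S j₀, (β m * (L m - E)) ^ 2) := by
      field_simp
    rw [h4]
    linarith
  rw [hsplit]
  linarith

end RealEstimate

section SmoothNear

variable {E F : Type*} [NormedAddCommGroup E] [NormedSpace ℝ E] [NormedAddCommGroup F]
  [NormedSpace ℝ F] {x : E}

/-- `f` is smooth in a neighbourhood of `x`. -/
def SmoothNear (f : E → F) (x : E) : Prop := ∀ᶠ y in 𝓝 x, ContDiffAt ℝ ∞ f y

lemma _root_.ContDiff.smoothNear {f : E → F} (hf : ContDiff ℝ ∞ f) (x : E) : SmoothNear f x :=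
  Filter.Eventually.of_forall fun _ => hf.contDiffAt

namespace SmoothNear

lemma contDiffAt {f : E → F} (hf : SmoothNear f x) : ContDiffAt ℝ ∞ f x := hf.self_of_nhds

lemma continuousAt {f : E → F} (hf : SmoothNear f x) : ContinuousAt f x :=
  hf.contDiffAt.continuousAt

lemma add {f g : E → F} (hf : SmoothNear f x) (hg : SmoothNear g x) :
    SmoothNear (fun y => f y + g y) x := by
  filter_upwards [hf, hg] with y h1 h2 using h1.add h2

lemma sub {f g : E → F} (hf : SmoothNear f x) (hg : SmoothNear g x) :
    SmoothNear (fun y => f y - g y) x := by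
  filter_upwards [hf, hg] with y h1 h2 using h1.sub h2

lemma mul {A : Type*} [NormedRing A] [NormedAlgebra ℝ A] {f g : E → A} (hf : SmoothNear f x)
    (hg : SmoothNear g x) : SmoothNear (fun y => f y * g y) x := by
  filter_upwards [hf, hg] with y h1 h2 using h1.mul h2

lemma pow {f : E → ℝ} (hf : SmoothNear f x) (k : ℕ) : SmoothNear (fun y => f y ^ k) x := by
  filter_upwards [hf] with y h1 using h1.pow k

lemma sum {ι : Type*} {s : Finset ι} {f : ι → E → F} (hf : ∀ i ∈ s, SmoothNear (f i) x) :
    SmoothNear (fun y => ∑ i ∈ s, f i y) x := by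
  filter_upwards [s.eventually_all.2 hf] with y hy using ContDiffAt.sum hy

lemma prod {ι : Type*} {s : Finset ι} {f : ι → E → ℝ} (hf : ∀ i ∈ s, SmoothNear (f i) x) :
    SmoothNear (fun y => ∏ i ∈ s, f i y) x := by
  filter_upwards [s.eventually_all.2 hf] with y hy using contDiffAt_prod hy

lemma inv {f : E → ℝ} (hf : SmoothNear f x) (h0 : f x ≠ 0) : SmoothNear (fun y => (f y)⁻¹) x := by
  filter_upwards [hf, hf.continuousAt.eventually_ne h0] with y h1 h2 using h1.inv h2

lemma log {f : E → ℝ} (hf : SmoothNear f x) (h0 : f x ≠ 0) :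
    SmoothNear (fun y => Real.log (f y)) x := by
  filter_upwards [hf, hf.continuousAt.eventually_ne h0] with y h1 h2 using h1.log h2

lemma norm_sq {f : E → ℂ} (hf : SmoothNear f x) : SmoothNear (fun y => ‖f y‖ ^ 2) x := by
  filter_upwards [hf] with y h1 using h1.norm_sq ℝ

lemma prodMk {G : Type*} [NormedAddCommGroup G] [NormedSpace ℝ G] {f : E → F} {g : E → G}
    (hf : SmoothNear f x) (hg : SmoothNear g x) : SmoothNear (fun y => (f y, g y)) x := by
  filter_upwards [hf, hg] with y h1 h2 using h1.prodMk h2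

lemma comp {G : Type*} [NormedAddCommGroup G] [NormedSpace ℝ G] {g : F → G} {f : E → F}
    (hg : SmoothNear g (f x)) (hf : SmoothNear f x) : SmoothNear (fun y => g (f y)) x := by
  filter_upwards [hf.continuousAt.eventually hg, hf] with y h1 h2 using ContDiffAt.comp y h1 h2

end SmoothNear

/-- The implicit function theorem, with smoothness in a neighbourhood. -/
theorem exists_smoothNear_implicit {E₁ E₂ F : Type*} [NormedAddCommGroup E₁] [NormedSpace ℝ E₁]
    [CompleteSpace E₁] [NormedAddCommGroup E₂] [NormedSpace ℝ E₂] [CompleteSpace E₂]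
    [NormedAddCommGroup F] [NormedSpace ℝ F] [CompleteSpace F] {f : E₁ × E₂ → F} {w₀ : E₁ × E₂}
    (hf : SmoothNear f w₀)
    (hinv : ∀ᶠ w in 𝓝 w₀, (fderiv ℝ f w ∘L .inr ℝ E₁ E₂).IsInvertible) :
    ∃ V : E₁ → E₂, SmoothNear V w₀.1 ∧ V w₀.1 = w₀.2 ∧
      ∀ᶠ w in 𝓝 w₀, f w = f w₀ ↔ V w.1 = w.2 := by
  have hne : (∞ : ℕ∞ω) ≠ 0 := by simp
  obtain ⟨V, hVs, hV0, hiff⟩ : ∃ V : E₁ → E₂, ContDiffAt ℝ ∞ V w₀.1 ∧ V w₀.1 = w₀.2 ∧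
      ∀ᶠ w in 𝓝 w₀, f w = f w₀ ↔ V w.1 = w.2 :=
    ⟨_, hf.contDiffAt.contDiffAt_implicitFunction hne hinv.self_of_nhds,
      hf.contDiffAt.implicitFunction_apply_self hne _,
      hf.contDiffAt.eventually_apply_eq_iff_implicitFunction hne _⟩
  refine ⟨V, ?_, hV0, hiff⟩
  have hVc : Filter.Tendsto (fun z => (z, V z)) (𝓝 w₀.1) (𝓝 w₀) := by
    have := (continuousAt_id (x := w₀.1)).prodMk hVs.continuousAt
    rw [ContinuousAt, hV0] at this
    exact this
  have hall := hiff.eventually_nhds.and (hf.and hinv)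
  filter_upwards [hVc.eventually hall] with z ⟨h1, h2, h3⟩
  have hfz : f (z, V z) = f w₀ := h1.self_of_nhds.2 rfl
  set V' := h2.implicitFunction hne h3 with hV'
  have hV'0 : V' z = V z := h2.implicitFunction_apply_self hne h3
  have hsm : ContDiffAt ℝ ∞ V' z := h2.contDiffAt_implicitFunction hne h3
  have hV'c : ContinuousAt (fun z' => (z', V' z')) z := continuousAt_id.prodMk hsm.continuousAt
  refine hsm.congr_of_eventuallyEq ?_
  have hpt : (z, V' z) = (z, V z) := by rw [hV'0]
  rw [← hpt] at h1
  filter_upwards [hV'c.eventually h1, h2.eventually_apply_implicitFunction hne h3] with z' e1 e2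
  exact e1.1 (e2.trans hfz)

end SmoothNear

/-- The parameters `(β, θ, ρ, q)` of the local models. -/
abbrev ModelParam (ι J : Type) (n : ℕ) : Type :=
  (ι → ℝ) × (ι → ℂ) × (ι → Fin n → ℝ) × (J → ℝ)

/-- The discrete data of the local models of the hypersurfaces near a simplex, with vertices
`m₀`, `m₁` and `σ s`. -/
structure ModelData (ι J : Type) [Fintype ι] [Fintype J] (n : ℕ) where
  κ : ℝ
  b : ι → ℝ
  S : J → Finset ι
  m₀ : ι
  m₁ : ι
  σ : Fin n → ι
  j₀ : J
  c₀ : ℝ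
  κ_le : 4 * ((n : ℝ) + 2) ≤ κ
  b_m₀ : b m₀ = 0
  b_σ : ∀ s, b (σ s) = 0
  σ_mem : ∀ s, σ s ∈ S j₀
  card_le : ∀ j, (S j).card ≤ n + 2
  c₀_pos : 0 < c₀

namespace ModelData

variable {ι J : Type} [Fintype ι] [Fintype J] {n : ℕ} (D : ModelData ι J n)

lemma κ_pos : 0 < D.κ := lt_of_lt_of_le (by positivity) D.κ_le

/-- The linear form `∑ ρ_{m,s} u_s`. -/
def lin (m : ι) (p : ModelParam ι J n) (u : Fin n → ℂ) : ℂ := ∑ s, (p.2.2.1 m s : ℂ) * u s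

/-- The normalized monomials, in the coordinates `(u, v)`. -/
def term (m : ι) (p : ModelParam ι J n) (u : Fin n → ℂ) (v : ℂ) : ℂ :=
  p.2.1 m * Complex.exp (D.κ / 2) * expGlue 0 (p.1 m, 1 / 2 - lin m p u) *
    Complex.exp (D.b m * v)

/-- The defining equation. -/
def eqn (p : ModelParam ι J n) (u : Fin n → ℂ) (v : ℂ) : ℂ := ∑ m, D.term m p u v

/-- The derivative of the defining equation with respect to `v`. -/
def eqnDeriv (p : ModelParam ι J n) (u : Fin n → ℂ) (v : ℂ) : ℂ :=
  ∑ m, (D.b m : ℂ) * D.term m p u v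

/-- The sum of the squared norms of the normalized monomials. -/
def normSum (p : ModelParam ι J n) (u : Fin n → ℂ) (v : ℂ) : ℝ := ∑ m, ‖D.term m p u v‖ ^ 2

/-- The functions `a_m`, divided by their values at the base point. -/
def scaled (m : ι) (p : ModelParam ι J n) (u : Fin n → ℂ) (v : ℂ) : ℝ :=
  1 - 2 * (lin m p u).re + p.1 m * (Real.log (D.normSum p u v) - 2 * D.b m * v.re)

/-- The function `h`, divided by a constant. -/
def hsum (p : ModelParam ι J n) (u : Fin n → ℂ) (v : ℂ) : ℝ :=
  ∑ j, p.2.2.2 j * ((∏ m ∈ D.S j, D.scaled m p u v)⁻¹) ^ 2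

/-- The Kähler potential. -/
def pot (p : ModelParam ι J n) (u : Fin n → ℂ) (v : ℂ) : ℝ :=
  Real.log (D.hsum p u v) + Real.log (D.normSum p u v)

/-- The density of the volume form. -/
def dens (p : ModelParam ι J n) (u : Fin n → ℂ) (v : ℂ) : ℝ :=
  D.c₀ * (p.1 D.m₀ * p.1 D.m₁) ^ 2 * (D.hsum p u v * D.normSum p u v) / ‖D.eqnDeriv p u v‖ ^ 2

/-- The admissible parameters, apart from a closedness condition at infinity. -/
structure IsAdmissible (C c : ℝ) (p : ModelParam ι J n) : Prop where
  β_pos : ∀ m, 0 < p.1 m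
  β_le : ∀ m, p.1 m ≤ 1 / D.κ
  norm_θ : ∀ m, ‖p.2.1 m‖ = 1
  ρ_le : ∀ m s, |p.2.2.1 m s| ≤ C
  ρ_m₀ : ∀ s, p.2.2.1 D.m₀ s = 0
  ρ_σ : ∀ s s', p.2.2.1 (D.σ s) s' = if s' = s then 1 else 0
  q_nonneg : ∀ j, 0 ≤ p.2.2.2 j
  q_le : ∀ j, p.2.2.2 j ≤ C
  q_j₀ : p.2.2.2 D.j₀ = 1
  eqn_eq : D.eqn p 0 0 = 0
  normSum_eq : D.normSum p 0 0 = 1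
  le_eqnDeriv : c ≤ ‖D.eqnDeriv p 0 0‖
  le_β_m₀ : c ≤ p.1 D.m₀
  le_β_m₁ : c ≤ p.1 D.m₁

section Smoothness

lemma contDiff_lin (m : ι) : ContDiff ℝ ∞
    (fun x : ModelParam ι J n × (Fin n → ℂ) × ℂ => lin m x.1 x.2.1) := by
  unfold lin
  refine ContDiff.sum fun s _ => ?_
  have h1 : ContDiff ℝ ∞ (fun x : ModelParam ι J n × (Fin n → ℂ) × ℂ => x.1.2.2.1 m s) := by
    fun_prop
  have h2 : ContDiff ℝ ∞ (fun x : ModelParam ι J n × (Fin n → ℂ) × ℂ => x.2.1 s) := by fun_prop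
  exact (Complex.ofRealCLM.contDiff.comp h1).mul h2

lemma smoothNear_term (m : ι) (p : ModelParam ι J n) :
    SmoothNear (fun x : ModelParam ι J n × (Fin n → ℂ) × ℂ => D.term m x.1 x.2.1 x.2.2)
      (p, 0, 0) := by
  have hopen : IsOpen {q : ℝ × ℂ | 0 < q.2.re} :=
    isOpen_lt continuous_const (Complex.continuous_re.comp continuous_snd)
  have hlin : ContDiff ℝ ∞ (fun x : ModelParam ι J n × (Fin n → ℂ) × ℂ =>
      (x.1.1 m, 1 / 2 - lin m x.1 x.2.1)) :=
    ContDiff.prodMk (by fun_prop) (contDiff_const.sub (contDiff_lin m))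
  have hev : ∀ᶠ x : ModelParam ι J n × (Fin n → ℂ) × ℂ in 𝓝 (p, 0, 0),
      0 < (1 / 2 - lin m x.1 x.2.1).re := by
    have hc : Continuous (fun x : ModelParam ι J n × (Fin n → ℂ) × ℂ =>
        (1 / 2 - lin m x.1 x.2.1).re) := Complex.continuous_re.comp hlin.continuous.snd
    exact hc.continuousAt.eventually (lt_mem_nhds (by simp [lin]))
  have h1 : SmoothNear (fun x : ModelParam ι J n × (Fin n → ℂ) × ℂ =>
      x.1.2.1 m * Complex.exp (D.κ / 2)) (p, 0, 0) :=
    ContDiff.smoothNear (ContDiff.mul (by fun_prop) contDiff_const) _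
  have h2 : SmoothNear (fun x : ModelParam ι J n × (Fin n → ℂ) × ℂ =>
      expGlue 0 (x.1.1 m, 1 / 2 - lin m x.1 x.2.1)) (p, 0, 0) := by
    filter_upwards [hev] with x hx
    have h3 : ContDiffAt ℝ ∞ (expGlue 0) (x.1.1 m, 1 / 2 - lin m x.1 x.2.1) :=
      (contDiffOn_expGlue 0).contDiffAt (hopen.mem_nhds hx)
    exact ContDiffAt.comp x h3 hlin.contDiffAt
  have h3 : SmoothNear (fun x : ModelParam ι J n × (Fin n → ℂ) × ℂ =>
      Complex.exp (D.b m * x.2.2)) (p, 0, 0) :=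
    ContDiff.smoothNear (contDiff_const.mul (contDiff_snd.comp contDiff_snd)).cexp _
  exact (h1.mul h2).mul h3

lemma smoothNear_eqn (p : ModelParam ι J n) :
    SmoothNear (fun x : ModelParam ι J n × (Fin n → ℂ) × ℂ => D.eqn x.1 x.2.1 x.2.2) (p, 0, 0) :=
  SmoothNear.sum fun m _ => D.smoothNear_term m p

lemma smoothNear_eqnDeriv (p : ModelParam ι J n) :
    SmoothNear (fun x : ModelParam ι J n × (Fin n → ℂ) × ℂ => D.eqnDeriv x.1 x.2.1 x.2.2)
      (p, 0, 0) :=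
  SmoothNear.sum fun m _ => (contDiff_const.smoothNear _).mul (D.smoothNear_term m p)

lemma smoothNear_normSum (p : ModelParam ι J n) :
    SmoothNear (fun x : ModelParam ι J n × (Fin n → ℂ) × ℂ => D.normSum x.1 x.2.1 x.2.2)
      (p, 0, 0) :=
  SmoothNear.sum fun m _ => (D.smoothNear_term m p).norm_sq

variable {p : ModelParam ι J n}

lemma scaled_zero (hN : D.normSum p 0 0 = 1) (m : ι) : D.scaled m p 0 0 = 1 := by
  simp [scaled, lin, hN]

lemma hsum_zero (hN : D.normSum p 0 0 = 1) : D.hsum p 0 0 = ∑ j, p.2.2.2 j := by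
  simp [hsum, D.scaled_zero hN]

lemma smoothNear_scaled (hN : D.normSum p 0 0 = 1) (m : ι) :
    SmoothNear (fun x : ModelParam ι J n × (Fin n → ℂ) × ℂ => D.scaled m x.1 x.2.1 x.2.2)
      (p, 0, 0) := by
  unfold scaled
  refine SmoothNear.add (ContDiff.smoothNear ?_ _) (SmoothNear.mul (ContDiff.smoothNear ?_ _)
    (SmoothNear.sub ((D.smoothNear_normSum p).log (by rw [hN]; exact one_ne_zero))
      (ContDiff.smoothNear ?_ _)))
  · exact contDiff_const.sub (contDiff_const.mul (Complex.reCLM.contDiff.comp (contDiff_lin m)))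
  · fun_prop
  · exact contDiff_const.mul (Complex.reCLM.contDiff.comp (contDiff_snd.comp contDiff_snd))

lemma smoothNear_hsum (hN : D.normSum p 0 0 = 1) :
    SmoothNear (fun x : ModelParam ι J n × (Fin n → ℂ) × ℂ => D.hsum x.1 x.2.1 x.2.2)
      (p, 0, 0) := by
  refine SmoothNear.sum fun j _ => SmoothNear.mul (ContDiff.smoothNear (by fun_prop) _)
    (SmoothNear.pow (SmoothNear.inv (SmoothNear.prod fun m _ => D.smoothNear_scaled hN m) ?_) 2)
  simp [D.scaled_zero hN]

lemma smoothNear_pot (hN : D.normSum p 0 0 = 1) (hq : 0 < ∑ j, p.2.2.2 j) :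
    SmoothNear (fun x : ModelParam ι J n × (Fin n → ℂ) × ℂ => D.pot x.1 x.2.1 x.2.2)
      (p, 0, 0) :=
  ((D.smoothNear_hsum hN).log (by simp only [D.hsum_zero hN]; exact hq.ne')).add
    ((D.smoothNear_normSum p).log (by simp only [hN]; exact one_ne_zero))

lemma smoothNear_dens (hN : D.normSum p 0 0 = 1) (hd : D.eqnDeriv p 0 0 ≠ 0) :
    SmoothNear (fun x : ModelParam ι J n × (Fin n → ℂ) × ℂ => D.dens x.1 x.2.1 x.2.2)
      (p, 0, 0) := by
  unfold dens
  simp only [div_eq_mul_inv]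
  refine ((ContDiff.smoothNear (by fun_prop) _).mul
    ((D.smoothNear_hsum hN).mul (D.smoothNear_normSum p))).mul
    ((D.smoothNear_eqnDeriv p).norm_sq.inv ?_)
  simpa using hd

end Smoothness

section Chart

/-- `(ψ, v)` are holomorphic coordinates near `u₀` of a piece of the model hypersurface with
parameter `p`, based at the origin. -/
structure IsChart (p : ModelParam ι J n) (ψ : (Fin n → ℂ) → Fin n → ℂ) (v : (Fin n → ℂ) → ℂ)
    (u₀ : Fin n → ℂ) : Prop where
  ψ_diff : ∀ᶠ y in 𝓝 u₀, DifferentiableAt ℂ ψ y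
  v_diff : ∀ᶠ y in 𝓝 u₀, DifferentiableAt ℂ v y
  ψ_zero : ψ u₀ = 0
  v_zero : v u₀ = 0
  eqn_eq : ∀ᶠ y in 𝓝 u₀, D.eqn p (ψ y) (v y) = 0
  injective : Function.Injective (fderiv ℂ ψ u₀)

lemma eventually_contDiffAt_of_differentiableAt {G : Type} [NormedAddCommGroup G] [NormedSpace ℂ G]
    [FiniteDimensional ℂ G] {f : (Fin n → ℂ) → G} {u₀ : Fin n → ℂ}
    (hf : ∀ᶠ y in 𝓝 u₀, DifferentiableAt ℂ f y) : ∀ᶠ y in 𝓝 u₀, ContDiffAt ℂ ∞ f y := by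
  obtain ⟨s, hs, hso, hus⟩ := eventually_nhds_iff.1 hf
  have := contDiffOn_of_differentiableOn_complex hso
    (fun y hy => (hs y hy).differentiableWithinAt)
  filter_upwards [hso.mem_nhds hus] with y hy using this.contDiffAt (hso.mem_nhds hy)

variable {D} {C c : ℝ} {p : ModelParam ι J n} {ψ : (Fin n → ℂ) → Fin n → ℂ} {v : (Fin n → ℂ) → ℂ}
  {u₀ : Fin n → ℂ}

lemma term_eq_of_pos (m : ι) (hβ : 0 < p.1 m) (u : Fin n → ℂ) (v : ℂ) :
    D.term m p u v = p.2.1 m * Complex.exp (D.κ / 2 - (1 / 2 - lin m p u) * (p.1 m : ℂ)⁻¹ +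
      D.b m * v) := by
  simp only [term, expGlue, hβ, if_true, pow_zero, one_mul]
  rw [Complex.exp_add, Complex.exp_sub, Complex.exp_neg]
  ring

/-- The logarithm of a normalized monomial, up to a constant. -/
def logTerm (D : ModelData ι J n) (p : ModelParam ι J n) (u : Fin n → ℂ) (v : ℂ) : ι → ℂ :=
  fun m => (p.1 m : ℂ)⁻¹ * lin m p u + D.b m * v

lemma norm_term_sq (hp : D.IsAdmissible C c p) (m : ι) (u : Fin n → ℂ) (v : ℂ) :
    ‖D.term m p u v‖ ^ 2 =
      Real.exp (D.κ - (p.1 m)⁻¹) * Real.exp (2 * (logTerm D p u v m).re) := by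
  rw [term_eq_of_pos m (hp.β_pos m), norm_mul, hp.norm_θ, one_mul, Complex.norm_exp, sq,
    ← Real.exp_add, ← Real.exp_add]
  congr 1
  simp only [logTerm, Complex.add_re, Complex.sub_re]
  have h1 : ((1 / 2 - lin m p u) * (p.1 m : ℂ)⁻¹).re =
      (p.1 m)⁻¹ / 2 - ((p.1 m : ℂ)⁻¹ * lin m p u).re := by
    rw [sub_mul, Complex.sub_re, mul_comm (lin m p u)]
    congr 1
    rw [← Complex.ofReal_inv]
    simp only [one_div, Complex.re_mul_ofReal]
    norm_num
    ring
  have h2 : ((D.κ : ℂ) / 2).re = D.κ / 2 := by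
    rw [show ((D.κ : ℂ) / 2) = ((D.κ / 2 : ℝ) : ℂ) by push_cast; ring, Complex.ofReal_re]
  rw [h1, h2]
  ring

/-- Twice the real part, componentwise. -/
def twoRe (ι : Type) [Fintype ι] : (ι → ℂ) →L[ℝ] (ι → ℝ) :=
  ContinuousLinearMap.pi fun m => (2 : ℝ) • Complex.reCLM.comp (ContinuousLinearMap.proj m)

lemma twoRe_apply (z : ι → ℂ) (m : ι) : twoRe ι z m = 2 * (z m).re := rfl

lemma pot_eq_logPotential (hp : D.IsAdmissible C c p) (u : Fin n → ℂ) (v : ℂ) :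
    D.pot p u v = logPotential (fun m => Real.exp (D.κ - (p.1 m)⁻¹)) p.1 p.2.2.2 D.S
      (twoRe ι (logTerm D p u v)) := by
  have hN : D.normSum p u v = ∑ m, Real.exp (D.κ - (p.1 m)⁻¹) *
      Real.exp (twoRe ι (logTerm D p u v) m) :=
    Finset.sum_congr rfl fun m _ => norm_term_sq hp m u v
  unfold pot logPotential hsum
  rw [← hN]
  congr 2
  refine Finset.sum_congr rfl fun j _ => ?_
  congr 3
  refine Finset.prod_congr rfl fun m _ => ?_
  simp only [scaled, twoRe_apply, logTerm, Complex.add_re]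
  rw [← Complex.ofReal_inv, Complex.re_ofReal_mul, Complex.re_ofReal_mul]
  have := (hp.β_pos m).ne'
  field_simp
  ring

lemma sum_exp_eq_one (hp : D.IsAdmissible C c p) : ∑ m, Real.exp (D.κ - (p.1 m)⁻¹) = 1 := by
  rw [← hp.normSum_eq]
  refine Finset.sum_congr rfl fun m _ => ?_
  rw [norm_term_sq hp]
  simp [logTerm, lin]

lemma one_le_sum_q (hp : D.IsAdmissible C c p) : 1 ≤ ∑ j, p.2.2.2 j := by
  rw [← hp.q_j₀]
  exact Finset.single_le_sum (f := p.2.2.2) (fun j _ => hp.q_nonneg j) (Finset.mem_univ _)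

/-- The constant in the lower bound of the model metrics. -/
def lowerBound (D : ModelData ι J n) (C c : ℝ) : ℝ :=
  min (1 / (Fintype.card J * C)) (Real.exp (D.κ - 1 / c) * D.κ ^ 2 / 4)

lemma lowerBound_pos (hp : D.IsAdmissible C c p) : 0 < lowerBound D C c := by
  have h1 : (1 : ℝ) ≤ C := hp.q_j₀ ▸ hp.q_le D.j₀
  have h2 : 0 < Fintype.card J := Fintype.card_pos_iff.2 ⟨D.j₀⟩
  have := D.κ_pos
  unfold lowerBound
  refine lt_min ?_ ?_
  · positivity
  · positivity

/-- A lower bound for the Hessian of the potential in terms of the coordinates. -/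
lemma lowerBound_mul_le (hc : 0 < c) (hp : D.IsAdmissible C c p) (L : ι → ℝ) (hL : L D.m₀ = 0)
    (s : Fin n) :
    lowerBound D C c * (p.1 (D.σ s) * L (D.σ s)) ^ 2 ≤
      fderiv ℝ (fderiv ℝ (logPotential (fun m => Real.exp (D.κ - (p.1 m)⁻¹)) p.1 p.2.2.2 D.S))
        0 L L := by
  have hκ := D.κ_pos
  have hQ := one_le_sum_q hp
  have hβ : ∀ j, ∑ m ∈ D.S j, p.1 m ≤ 1 / 4 := by
    intro j
    calc ∑ m ∈ D.S j, p.1 m ≤ ∑ m ∈ D.S j, 1 / D.κ := Finset.sum_le_sum fun m _ => hp.β_le m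
      _ = (D.S j).card * (1 / D.κ) := by rw [Finset.sum_const, nsmul_eq_mul]
      _ ≤ ((n : ℝ) + 2) * (1 / D.κ) := by
        gcongr
        exact_mod_cast D.card_le j
      _ ≤ 1 / 4 := by
        rw [mul_one_div, div_le_div_iff₀ hκ (by norm_num)]
        linarith [D.κ_le]
  refine le_trans ?_ (le_hessian_logPotential (fun m => (Real.exp_pos _).le) (sum_exp_eq_one hp)
    hp.q_nonneg (by linarith) hβ D.j₀ L)
  set E := ∑ m', Real.exp (D.κ - (p.1 m')⁻¹) * L m' with hE
  set Q := ∑ j, p.2.2.2 j with hQdef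
  have h1 : Real.exp (D.κ - 1 / c) * E ^ 2 ≤
      ∑ m, Real.exp (D.κ - (p.1 m)⁻¹) * (L m - E) ^ 2 := by
    refine le_trans ?_ (Finset.single_le_sum
      (f := fun m => Real.exp (D.κ - (p.1 m)⁻¹) * (L m - E) ^ 2)
      (fun m _ => by positivity) (Finset.mem_univ D.m₀))
    simp only [hL, zero_sub, neg_sq]
    gcongr
    rw [one_div]
    exact inv_anti₀ hc hp.le_β_m₀
  have h2 : (p.1 (D.σ s) * (L (D.σ s) - E)) ^ 2 ≤
      ∑ m ∈ D.S D.j₀, (p.1 m * (L m - E)) ^ 2 :=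
    Finset.single_le_sum (f := fun m => (p.1 m * (L m - E)) ^ 2) (fun m _ => sq_nonneg _)
      (D.σ_mem s)
  have hQle : Q ≤ Fintype.card J * C := by
    calc Q ≤ ∑ _j : J, C := Finset.sum_le_sum fun j _ => hp.q_le j
      _ = Fintype.card J * C := by simp
  set a := lowerBound D C c with ha
  have ha0 : 0 < a := lowerBound_pos hp
  have ha1 : a ≤ 1 / Q :=
    (min_le_left _ _).trans (one_div_le_one_div_of_le (by linarith) hQle)
  have ha2 : a ≤ Real.exp (D.κ - 1 / c) * D.κ ^ 2 / 4 := min_le_right _ _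
  rw [hp.q_j₀]
  set x := p.1 (D.σ s) * (L (D.σ s) - E) with hx
  have hβσ := hp.β_le (D.σ s)
  have hβσ0 := hp.β_pos (D.σ s)
  have h3 : (p.1 (D.σ s) * L (D.σ s)) ^ 2 ≤ 2 * x ^ 2 + 2 * ((1 / D.κ) * E) ^ 2 := by
    have e1 : p.1 (D.σ s) * L (D.σ s) = x + p.1 (D.σ s) * E := by rw [hx]; ring
    have e2 : (p.1 (D.σ s) * E) ^ 2 ≤ ((1 / D.κ) * E) ^ 2 := by
      rw [mul_pow, mul_pow]; gcongr
    rw [e1]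
    nlinarith [sq_nonneg (x - p.1 (D.σ s) * E)]
  have h4 : a * (2 * ((1 / D.κ) * E) ^ 2) ≤ 1 / 2 * (Real.exp (D.κ - 1 / c) * E ^ 2) := by
    calc a * (2 * ((1 / D.κ) * E) ^ 2)
        ≤ (Real.exp (D.κ - 1 / c) * D.κ ^ 2 / 4) * (2 * ((1 / D.κ) * E) ^ 2) := by gcongr
      _ = 1 / 2 * (Real.exp (D.κ - 1 / c) * E ^ 2) := by field_simp; ring
  calc a * (p.1 (D.σ s) * L (D.σ s)) ^ 2 ≤ a * (2 * x ^ 2 + 2 * ((1 / D.κ) * E) ^ 2) := by gcongr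
    _ = 2 * a * x ^ 2 + a * (2 * ((1 / D.κ) * E) ^ 2) := by ring
    _ ≤ 2 * (1 / Q) * (∑ m ∈ D.S D.j₀, (p.1 m * (L m - E)) ^ 2) +
        1 / 2 * ∑ m, Real.exp (D.κ - (p.1 m)⁻¹) * (L m - E) ^ 2 := by
      exact add_le_add (by gcongr) (h4.trans (by gcongr))
    _ = _ := by ring

end Chart

end ModelData

namespace ModelData

variable {ι J : Type} [Fintype ι] [Fintype J] {n : ℕ} {D : ModelData ι J n}
  {C c : ℝ} {p : ModelParam ι J n} {ψ : (Fin n → ℂ) → Fin n → ℂ} {v : (Fin n → ℂ) → ℂ}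
  {u₀ : Fin n → ℂ}

/-- `lin m p` as a continuous linear map. -/
def linCLM (m : ι) (p : ModelParam ι J n) : (Fin n → ℂ) →L[ℂ] ℂ :=
  ∑ s, (p.2.2.1 m s : ℂ) • ContinuousLinearMap.proj s

lemma linCLM_apply {ι J : Type} (m : ι) (p : ModelParam ι J n) (u : Fin n → ℂ) :
    linCLM m p u = lin m p u := by
  simp [linCLM, lin]

lemma hasFDerivAt_logTerm (hψ : DifferentiableAt ℂ ψ u₀) (hv : DifferentiableAt ℂ v u₀) :
    HasFDerivAt (fun y => logTerm D p (ψ y) (v y)) (ContinuousLinearMap.pi fun m =>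
      (p.1 m : ℂ)⁻¹ • (linCLM m p).comp (fderiv ℂ ψ u₀) + (D.b m : ℂ) • fderiv ℂ v u₀) u₀ := by
  rw [hasFDerivAt_pi]
  intro m
  simp only [logTerm, ← linCLM_apply]
  exact (((linCLM m p).hasFDerivAt.comp u₀ hψ.hasFDerivAt).const_mul _).add
    (hv.hasFDerivAt.const_mul _)

lemma IsChart.contDiffAt_ψ (h : D.IsChart p ψ v u₀) : ContDiffAt ℂ ∞ ψ u₀ :=
  (eventually_contDiffAt_of_differentiableAt h.ψ_diff).self_of_nhds

lemma IsChart.contDiffAt_v (h : D.IsChart p ψ v u₀) : ContDiffAt ℂ ∞ v u₀ :=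
  (eventually_contDiffAt_of_differentiableAt h.v_diff).self_of_nhds

/-- The lower bound for the metric in a chart. -/
lemma IsChart.le_levi (hc : 0 < c) (hp : D.IsAdmissible C c p) (h : D.IsChart p ψ v u₀)
    (X : Fin n → ℂ) :
    lowerBound D C c * ‖fderiv ℂ ψ u₀ X‖ ^ 2 ≤
      (levi (fun y => D.pot p (ψ y) (v y)) u₀ X X).re := by
  have hψ := h.ψ_diff.self_of_nhds
  have hv := h.v_diff.self_of_nhds
  have hsm : ContDiffAt ℂ 2 (fun y => logTerm D p (ψ y) (v y)) u₀ := by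
    refine contDiffAt_pi.2 fun m => ?_
    simp only [logTerm, ← linCLM_apply]
    exact ((contDiffAt_const.mul ((linCLM m p).contDiff.contDiffAt.comp u₀ h.contDiffAt_ψ)).add
      (contDiffAt_const.mul h.contDiffAt_v)).of_le ENat.LEInfty.out
  have hzero : twoRe ι (logTerm D p (ψ u₀) (v u₀)) = 0 := by
    ext m
    simp [twoRe_apply, logTerm, h.ψ_zero, h.v_zero, lin]
  have hG : ContDiffAt ℝ 2 (logPotential (fun m => Real.exp (D.κ - (p.1 m)⁻¹)) p.1 p.2.2.2 D.S)
      (twoRe ι (logTerm D p (ψ u₀) (v u₀))) := by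
    rw [hzero]
    exact (contDiffAt_logPotential (sum_exp_eq_one hp)
      (by linarith [one_le_sum_q hp])).of_le ENat.LEInfty.out
  have hpot : (fun y => D.pot p (ψ y) (v y)) = fun y =>
      logPotential (fun m => Real.exp (D.κ - (p.1 m)⁻¹)) p.1 p.2.2.2 D.S
        (twoRe ι (logTerm D p (ψ y) (v y))) := by
    ext y
    exact pot_eq_logPotential hp _ _
  rw [hpot, levi_re_comp (twoRe ι) (lam := fun y => logTerm D p (ψ y) (v y)) hG hsm, hzero,
    (hasFDerivAt_logTerm hψ hv).fderiv]
  set d : ι → ℂ := (ContinuousLinearMap.pi fun m =>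
      (p.1 m : ℂ)⁻¹ • (linCLM m p).comp (fderiv ℂ ψ u₀) + (D.b m : ℂ) • fderiv ℂ v u₀) X with hd
  have hdm : ∀ m, d m = (p.1 m : ℂ)⁻¹ * lin m p (fderiv ℂ ψ u₀ X) + D.b m * fderiv ℂ v u₀ X := by
    intro m
    rw [← linCLM_apply]
    rfl
  have hd0 : d D.m₀ = 0 := by
    rw [hdm, D.b_m₀]
    simp [lin, hp.ρ_m₀]
  have hds : ∀ s, (p.1 (D.σ s) : ℂ) * d (D.σ s) = fderiv ℂ ψ u₀ X s := by
    intro s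
    have hne : (p.1 (D.σ s) : ℂ) ≠ 0 := by exact_mod_cast (hp.β_pos _).ne'
    rw [hdm, D.b_σ]
    simp only [lin, hp.ρ_σ, apply_ite Complex.ofReal, Complex.ofReal_one, Complex.ofReal_zero,
      ite_mul, one_mul, zero_mul, Finset.sum_ite_eq', Finset.mem_univ, if_true]
    rw [add_zero, mul_inv_cancel_left₀ hne]
  have hre : ∀ s, p.1 (D.σ s) * twoRe ι d (D.σ s) = 2 * (fderiv ℂ ψ u₀ X s).re := by
    intro s
    rw [← hds, Complex.re_ofReal_mul, twoRe_apply]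
    ring
  have him : ∀ s, p.1 (D.σ s) * twoRe ι (Complex.I • d) (D.σ s) =
      -(2 * (fderiv ℂ ψ u₀ X s).im) := by
    intro s
    rw [← hds, Complex.im_ofReal_mul, twoRe_apply]
    simp
    ring
  set H := fderiv ℝ (fderiv ℝ
    (logPotential (fun m => Real.exp (D.κ - (p.1 m)⁻¹)) p.1 p.2.2.2 D.S)) 0 with hH
  have hs : ∀ s, lowerBound D C c * ‖fderiv ℂ ψ u₀ X s‖ ^ 2 ≤
      (H (twoRe ι d) (twoRe ι d) + H (twoRe ι (Complex.I • d)) (twoRe ι (Complex.I • d))) / 4 := by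
    intro s
    have h1 := lowerBound_mul_le hc hp (twoRe ι d) (by simp [twoRe_apply, hd0]) s
    have h2 := lowerBound_mul_le hc hp (twoRe ι (Complex.I • d)) (by simp [twoRe_apply, hd0]) s
    rw [hre] at h1
    rw [him] at h2
    refine le_trans (le_of_eq ?_) (div_le_div_of_nonneg_right (add_le_add h1 h2) (by norm_num))
    rw [← Complex.normSq_eq_norm_sq, Complex.normSq_apply]
    ring
  by_cases hn : Nonempty (Fin n)
  · obtain ⟨s₀⟩ := hn
    have ha := lowerBound_pos hp
    have hM := le_trans (by positivity) (hs s₀)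
    rw [mul_comm, ← le_div_iff₀ ha]
    refine (Real.le_sqrt (norm_nonneg _) (by positivity)).1 ?_
    refine (pi_norm_le_iff_of_nonneg (Real.sqrt_nonneg _)).2 fun s => ?_
    refine Real.le_sqrt_of_sq_le ?_
    rw [le_div_iff₀ ha, mul_comm]
    exact hs s
  · rw [not_nonempty_iff] at hn
    have hX : X = 0 := Subsingleton.elim _ _
    have hd0 : d = 0 := by rw [hd, hX, map_zero]
    rw [hd0, hX]
    simp

/-- The set of parameters that occur. -/
def goodSet (D : ModelData ι J n) (C c : ℝ) : Set (ModelParam ι J n) :=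
  {p | D.IsAdmissible C c p ∧ ∃ ψ v u₀, D.IsChart p ψ v u₀}

lemma continuous_term_zero (m : ι) :
    Continuous (fun p : ModelParam ι J n => D.term m p 0 0) := by
  rw [continuous_iff_continuousAt]
  intro p
  exact ContinuousAt.comp (f := fun p : ModelParam ι J n => (p, (0 : Fin n → ℂ), (0 : ℂ)))
    (D.smoothNear_term m p).continuousAt (by fun_prop)

/-- Closed conditions satisfied by the admissible parameters. -/
structure IsLimitParam (D : ModelData ι J n) (c : ℝ) (p : ModelParam ι J n) : Prop where
  eqn_eq : D.eqn p 0 0 = 0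
  normSum_eq : D.normSum p 0 0 = 1
  le_eqnDeriv : c ≤ ‖D.eqnDeriv p 0 0‖
  le_β_m₀ : c ≤ p.1 D.m₀
  le_β_m₁ : c ≤ p.1 D.m₁
  one_le_sum_q : 1 ≤ ∑ j, p.2.2.2 j

lemma isLimitParam_of_mem_closure (hp : p ∈ closure (D.goodSet C c)) : D.IsLimitParam c p := by
  have key : closure (D.goodSet C c) ⊆ {p | D.eqn p 0 0 = 0} ∩ {p | D.normSum p 0 0 = 1} ∩
      {p | c ≤ ‖D.eqnDeriv p 0 0‖} ∩ {p | c ≤ p.1 D.m₀} ∩ {p | c ≤ p.1 D.m₁} ∩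
      {p | 1 ≤ ∑ j, p.2.2.2 j} := by
    refine closure_minimal (fun p hp => ⟨⟨⟨⟨⟨hp.1.eqn_eq, hp.1.normSum_eq⟩, hp.1.le_eqnDeriv⟩,
      hp.1.le_β_m₀⟩, hp.1.le_β_m₁⟩, ModelData.one_le_sum_q hp.1⟩) ?_
    have hterm := continuous_term_zero (D := D)
    refine ((((IsClosed.inter ?_ ?_).inter ?_).inter ?_).inter ?_).inter ?_
    · exact isClosed_eq (continuous_finsetSum _ fun m _ => hterm m) continuous_const
    · exact isClosed_eq (continuous_finsetSum _ fun m _ => (hterm m).norm.pow 2) continuous_const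
    · exact isClosed_le continuous_const
        (continuous_finsetSum _ fun m _ => continuous_const.mul (hterm m)).norm
    · exact isClosed_le continuous_const (by fun_prop)
    · exact isClosed_le continuous_const (by fun_prop)
    · exact isClosed_le continuous_const (by fun_prop)
  obtain ⟨⟨⟨⟨⟨h1, h2⟩, h3⟩, h4⟩, h5⟩, h6⟩ := key hp
  exact ⟨h1, h2, h3, h4, h5, h6⟩

lemma isCompact_closure_goodSet (D : ModelData ι J n) (C c : ℝ) :
    IsCompact (closure (D.goodSet C c)) := by
  refine Bornology.IsBounded.isCompact_closure ?_
  refine (Metric.isBounded_closedBall (x := (0 : ModelParam ι J n))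
    (r := max (1 / D.κ) (max 1 (max C 0)))).subset fun p hp => ?_
  obtain ⟨hp, -⟩ := hp
  have hκ := D.κ_pos
  rw [mem_closedBall_zero_iff]
  refine norm_prod_le_iff.2 ⟨?_, norm_prod_le_iff.2 ⟨?_, norm_prod_le_iff.2 ⟨?_, ?_⟩⟩⟩
  · refine (pi_norm_le_iff_of_nonneg (by positivity)).2 fun m => ?_
    rw [Real.norm_of_nonneg (hp.β_pos m).le]
    exact (hp.β_le m).trans (le_max_left _ _)
  · refine (pi_norm_le_iff_of_nonneg (by positivity)).2 fun m => ?_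
    rw [hp.norm_θ]
    exact (le_max_left _ _).trans (le_max_right _ _)
  · refine (pi_norm_le_iff_of_nonneg (by positivity)).2 fun m => ?_
    refine (pi_norm_le_iff_of_nonneg (by positivity)).2 fun s => ?_
    exact (hp.ρ_le m s).trans ((le_max_left _ _).trans
      ((le_max_right _ _).trans (le_max_right _ _)))
  · refine (pi_norm_le_iff_of_nonneg (by positivity)).2 fun j => ?_
    rw [Real.norm_of_nonneg (hp.q_nonneg j)]
    exact (hp.q_le j).trans ((le_max_left _ _).trans ((le_max_right _ _).trans (le_max_right _ _)))

/-- The coordinate `v` on the model hypersurface as a smooth function of `(p, u)`. -/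
lemma IsLimitParam.exists_implicit (hc : 0 < c) (hp : D.IsLimitParam c p) :
    ∃ V : ModelParam ι J n × (Fin n → ℂ) → ℂ, SmoothNear V (p, 0) ∧ V (p, 0) = 0 ∧
      ∀ᶠ w : (ModelParam ι J n × (Fin n → ℂ)) × ℂ in 𝓝 ((p, 0), 0),
        D.eqn w.1.1 w.1.2 w.2 = 0 ↔ V w.1 = w.2 := by
  set f : (ModelParam ι J n × (Fin n → ℂ)) × ℂ → ℂ := fun w => D.eqn w.1.1 w.1.2 w.2 with hf
  have hfs : SmoothNear f ((p, 0), 0) :=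
    SmoothNear.comp (f := fun w : (ModelParam ι J n × (Fin n → ℂ)) × ℂ => (w.1.1, w.1.2, w.2))
      (x := ((p, 0), 0)) (D.smoothNear_eqn p) (ContDiff.smoothNear (by fun_prop) _)
  have hds : ContinuousAt (fun w : (ModelParam ι J n × (Fin n → ℂ)) × ℂ =>
      D.eqnDeriv w.1.1 w.1.2 w.2) ((p, 0), 0) :=
    (SmoothNear.comp (f := fun w : (ModelParam ι J n × (Fin n → ℂ)) × ℂ => (w.1.1, w.1.2, w.2))
      (x := ((p, 0), 0)) (D.smoothNear_eqnDeriv p)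
      (ContDiff.smoothNear (by fun_prop) _)).continuousAt
  have hne : D.eqnDeriv p 0 0 ≠ 0 := norm_pos_iff.1 (hc.trans_le hp.le_eqnDeriv)
  have hinv : ∀ᶠ w in 𝓝 ((p, (0 : Fin n → ℂ)), (0 : ℂ)),
      (fderiv ℝ f w ∘L .inr ℝ (ModelParam ι J n × (Fin n → ℂ)) ℂ).IsInvertible := by
    filter_upwards [hfs, hds.eventually_ne hne] with w h1 h2
    have e1 : HasFDerivAt (fun v => f (w.1, v))
        (fderiv ℝ f w ∘L .inr ℝ (ModelParam ι J n × (Fin n → ℂ)) ℂ) w.2 :=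
      HasFDerivAt.comp w.2 (f := fun v => (w.1, v)) (g := f)
        (h1.differentiableAt (by simp)).hasFDerivAt (hasFDerivAt_prodMk_right w.1 w.2)
    have e2 : HasDerivAt (fun v => f (w.1, v)) (D.eqnDeriv w.1.1 w.1.2 w.2) w.2 := by
      refine HasDerivAt.fun_sum fun m _ => ?_
      have := (((hasDerivAt_id w.2).const_mul (D.b m : ℂ)).cexp).const_mul
        (w.1.1.2.1 m * Complex.exp (D.κ / 2) * expGlue 0 (w.1.1.1 m, 1 / 2 - lin m w.1.1 w.1.2))
      refine this.congr_deriv ?_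
      simp only [term, id, mul_one]
      ring
    have e3 := e1.unique (e2.hasFDerivAt.restrictScalars ℝ)
    rw [e3]
    refine ⟨(ContinuousLinearEquiv.unitsEquivAut ℂ (Units.mk0 _ h2)).restrictScalars ℝ, ?_⟩
    ext
    simp
  obtain ⟨V, h1, h2, h3⟩ := exists_smoothNear_implicit hfs hinv
  refine ⟨V, h1, h2, ?_⟩
  have hf0 : f ((p, 0), 0) = 0 := hp.eqn_eq
  rw [hf0] at h3
  exact h3

end ModelData

namespace ModelData

variable {ι J : Type} [Fintype ι] [Fintype J] {n : ℕ} {D : ModelData ι J n}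
  {C c : ℝ} {p p₀ : ModelParam ι J n} {ψ : (Fin n → ℂ) → Fin n → ℂ} {v : (Fin n → ℂ) → ℂ}
  {u₀ : Fin n → ℂ} {U : Set (ModelParam ι J n × (Fin n → ℂ))}
  {V : ModelParam ι J n × (Fin n → ℂ) → ℂ}

/-- The potential on the model hypersurface, in terms of the coordinates `u`. -/
def famPot (D : ModelData ι J n) (V : ModelParam ι J n × (Fin n → ℂ) → ℂ)
    (p : ModelParam ι J n) (u : Fin n → ℂ) : ℝ := D.pot p u (V (p, u))

/-- The density of the volume form on the model hypersurface, in terms of the coordinates `u`. -/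
def famDens (D : ModelData ι J n) (V : ModelParam ι J n × (Fin n → ℂ) → ℂ)
    (p : ModelParam ι J n) (u : Fin n → ℂ) : ℝ := D.dens p u (V (p, u))

/-- The quotient of the volume forms on the model hypersurface. -/
def famRatio (D : ModelData ι J n) (V : ModelParam ι J n × (Fin n → ℂ) → ℂ)
    (p : ModelParam ι J n) (u : Fin n → ℂ) : ℝ :=
  kahlerVolume (D.famPot V p) u / D.famDens V p u

/-- On `U` the model hypersurfaces are graphs of `V`, with nondegenerate Kähler metrics that
depend smoothly on the parameters. -/
structure IsModelFamily (D : ModelData ι J n) (U : Set (ModelParam ι J n × (Fin n → ℂ)))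
    (V : ModelParam ι J n × (Fin n → ℂ) → ℂ) : Prop where
  isOpen : IsOpen U
  contDiffOn_pot : ContDiffOn ℝ ∞ (fun z => D.famPot V z.1 z.2) U
  contDiffOn_dens : ContDiffOn ℝ ∞ (fun z => D.famDens V z.1 z.2) U
  dens_pos : ∀ z ∈ U, 0 < D.famDens V z.1 z.2
  metric_pos : ∀ z ∈ U, ∀ X, X ≠ 0 → 0 < kahlerMetric (D.famPot V z.1) z.2 X X

namespace IsModelFamily

lemma contDiffAt_pot (h : D.IsModelFamily U V) {z} (hz : z ∈ U) :
    ContDiffAt ℝ ∞ (fun z : ModelParam ι J n × (Fin n → ℂ) => D.famPot V z.1 z.2) z :=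
  h.contDiffOn_pot.contDiffAt (h.isOpen.mem_nhds hz)

lemma contDiffAt_famPot (h : D.IsModelFamily U V) {z} (hz : z ∈ U) :
    ContDiffAt ℝ ∞ (D.famPot V z.1) z.2 :=
  ContDiffAt.comp (g := fun z : ModelParam ι J n × (Fin n → ℂ) => D.famPot V z.1 z.2)
    (f := fun u => (z.1, u)) z.2 (h.contDiffAt_pot hz) (by fun_prop)

lemma ratio_pos (h : D.IsModelFamily U V) {z} (hz : z ∈ U) : 0 < D.famRatio V z.1 z.2 := by
  have hd := det_leviMatrix_pos ((h.contDiffAt_famPot hz).of_le ENat.LEInfty.out)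
    (fun X hX => (div_pos_iff_of_pos_right Real.pi_pos).1 (h.metric_pos z hz X hX))
  have := Real.pi_pos
  exact div_pos (by unfold kahlerVolume; positivity) (h.dens_pos z hz)

lemma contDiffOn_ratio (h : D.IsModelFamily U V) :
    ContDiffOn ℝ ∞ (fun z : ModelParam ι J n × (Fin n → ℂ) => D.famRatio V z.1 z.2) U :=
  fun _ hz => ((contDiffAt_const.mul (contDiffAt_det_leviMatrix (h.contDiffAt_pot hz))).div
    (h.contDiffOn_dens.contDiffAt (h.isOpen.mem_nhds hz))
    (h.dens_pos _ hz).ne').contDiffWithinAt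

lemma contDiffOn_neg_log_ratio (h : D.IsModelFamily U V) :
    ContDiffOn ℝ ∞ (fun z : ModelParam ι J n × (Fin n → ℂ) =>
      -Real.log (D.famRatio V z.1 z.2)) U :=
  (h.contDiffOn_ratio.log fun _ hz => (h.ratio_pos hz).ne').neg

lemma isSmoothMetricOn (h : D.IsModelFamily U V) :
    IsSmoothMetricOn U (fun p => kahlerMetric (D.famPot V p))
      (fun z => symmetrize (fderiv ℝ (fderiv ℝ (D.famPot V z.1)) z.2)) :=
  isSmoothMetricOn_kahlerMetric h.isOpen h.contDiffOn_pot h.metric_pos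

end IsModelFamily

lemma IsChart.surjective (h : D.IsChart p ψ v u₀) : Function.Surjective (fderiv ℂ ψ u₀) :=
  (LinearMap.injective_iff_surjective (f := (fderiv ℂ ψ u₀ : (Fin n → ℂ) →ₗ[ℂ] (Fin n → ℂ)))).1
    h.injective

lemma smoothNear_graph {G : ModelParam ι J n × (Fin n → ℂ) × ℂ → ℝ} (hV : SmoothNear V (p₀, 0))
    (hV0 : V (p₀, 0) = 0) (hG : SmoothNear G (p₀, 0, 0)) :
    SmoothNear (fun z : ModelParam ι J n × (Fin n → ℂ) => G (z.1, z.2, V z)) (p₀, 0) := by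
  have hgraph : SmoothNear (fun z : ModelParam ι J n × (Fin n → ℂ) => (z.1, z.2, V z)) (p₀, 0) :=
    (contDiff_fst.smoothNear _).prodMk ((contDiff_snd.smoothNear _).prodMk hV)
  rw [← hV0] at hG
  exact SmoothNear.comp (x := (p₀, (0 : Fin n → ℂ))) hG hgraph

/-- Near a limit of parameters that occur, the model hypersurfaces form a smooth family. -/
lemma exists_isModelFamily (hc : 0 < c) (hp₀ : p₀ ∈ closure (D.goodSet C c)) :
    ∃ U V, D.IsModelFamily U V ∧ (p₀, 0) ∈ U ∧ ∀ᶠ p in 𝓝 p₀, ∀ ψ v u₀, D.IsChart p ψ v u₀ →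
      ∀ᶠ y in 𝓝 u₀, V (p, ψ y) = v y := by
  have hlim := isLimitParam_of_mem_closure hp₀
  obtain ⟨V, hVs, hV0, hiff⟩ := hlim.exists_implicit hc
  have hne : D.eqnDeriv p₀ 0 0 ≠ 0 := norm_pos_iff.1 (hc.trans_le hlim.le_eqnDeriv)
  have hpot : SmoothNear (fun z : ModelParam ι J n × (Fin n → ℂ) => D.famPot V z.1 z.2)
      (p₀, 0) :=
    smoothNear_graph hVs hV0 (D.smoothNear_pot hlim.normSum_eq (by linarith [hlim.one_le_sum_q]))
  have hdens : SmoothNear (fun z : ModelParam ι J n × (Fin n → ℂ) => D.famDens V z.1 z.2)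
      (p₀, 0) :=
    smoothNear_graph hVs hV0 (D.smoothNear_dens hlim.normSum_eq hne)
  have hdens0 : 0 < D.famDens V p₀ 0 := by
    unfold famDens dens
    rw [hV0, D.hsum_zero hlim.normSum_eq, hlim.normSum_eq]
    have h0 : 0 < p₀.1 D.m₀ := hc.trans_le hlim.le_β_m₀
    have h1 : 0 < p₀.1 D.m₁ := hc.trans_le hlim.le_β_m₁
    have h2 : 0 < ∑ j, p₀.2.2.2 j := by linarith [hlim.one_le_sum_q]
    have h3 := norm_pos_iff.2 hne
    have h4 := D.c₀_pos
    positivity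
  -- charts are graphs of `V`
  have hchart : ∀ᶠ p in 𝓝 p₀, ∀ ψ v u₀, D.IsChart p ψ v u₀ →
      ∀ᶠ y in 𝓝 u₀, V (p, ψ y) = v y := by
    have hcont : Filter.Tendsto (fun p : ModelParam ι J n => ((p, (0 : Fin n → ℂ)), (0 : ℂ)))
        (𝓝 p₀) (𝓝 ((p₀, 0), 0)) := by
      refine Continuous.tendsto' (by fun_prop) _ _ rfl
    filter_upwards [hcont.eventually hiff.eventually_nhds] with p hp ψ v u₀ h
    have hc' : Filter.Tendsto (fun y => ((p, ψ y), v y)) (𝓝 u₀) (𝓝 ((p, 0), 0)) := by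
      have := (continuousAt_const (y := p)).prodMk h.contDiffAt_ψ.continuousAt |>.prodMk
        h.contDiffAt_v.continuousAt
      rw [ContinuousAt, h.ψ_zero, h.v_zero] at this
      exact this
    filter_upwards [hc'.eventually hp, h.eqn_eq] with y h1 h2 using h1.1 h2
  -- the lower bound of the metric at the origin
  have hin : Filter.Tendsto (fun p : ModelParam ι J n => (p, (0 : Fin n → ℂ))) (𝓝 p₀)
      (𝓝 (p₀, 0)) := Continuous.tendsto' (by fun_prop) _ _ rfl
  have hlow : ∀ᶠ p in 𝓝[D.goodSet C c] p₀, ∀ Y, lowerBound D C c * ‖Y‖ ^ 2 ≤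
      (levi (D.famPot V p) 0 Y Y).re := by
    filter_upwards [self_mem_nhdsWithin, nhdsWithin_le_nhds hchart,
      nhdsWithin_le_nhds (hin.eventually hpot)] with p ⟨hadm, ψ, v, u₀, h⟩ h1 h2 Y
    obtain ⟨X, rfl⟩ := h.surjective Y
    refine (h.le_levi hc hadm X).trans (le_of_eq ?_)
    have h3 : ContDiffAt ℝ ∞ (D.famPot V p) (ψ u₀) := by
      rw [h.ψ_zero]
      exact ContDiffAt.comp (g := fun z : ModelParam ι J n × (Fin n → ℂ) => D.famPot V z.1 z.2)
        (f := fun u => (p, u)) 0 h2 (by fun_prop)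
    have h4 := levi_comp (h3.of_le ENat.LEInfty.out) (h.contDiffAt_ψ.of_le ENat.LEInfty.out) X X
    rw [h.ψ_zero] at h4
    rw [← h4]
    congr 1
    refine levi_congr ?_ X X
    filter_upwards [h1 ψ v u₀ h] with y hy
    simp only [famPot, hy]
  have : (𝓝[D.goodSet C c] p₀).NeBot := mem_closure_iff_nhdsWithin_neBot.1 hp₀
  have hpos0 : ∀ X, X ≠ 0 → 0 < kahlerMetric (D.famPot V p₀) 0 X X := by
    intro X hX
    obtain ⟨p, hp⟩ := closure_nonempty_iff.1 ⟨p₀, hp₀⟩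
    have hl : 0 < lowerBound D C c := lowerBound_pos hp.1
    have hcl : ContinuousAt (fun p => (levi (D.famPot V p) 0 X X).re) p₀ :=
      Complex.continuous_re.continuousAt.comp
        (ContinuousAt.comp (f := fun p : ModelParam ι J n => (p, (0 : Fin n → ℂ)))
          (contDiffAt_levi hpot.contDiffAt X X).continuousAt (by fun_prop))
    have hge := ge_of_tendsto (hcl.tendsto.mono_left nhdsWithin_le_nhds)
      (hlow.mono fun p hp => hp X)
    have := norm_pos_iff.2 hX
    exact div_pos (lt_of_lt_of_le (by positivity) hge) Real.pi_pos
  have hpot2 : ContDiffAt ℝ 2 (D.famPot V p₀) 0 :=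
    (ContDiffAt.comp (g := fun z : ModelParam ι J n × (Fin n → ℂ) => D.famPot V z.1 z.2)
        (f := fun u => (p₀, u)) 0 hpot.contDiffAt (by fun_prop)).of_le ENat.LEInfty.out
  obtain ⟨a, ha, hev⟩ := exists_pos_le_of_continuousAt
    (contDiffAt_symmetrize hpot.contDiffAt).continuousAt
    (fun X hX => by
      have := hpos0 X hX
      rwa [kahlerMetric_eq_symmetrize hpot2] at this)
  have hall := (hpot.and (hdens.and (hdens.continuousAt.eventually
    (lt_mem_nhds hdens0)))).and hev
  obtain ⟨U, hU, hUo, hmem⟩ := eventually_nhds_iff.1 hall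
  refine ⟨U, V, ⟨hUo, fun z hz => (hU z hz).1.1.contDiffWithinAt,
    fun z hz => (hU z hz).1.2.1.contDiffWithinAt, fun z hz => (hU z hz).1.2.2, ?_⟩, hmem, hchart⟩
  intro z hz X hX
  have h2 : ContDiffAt ℝ 2 (D.famPot V z.1) z.2 :=
    (ContDiffAt.comp (g := fun z : ModelParam ι J n × (Fin n → ℂ) => D.famPot V z.1 z.2)
        (f := fun u => (z.1, u)) z.2 (hU z hz).1.1 (by fun_prop)).of_le ENat.LEInfty.out
  rw [kahlerMetric_eq_symmetrize h2]
  have := norm_pos_iff.2 hX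
  exact lt_of_lt_of_le (by positivity) ((hU z hz).2 X)

/-- The Jacobian determinant. -/
def jac (ψ : (Fin n → ℂ) → Fin n → ℂ) (y : Fin n → ℂ) : ℂ :=
  (Matrix.of fun j => fderiv ℂ ψ y (Pi.single j 1)).det

lemma jac_ne_zero_iff {y : Fin n → ℂ} :
    jac ψ y ≠ 0 ↔ Function.Injective (fderiv ℂ ψ y) := by
  have h1 : (Matrix.of fun j => fderiv ℂ ψ y (Pi.single j 1)).transpose =
      LinearMap.toMatrix' (fderiv ℂ ψ y : (Fin n → ℂ) →ₗ[ℂ] (Fin n → ℂ)) := by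
    ext i j
    simp [LinearMap.toMatrix'_apply]
  unfold jac
  rw [← Matrix.det_transpose, h1, ← isUnit_iff_ne_zero, ← Matrix.isUnit_iff_isUnit_det,
    ← Matrix.mulVec_injective_iff_isUnit]
  have h2 : (LinearMap.toMatrix' (fderiv ℂ ψ y : (Fin n → ℂ) →ₗ[ℂ] (Fin n → ℂ))).mulVec =
      fderiv ℂ ψ y := by
    ext1 x
    exact LinearMap.toMatrix'_mulVec _ x
  rw [h2]

lemma contDiffAt_jac {y : Fin n → ℂ} (h : ContDiffAt ℂ ∞ ψ y) : ContDiffAt ℂ ∞ (jac ψ) y := by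
  have h1 : ContDiffAt ℂ ∞ (fderiv ℂ ψ) y := h.fderiv_right (by simp)
  unfold jac
  simp only [Matrix.det_apply, Matrix.of_apply]
  refine ContDiffAt.sum fun τ _ => ContDiffAt.const_smul _ (contDiffAt_prod fun i _ => ?_)
  exact contDiffAt_pi.1 (h1.clm_apply contDiffAt_const) _

lemma contDiffAt_eqnDeriv {y : Fin n → ℂ} (hp : ∀ m, 0 < p.1 m) (hψ : ContDiffAt ℂ ∞ ψ y)
    (hv : ContDiffAt ℂ ∞ v y) : ContDiffAt ℂ ∞ (fun y => D.eqnDeriv p (ψ y) (v y)) y := by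
  unfold eqnDeriv
  simp only [term_eq_of_pos _ (hp _), ← linCLM_apply]
  refine ContDiffAt.sum fun m _ => contDiffAt_const.mul (contDiffAt_const.mul
    (ContDiffAt.cexp ?_))
  exact (contDiffAt_const.sub ((contDiffAt_const.sub
    ((linCLM m p).contDiff.contDiffAt.comp y hψ)).mul contDiffAt_const)).add
    (contDiffAt_const.mul hv)

/-- The volume density in a chart of the model hypersurface. -/
def IsChartDensity (D : ModelData ι J n) (p : ModelParam ι J n) (ψ : (Fin n → ℂ) → Fin n → ℂ)
    (v : (Fin n → ℂ) → ℂ) (u₀ : Fin n → ℂ) (dF : (Fin n → ℂ) → ℝ) : Prop :=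
  ∀ᶠ y in 𝓝 u₀, dF y = D.dens p (ψ y) (v y) * ‖jac ψ y‖ ^ 2

lemma levi_log_density {dF : (Fin n → ℂ) → ℝ} {y : Fin n → ℂ} (hp : ∀ m, 0 < p.1 m)
    (h : D.IsModelFamily U V) (hψ : ContDiffAt ℂ ∞ ψ y) (hv : ContDiffAt ℂ ∞ v y)
    (hU : (p, ψ y) ∈ U) (hj : jac ψ y ≠ 0) (hV : ∀ᶠ y in 𝓝 y, V (p, ψ y) = v y)
    (hdF : D.IsChartDensity p ψ v y dF) (X Y : Fin n → ℂ) :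
    levi (fun y => Real.log (dF y)) y X Y =
      levi (D.famPot V p) (ψ y) (fderiv ℂ ψ y X) (fderiv ℂ ψ y Y) := by
  set τ : (Fin n → ℂ) → ℂ := fun y => ((Real.sqrt D.c₀ * (p.1 D.m₀ * p.1 D.m₁) : ℝ) : ℂ) *
    jac ψ y / D.eqnDeriv p (ψ y) (v y) with hτ
  have hpos : ∀ᶠ y' in 𝓝 y, 0 < D.famDens V p (ψ y') := by
    have h1 : ContinuousAt (fun y' => (p, ψ y')) y :=
      continuousAt_const.prodMk hψ.continuousAt
    filter_upwards [h1.eventually (h.isOpen.mem_nhds hU)] with y' hy' using h.dens_pos _ hy'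
  have hpos' : ∀ᶠ y' in 𝓝 y, D.eqnDeriv p (ψ y') (v y') ≠ 0 ∧ 0 < D.hsum p (ψ y') (v y') ∧
      0 < D.normSum p (ψ y') (v y') := by
    filter_upwards [hpos, hV] with y' h1 h2
    simp only [famDens, h2, dens] at h1
    have hN : 0 ≤ D.normSum p (ψ y') (v y') := Finset.sum_nonneg fun m _ => by positivity
    have hne : D.eqnDeriv p (ψ y') (v y') ≠ 0 := by
      intro h0
      simp [h0] at h1
    have h3 := norm_pos_iff.2 hne
    have h4 := hp D.m₀
    have h5 := hp D.m₁
    have h6 := D.c₀_pos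
    have h7 : 0 < D.hsum p (ψ y') (v y') * D.normSum p (ψ y') (v y') := by
      rw [div_pos_iff_of_pos_right (by positivity)] at h1
      exact pos_of_mul_pos_right h1 (by positivity)
    have h8 : 0 < D.hsum p (ψ y') (v y') := pos_of_mul_pos_left h7 hN
    exact ⟨hne, h8, pos_of_mul_pos_right h7 h8.le⟩
  have hjc : ∀ᶠ y' in 𝓝 y, jac ψ y' ≠ 0 :=
    (contDiffAt_jac hψ).continuousAt.eventually_ne hj
  have hconst : (Real.sqrt D.c₀ * (p.1 D.m₀ * p.1 D.m₁)) ≠ 0 :=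
    mul_ne_zero (Real.sqrt_pos.2 D.c₀_pos).ne' (mul_pos (hp _) (hp _)).ne'
  have hτne : τ y ≠ 0 :=
    div_ne_zero (mul_ne_zero (by exact_mod_cast hconst) hj) hpos'.self_of_nhds.1
  have hτs : ContDiffAt ℂ ∞ τ y :=
    (contDiffAt_const.mul (contDiffAt_jac hψ)).div (contDiffAt_eqnDeriv hp hψ hv)
      hpos'.self_of_nhds.1
  have heq : (fun y => Real.log (dF y)) =ᶠ[𝓝 y] fun y =>
      D.famPot V p (ψ y) + Real.log (‖τ y‖ ^ 2) := by
    filter_upwards [hpos', hjc, hV, hdF] with y' ⟨h1, h2, h3⟩ h4 h5 h6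
    have h7 : τ y' ≠ 0 := div_ne_zero (mul_ne_zero (by exact_mod_cast hconst) h4) h1
    have h8 := norm_pos_iff.2 h1
    have h9 := norm_pos_iff.2 h7
    have e1 : ‖τ y'‖ ^ 2 = D.c₀ * (p.1 D.m₀ * p.1 D.m₁) ^ 2 * ‖jac ψ y'‖ ^ 2 /
        ‖D.eqnDeriv p (ψ y') (v y')‖ ^ 2 := by
      rw [hτ]
      simp only [norm_div, norm_mul, Complex.norm_real, div_pow, mul_pow, Real.norm_eq_abs,
        sq_abs, Real.sq_sqrt D.c₀_pos.le]
    rw [h6, famPot, h5, pot, ← Real.log_mul h2.ne' h3.ne', ← Real.log_mul (by positivity)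
      (by positivity), e1, dens]
    congr 1
    ring
  have hf : ContDiffAt ℝ ∞ (D.famPot V p) (ψ y) := h.contDiffAt_famPot (z := (p, ψ y)) hU
  rw [levi_congr heq, levi_add (ρ := fun y => D.famPot V p (ψ y)),
    levi_log_norm_sq_eq_zero (hτs.of_le ENat.LEInfty.out) hτne, add_zero,
    levi_comp (hf.of_le ENat.LEInfty.out) (hψ.of_le ENat.LEInfty.out)]
  · exact (hf.comp y (hψ.restrict_scalars ℝ)).of_le ENat.LEInfty.out
  · exact contDiffAt_log_norm_sq ((hτs.restrict_scalars ℝ).of_le ENat.LEInfty.out) hτne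

/-- The metric and the quotient of the volume forms in a chart are pulled back from the model. -/
lemma exists_chart_domain {dF : (Fin n → ℂ) → ℝ} (hp : ∀ m, 0 < p.1 m)
    (h : D.IsModelFamily U V) (hU : (p, 0) ∈ U) (hch : D.IsChart p ψ v u₀)
    (hV : ∀ᶠ y in 𝓝 u₀, V (p, ψ y) = v y) (hdF : D.IsChartDensity p ψ v u₀ dF) :
    ∃ O, IsOpen O ∧ u₀ ∈ O ∧ ContDiffOn ℝ ∞ ψ O ∧ ∀ y ∈ O, (p, ψ y) ∈ U ∧
      Function.Injective (fderiv ℝ ψ y) ∧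
      (∀ X Y, kahlerMetric (fun y => Real.log (dF y)) y X Y =
        kahlerMetric (D.famPot V p) (ψ y) (fderiv ℝ ψ y X) (fderiv ℝ ψ y Y)) ∧
      kahlerVolume (fun y => Real.log (dF y)) y / dF y = D.famRatio V p (ψ y) := by
  have h1 := eventually_contDiffAt_of_differentiableAt hch.ψ_diff
  have h2 := eventually_contDiffAt_of_differentiableAt hch.v_diff
  have h3 : ∀ᶠ y in 𝓝 u₀, (p, ψ y) ∈ U := by
    have hc : ContinuousAt (fun y' => (p, ψ y')) u₀ :=
      continuousAt_const.prodMk hch.contDiffAt_ψ.continuousAt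
    have hU' : (p, ψ u₀) ∈ U := by rwa [hch.ψ_zero]
    exact hc.eventually (h.isOpen.mem_nhds hU')
  have h4 : ∀ᶠ y in 𝓝 u₀, jac ψ y ≠ 0 :=
    (contDiffAt_jac hch.contDiffAt_ψ).continuousAt.eventually_ne (jac_ne_zero_iff.2 hch.injective)
  have hall := (h1.and h2).and ((h3.and h4).and (hV.eventually_nhds.and hdF.eventually_nhds))
  obtain ⟨O, hO, hOo, hmem⟩ := eventually_nhds_iff.1 hall
  refine ⟨O, hOo, hmem, fun y hy => ((hO y hy).1.1.restrict_scalars ℝ).contDiffWithinAt, ?_⟩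
  intro y hy
  obtain ⟨⟨e1, e2⟩, ⟨e3, e4⟩, e5, e6⟩ := hO y hy
  have hdiff : DifferentiableAt ℂ ψ y := e1.differentiableAt (by simp)
  have hre : ∀ X, fderiv ℝ ψ y X = fderiv ℂ ψ y X := fderiv_real_eq_complex hdiff
  have hlevi := levi_log_density hp h e1 e2 e3 e4 e5 e6
  have hf : ContDiffAt ℝ ∞ (D.famPot V p) (ψ y) := h.contDiffAt_famPot (z := (p, ψ y)) e3
  refine ⟨e3, ?_, ?_, ?_⟩
  · intro X Y hXY
    rw [hre, hre] at hXY
    exact jac_ne_zero_iff.1 e4 hXY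
  · intro X Y
    rw [hre, hre, kahlerMetric, hlevi]
    rfl
  · have hdet : (leviMatrix (fun y => Real.log (dF y)) y).det.re =
        ‖jac ψ y‖ ^ 2 * (leviMatrix (D.famPot V p) (ψ y)).det.re := by
      rw [det_leviMatrix_congr (ρ' := fun y => D.famPot V p (ψ y)), det_leviMatrix_comp
        (hf.of_le ENat.LEInfty.out) (e1.of_le ENat.LEInfty.out)]
      · rfl
      · intro X Y
        rw [hlevi, levi_comp (hf.of_le ENat.LEInfty.out) (e1.of_le ENat.LEInfty.out)]
    have e4' := norm_pos_iff.2 e4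
    have e7 : dF y = D.famDens V p (ψ y) * ‖jac ψ y‖ ^ 2 := by
      rw [e6.self_of_nhds, famDens, e5.self_of_nhds]
    unfold kahlerVolume famRatio kahlerVolume
    rw [hdet, e7, show ∀ a b c d e : ℝ, a * b * (c * d) / (e * c) = (a * b * d * c) / (e * c) by
      intros; ring, mul_div_mul_right _ _ (by positivity)]

end ModelData

/-- The quotient of the volume forms of the Kähler metric with potential `log d` and of the volume
form with density `d`. -/
def densRatio {n : ℕ} (d : (Fin n → ℂ) → ℝ) (y : Fin n → ℂ) : ℝ :=
  kahlerVolume (fun y => Real.log (d y)) y / d y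

namespace ModelData

variable {ι J : Type} [Fintype ι] [Fintype J] {n : ℕ} {D : ModelData ι J n}
  {C c : ℝ} {p p₀ : ModelParam ι J n} {ψ ψ' : (Fin n → ℂ) → Fin n → ℂ} {v v' : (Fin n → ℂ) → ℂ}
  {u₀ u₀' : Fin n → ℂ} {dF dF' : (Fin n → ℂ) → ℝ}

lemma IsChart.mem_goodSet (hp : D.IsAdmissible C c p) (hch : D.IsChart p ψ v u₀) :
    p ∈ D.goodSet C c := ⟨hp, ψ, v, u₀, hch⟩

theorem IsChart.metric_pos (hc : 0 < c) (hp : D.IsAdmissible C c p) (hch : D.IsChart p ψ v u₀)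
    (hdF : D.IsChartDensity p ψ v u₀ dF) {X : Fin n → ℂ} (hX : X ≠ 0) :
    0 < kahlerMetric (fun y => Real.log (dF y)) u₀ X X := by
  obtain ⟨U, V, h, hU, hV⟩ := exists_isModelFamily hc (subset_closure (hch.mem_goodSet hp))
  obtain ⟨O, -, hu, -, hO⟩ := exists_chart_domain hp.β_pos h hU hch
    (hV.self_of_nhds ψ v u₀ hch) hdF
  obtain ⟨h1, h2, h3, -⟩ := hO u₀ hu
  rw [h3]
  exact h.metric_pos _ h1 _ fun h0 => hX (h2 (by rw [h0, map_zero]))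

theorem IsChart.densRatio_pos (hc : 0 < c) (hp : D.IsAdmissible C c p) (hch : D.IsChart p ψ v u₀)
    (hdF : D.IsChartDensity p ψ v u₀ dF) : 0 < densRatio dF u₀ := by
  obtain ⟨U, V, h, hU, hV⟩ := exists_isModelFamily hc (subset_closure (hch.mem_goodSet hp))
  obtain ⟨O, -, hu, -, hO⟩ := exists_chart_domain hp.β_pos h hU hch
    (hV.self_of_nhds ψ v u₀ hch) hdF
  obtain ⟨h1, -, -, h4⟩ := hO u₀ hu
  rw [densRatio, h4]
  exact h.ratio_pos (z := (p, ψ u₀)) h1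

theorem IsChart.contDiffAt_densRatio (hc : 0 < c) (hp : D.IsAdmissible C c p)
    (hch : D.IsChart p ψ v u₀) (hdF : D.IsChartDensity p ψ v u₀ dF) :
    ContDiffAt ℝ ∞ (densRatio dF) u₀ := by
  obtain ⟨U, V, h, hU, hV⟩ := exists_isModelFamily hc (subset_closure (hch.mem_goodSet hp))
  obtain ⟨O, hOo, hu, hψ, hO⟩ := exists_chart_domain hp.β_pos h hU hch
    (hV.self_of_nhds ψ v u₀ hch) hdF
  have hc : ContDiffOn ℝ ∞ (fun y => D.famRatio V p (ψ y)) O :=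
    ContDiffOn.comp (g := fun z : ModelParam ι J n × (Fin n → ℂ) => D.famRatio V z.1 z.2)
      (f := fun y => (p, ψ y)) h.contDiffOn_ratio (contDiffOn_const.prodMk hψ)
      fun y hy => (hO y hy).1
  exact (hc.congr fun y hy => (hO y hy).2.2.2).contDiffAt (hOo.mem_nhds hu)

theorem IsChart.densRatio_eq (hc : 0 < c) (hp : D.IsAdmissible C c p) (hch : D.IsChart p ψ v u₀)
    (hdF : D.IsChartDensity p ψ v u₀ dF) (hch' : D.IsChart p ψ' v' u₀')
    (hdF' : D.IsChartDensity p ψ' v' u₀' dF') : densRatio dF u₀ = densRatio dF' u₀' := by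
  obtain ⟨U, V, h, hU, hV⟩ := exists_isModelFamily hc (subset_closure (hch.mem_goodSet hp))
  obtain ⟨O, -, hu, -, hO⟩ := exists_chart_domain hp.β_pos h hU hch
    (hV.self_of_nhds ψ v u₀ hch) hdF
  obtain ⟨O', -, hu', -, hO'⟩ := exists_chart_domain hp.β_pos h hU hch'
    (hV.self_of_nhds ψ' v' u₀' hch') hdF'
  rw [densRatio, densRatio, (hO u₀ hu).2.2.2, (hO' u₀' hu').2.2.2, hch.ψ_zero, hch'.ψ_zero]

/-- The bounds for the Ricci potential and its derivatives in all charts of the hypersurfaces with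
parameters in `s`. -/
def IsRicciBound (D : ModelData ι J n) (C c : ℝ) (k : ℕ) (s : Set (ModelParam ι J n)) (K : ℝ) :
    Prop :=
  ∀ p ∈ s, D.IsAdmissible C c p → ∀ ψ v u₀ dF f, D.IsChart p ψ v u₀ →
    D.IsChartDensity p ψ v u₀ dF → (∀ᶠ y in 𝓝 u₀, f y = -Real.log (densRatio dF y)) →
    |f u₀| ≤ K ∧ ∀ e : Fin (2 * n) → Fin n → ℂ,
      IsOrthonormalFrame (kahlerMetric fun y => Real.log (dF y)) u₀ e →
      frameNorm e (iterNabla (kahlerMetric fun y => Real.log (dF y)) f k u₀) ≤ K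

lemma IsRicciBound.mono {s : Set (ModelParam ι J n)} {k : ℕ} {K K' : ℝ}
    (h : D.IsRicciBound C c k s K) (hK : K ≤ K') : D.IsRicciBound C c k s K' :=
  fun p hps hp ψ v u₀ dF f h1 h2 h3 =>
    ⟨(h p hps hp ψ v u₀ dF f h1 h2 h3).1.trans hK, fun e he =>
      ((h p hps hp ψ v u₀ dF f h1 h2 h3).2 e he).trans hK⟩

lemma exists_isRicciBound_nhds (hc : 0 < c) (hp₀ : p₀ ∈ closure (D.goodSet C c)) (k : ℕ) :
    ∃ s ∈ 𝓝 p₀, ∃ K, D.IsRicciBound C c k s K := by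
  obtain ⟨U, V, h, hU, hV⟩ := exists_isModelFamily hc hp₀
  obtain ⟨K, hK⟩ := h.isSmoothMetricOn.exists_frameNorm_le
    (f := fun p u => -Real.log (D.famRatio V p u)) h.contDiffOn_neg_log_ratio k (Fin (2 * n)) hU
  have hin : Filter.Tendsto (fun p : ModelParam ι J n => (p, (0 : Fin n → ℂ))) (𝓝 p₀)
      (𝓝 (p₀, 0)) := Continuous.tendsto' (by fun_prop) _ _ rfl
  have hcont : Filter.Tendsto (fun p => |(-Real.log (D.famRatio V p 0))|) (𝓝 p₀)
      (𝓝 |(-Real.log (D.famRatio V p₀ 0))|) :=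
    ((h.contDiffOn_neg_log_ratio.contDiffAt (h.isOpen.mem_nhds hU)).continuousAt.tendsto.comp
      hin).abs
  have hbd := hcont.eventually (gt_mem_nhds (lt_add_one _))
  refine ⟨_, (hV.and hK).and (hbd.and (hin.eventually (h.isOpen.mem_nhds hU))),
    max K (|(-Real.log (D.famRatio V p₀ 0))| + 1), ?_⟩
  rintro p ⟨⟨h1, h2⟩, h3, h4⟩ hp ψ v u₀ dF f hch hdF hf
  obtain ⟨O, hOo, hu, hψ, hO⟩ := exists_chart_domain hp.β_pos h h4 hch (h1 ψ v u₀ hch) hdF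
  obtain ⟨O', hO', hOo', hu'⟩ := eventually_nhds_iff.1 hf
  have hf' : ∀ y ∈ O ∩ O', f y = -Real.log (D.famRatio V p (ψ y)) := by
    intro y hy
    rw [hO' y hy.2, densRatio, (hO y hy.1).2.2.2]
  constructor
  · rw [hf' u₀ ⟨hu, hu'⟩, hch.ψ_zero]
    exact h3.le.trans (le_max_right _ _)
  · intro e he
    have hpb := h.isSmoothMetricOn.iterNabla_pullback
      (f := fun p u => -Real.log (D.famRatio V p u)) h.contDiffOn_neg_log_ratio (p := p)
      (hOo.inter hOo') (hψ.mono Set.inter_subset_left) (fun y hy => (hO y hy.1).1)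
      (fun y hy => (hO y hy.1).2.1)
      (fun y hy X Y => ((hO y hy.1).2.2.1 X Y).trans
        (kahlerMetric_eq_symmetrize ((h.contDiffAt_famPot (hO y hy.1).1).of_le
          ENat.LEInfty.out) _ _)) hf' k u₀ ⟨hu, hu'⟩
    have he' : IsOrthonormalFrame (kahlerMetric (D.famPot V p)) 0
        (fun a => fderiv ℝ ψ u₀ (e a)) := by
      intro a b
      rw [← he a b, (hO u₀ hu).2.2.1, hch.ψ_zero]
    refine le_trans (le_of_eq ?_) ((h2 _ he').trans (le_max_left _ _))
    unfold frameNorm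
    congr 1
    refine Finset.sum_congr rfl fun I _ => ?_
    rw [hpb, hch.ψ_zero]

/-- The Ricci potentials of the model hypersurfaces are uniformly bounded, with all derivatives. -/
theorem exists_isRicciBound (D : ModelData ι J n) (C : ℝ) (hc : 0 < c) (k : ℕ) :
    ∃ K, D.IsRicciBound C c k Set.univ K := by
  obtain ⟨K, hK⟩ := (isCompact_closure_goodSet D C c).induction_on
    (p := fun s => ∃ K, D.IsRicciBound C c k s K) ⟨0, fun p hp => hp.elim⟩
    (fun s t hst ⟨K, hK⟩ => ⟨K, fun p hp => hK p (hst hp)⟩)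
    (fun s t ⟨K, hK⟩ ⟨K', hK'⟩ => ⟨max K K', fun p hp => hp.elim
      (fun hp => hK.mono (le_max_left _ _) p hp) (fun hp => hK'.mono (le_max_right _ _) p hp)⟩)
    (fun p₀ hp₀ => by
      obtain ⟨s, hs, hK⟩ := exists_isRicciBound_nhds hc hp₀ k
      exact ⟨s, nhdsWithin_le_nhds hs, hK⟩)
  exact ⟨K, fun p _ hp ψ v u₀ dF f hch => hK p (subset_closure (hch.mem_goodSet hp)) hp ψ v u₀ dF
    f hch⟩

end ModelData

section Combinatorics

variable {l : ℕ} {Δ : Finset (Fin l → ℤ)} {w : (Fin l → ℤ) → ℝ} {S S' : Finset (Fin l → ℤ)}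

lemma mem_Ztop : S ∈ Ztop Δ w ↔ IsTopSimplex Δ w S := by
  classical
  unfold Ztop
  rw [Finset.mem_filter, Finset.mem_powerset]
  exact ⟨fun h => h.2, fun h => ⟨h.1, h⟩⟩

lemma affineMap_sum {ι V : Type*} [AddCommGroup V] [Module ℝ V] (f : V →ᵃ[ℝ] ℝ) (s : Finset ι)
    (t : ι → ℝ) (x : ι → V) :
    f.linear (∑ i ∈ s, t i • x i) + (∑ i ∈ s, t i) * f 0 = ∑ i ∈ s, t i * f (x i) := by
  have h : ∀ y, f y = f.linear y + f 0 := fun y => congrFun f.decomp y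
  simp only [h (x _), map_sum, map_smul, smul_eq_mul, mul_add, Finset.sum_add_distrib,
    Finset.sum_mul]

lemma affineMap_sum_of_sum_eq_one {ι V : Type*} [AddCommGroup V] [Module ℝ V] (f : V →ᵃ[ℝ] ℝ)
    {s : Finset ι} {t : ι → ℝ} (ht : ∑ i ∈ s, t i = 1) (x : ι → V) :
    f (∑ i ∈ s, t i • x i) = ∑ i ∈ s, t i * f (x i) := by
  rw [← affineMap_sum, ht, one_mul]
  exact congrFun f.decomp _

lemma exists_bary (hS : IsTopSimplex Δ w S) :
    ∃ b : (Fin l → ℤ) → (Fin l → ℝ) →ᵃ[ℝ] ℝ,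
      (∀ s ∈ S, ∀ s' ∈ S, b s (toReal s') = if s = s' then 1 else 0) ∧
      (∀ x, ∑ s ∈ S, b s x = 1) ∧ (∀ x, ∑ s ∈ S, b s x • toReal s = x) ∧
      (∀ x ∈ convexHull ℝ (toReal '' (S : Set (Fin l → ℤ))), ∀ s ∈ S, 0 ≤ b s x) := by
  classical
  obtain ⟨-, hcard, hind, -⟩ := hS
  let B : AffineBasis S ℝ (Fin l → ℝ) := ⟨fun m : S => toReal (m : Fin l → ℤ), hind, by
    rw [hind.affineSpan_eq_top_iff_card_eq_finrank_add_one]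
    simp [hcard]⟩
  have hB : ∀ s : S, B s = toReal (s : Fin l → ℤ) := fun s => rfl
  refine ⟨fun s => if h : s ∈ S then B.coord ⟨s, h⟩ else 0, ?_, ?_, ?_, ?_⟩
  · intro s hs s' hs'
    simp only [dif_pos hs]
    rw [← hB ⟨s', hs'⟩, B.coord_apply]
    simp
  · intro x
    rw [← Finset.sum_coe_sort S, ← B.sum_coord_apply_eq_one x]
    refine Finset.sum_congr rfl fun s _ => ?_
    simp only [dif_pos s.2]
  · intro x
    conv_rhs => rw [← B.linear_combination_coord_eq_self x]
    rw [← Finset.sum_coe_sort S]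
    refine Finset.sum_congr rfl fun s _ => ?_
    simp only [dif_pos s.2, hB]
  · intro x hx s hs
    have h1 : toReal '' (S : Set (Fin l → ℤ)) = Set.range B := by
      rw [Set.image_eq_range]
      rfl
    rw [h1, B.convexHull_eq_nonneg_coord] at hx
    simp only [dif_pos hs]
    exact hx _

open Classical in
/-- The barycentric coordinates of a simplex of the decomposition. -/
def bary (Δ : Finset (Fin l → ℤ)) (w : (Fin l → ℤ) → ℝ) (S : Finset (Fin l → ℤ)) :
    (Fin l → ℤ) → (Fin l → ℝ) →ᵃ[ℝ] ℝ :=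
  if h : IsTopSimplex Δ w S then (exists_bary h).choose else 0

lemma bary_spec (hS : S ∈ Ztop Δ w) :
      (∀ s ∈ S, ∀ s' ∈ S, bary Δ w S s (toReal s') = if s = s' then 1 else 0) ∧
      (∀ x, ∑ s ∈ S, bary Δ w S s x = 1) ∧ (∀ x, ∑ s ∈ S, bary Δ w S s x • toReal s = x) ∧
      (∀ x ∈ convexHull ℝ (toReal '' (S : Set (Fin l → ℤ))), ∀ s ∈ S, 0 ≤ bary Δ w S s x) := by
  have h := mem_Ztop.1 hS
  unfold bary
  rw [dif_pos h]
  exact (exists_bary h).choose_spec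

lemma affineMap_eq_sum_bary (hS : S ∈ Ztop Δ w) (f : (Fin l → ℝ) →ᵃ[ℝ] ℝ) (x : Fin l → ℝ) :
    f x = ∑ s ∈ S, bary Δ w S s x * f (toReal s) := by
  conv_lhs => rw [← (bary_spec hS).2.2.1 x]
  exact affineMap_sum_of_sum_eq_one f ((bary_spec hS).2.1 x) _

lemma exists_perm_bary_ne_zero (hS : S ∈ Ztop Δ w) (hS' : S' ∈ Ztop Δ w) :
    ∃ e : S' ≃ S, ∀ m : S', bary Δ w S (e m) (toReal m) ≠ 0 := by
  classical
  have hc : Fintype.card S = Fintype.card (Fin (l + 1)) := by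
    simp [(mem_Ztop.1 hS).2.1]
  have hc' : Fintype.card S' = Fintype.card (Fin (l + 1)) := by
    simp [(mem_Ztop.1 hS').2.1]
  let f := Fintype.equivOfCardEq hc
  let f' := Fintype.equivOfCardEq hc'
  let M : Matrix (Fin (l + 1)) (Fin (l + 1)) ℝ :=
    Matrix.of fun i j => bary Δ w S (f.symm j) (toReal (f'.symm i : Fin l → ℤ))
  let M' : Matrix (Fin (l + 1)) (Fin (l + 1)) ℝ :=
    Matrix.of fun i j => bary Δ w S' (f'.symm j) (toReal (f.symm i : Fin l → ℤ))
  have hMM : M * M' = 1 := by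
    ext i j
    have h1 := affineMap_eq_sum_bary hS (bary Δ w S' (f'.symm j))
      (toReal (f'.symm i : Fin l → ℤ))
    rw [(bary_spec hS').1 _ (f'.symm j).2 _ (f'.symm i).2, ← Finset.sum_coe_sort S,
      ← Equiv.sum_comp f.symm] at h1
    rw [Matrix.mul_apply, Matrix.one_apply]
    refine Eq.trans h1.symm ?_
    simp [eq_comm]
  have hdet : M.det ≠ 0 := by
    intro h0
    have := congrArg Matrix.det hMM
    simp [h0] at this
  rw [Matrix.det_apply] at hdet
  obtain ⟨τ, -, hτ⟩ := Finset.exists_ne_zero_of_sum_ne_zero hdet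
  have hprod : ∏ i, M (τ i) i ≠ 0 := fun h0 => hτ (by rw [h0, smul_zero])
  rw [Finset.prod_ne_zero_iff] at hprod
  refine ⟨(f'.trans τ.symm).trans f.symm, fun m => ?_⟩
  have := hprod (τ.symm (f' m)) (Finset.mem_univ _)
  simpa [M] using this

lemma exists_abs_le {I : Type*} [Finite I] (f : I → ℝ) : ∃ C, 1 ≤ C ∧ ∀ i, |f i| ≤ C := by
  cases nonempty_fintype I
  have h0 : 0 ≤ ∑ i, |f i| := Finset.sum_nonneg fun i _ => abs_nonneg _
  refine ⟨1 + ∑ i, |f i|, by linarith, fun i => ?_⟩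
  have h1 := Finset.single_le_sum (f := fun i => |f i|) (fun i _ => abs_nonneg _)
    (Finset.mem_univ i)
  linarith

lemma exists_pos_le_abs {I : Type*} [Finite I] (f : I → ℝ) :
    ∃ c > 0, ∀ i, f i ≠ 0 → c ≤ |f i| := by
  obtain ⟨C, hC, h⟩ := exists_abs_le fun i => (f i)⁻¹
  refine ⟨C⁻¹, by positivity, fun i hi => ?_⟩
  have := h i
  rw [abs_inv] at this
  exact inv_le_of_inv_le₀ (abs_pos.2 hi) this

lemma abs_sum_geom_le {C ε : ℝ} (hε : 0 ≤ ε) (hε2 : ε ≤ 1 / 2) (k : ℕ) :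
    ∀ (a : ℕ → ℝ), (∀ i, |a i| ≤ C) → |∑ i ∈ Finset.range k, ε ^ i * a i| ≤ 2 * C := by
  induction k with
  | zero =>
    intro a ha
    simpa using (abs_nonneg _).trans (ha 0)
  | succ k ih =>
    intro a ha
    have h1 := ih (fun i => a (i + 1)) fun i => ha _
    have h0 := ha 0
    rw [Finset.sum_range_succ']
    have h2 : ∑ i ∈ Finset.range k, ε ^ (i + 1) * a (i + 1) =
        ε * ∑ i ∈ Finset.range k, ε ^ i * a (i + 1) := by
      rw [Finset.mul_sum]
      exact Finset.sum_congr rfl fun i _ => by ring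
    rw [h2, pow_zero, one_mul]
    refine (abs_add_le _ _).trans ?_
    rw [abs_mul, abs_of_nonneg hε]
    nlinarith [abs_nonneg (∑ i ∈ Finset.range k, ε ^ i * a (i + 1)), abs_nonneg (a 0)]

/-- If `∑ ε^i a_i` is nonnegative for a small `ε`, then the first nonzero coefficient is positive
and so the truncated sums are nonnegative. -/
lemma truncated_sum_nonneg {C c ε : ℝ} (hc : 0 < c) (hε : 0 < ε) (hε2 : ε ≤ 1 / 2)
    (hεC : ε * (2 * C) ≤ c / 2) (N : ℕ) :
    ∀ (a : ℕ → ℝ), (∀ i, |a i| ≤ C) → (∀ i, a i ≠ 0 → c ≤ |a i|) →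
      0 ≤ ∑ i ∈ Finset.range N, ε ^ i * a i → ∀ k ≤ N,
      0 ≤ ∑ i ∈ Finset.range k, ε ^ i * a i ∧ ∀ i < k, a i ≠ 0 →
        ε ^ N * (c / 2) ≤ ∑ i ∈ Finset.range k, ε ^ i * a i := by
  induction N with
  | zero =>
    intro a _ _ _ k hk
    obtain rfl : k = 0 := by omega
    simp
  | succ N ih =>
    intro a hC hca hsum k hk
    obtain _ | k := k
    · simp
    have hsplit : ∀ k, ∑ i ∈ Finset.range (k + 1), ε ^ i * a i =
        ε * ∑ i ∈ Finset.range k, ε ^ i * a (i + 1) + a 0 := by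
      intro k
      rw [Finset.sum_range_succ', Finset.mul_sum, pow_zero, one_mul]
      congr 1
      exact Finset.sum_congr rfl fun i _ => by ring
    rw [hsplit] at hsum ⊢
    have htail : ∀ k, |ε * ∑ i ∈ Finset.range k, ε ^ i * a (i + 1)| ≤ c / 2 := by
      intro k
      rw [abs_mul, abs_of_pos hε]
      exact (mul_le_mul_of_nonneg_left
        (abs_sum_geom_le hε.le hε2 k (fun i => a (i + 1)) fun i => hC _) hε.le).trans hεC
    by_cases h0 : a 0 = 0
    · rw [h0, add_zero] at hsum ⊢
      have h1 := ih (fun i => a (i + 1)) (fun i => hC _) (fun i => hca _)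
        (nonneg_of_mul_nonneg_right hsum hε) k (by omega)
      refine ⟨mul_nonneg hε.le h1.1, fun i hi hai => ?_⟩
      obtain _ | i := i
      · exact absurd h0 hai
      have h2 := mul_le_mul_of_nonneg_left (h1.2 i (by omega) hai) hε.le
      rwa [pow_succ', mul_assoc]
    · have h1 := hca 0 h0
      have h2 : c ≤ a 0 := by
        have h3 := (abs_le.1 (htail N)).2
        rcases abs_cases (a 0) with h | h <;> linarith
      have h3 := (abs_le.1 (htail k)).1
      have h4 : ε ^ (N + 1) ≤ 1 := pow_le_one₀ hε.le (by linarith)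
      exact ⟨by linarith, fun i _ _ => by nlinarith⟩

lemma exists_affineMap_eq (c : Fin l → ℝ) (b : ℝ) :
    ∃ g : (Fin l → ℝ) →ᵃ[ℝ] ℝ, ∀ x, g x = ∑ i, c i * x i + b := by
  let f : (Fin l → ℝ) →ᵃ[ℝ] ℝ :=
    (∑ i, c i • (LinearMap.proj i : (Fin l → ℝ) →ₗ[ℝ] ℝ)).toAffineMap + AffineMap.const ℝ _ b
  exact ⟨f, fun x => by simp [f]⟩

lemma sum_bary_mul (hS : S ∈ Ztop Δ w) {m : Fin l → ℤ} (hm : m ∈ Δ) :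
    (m ∈ S → ∑ s ∈ S, bary Δ w S s (toReal m) * w s = w m) ∧
      (m ∉ S → ∑ s ∈ S, bary Δ w S s (toReal m) * w s < w m) := by
  obtain ⟨-, -, -, c, b, h1, h2⟩ := mem_Ztop.1 hS
  obtain ⟨f, hf'⟩ := exists_affineMap_eq c b
  have hf : ∀ m : Fin l → ℤ, f (toReal m) = ∑ i, c i * (m i : ℝ) + b := fun m => hf' _
  have h3 : ∑ s ∈ S, bary Δ w S s (toReal m) * w s = f (toReal m) := by
    rw [affineMap_eq_sum_bary hS f]
    exact Finset.sum_congr rfl fun s hs => by rw [hf, h1 s hs]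
  rw [h3, hf]
  exact ⟨fun h => (h1 m h).symm, fun h => h2 m hm h⟩

/-- A function `T w + g` on `Δ`, with `g` affine, that is nonnegative is controlled by its values
at the vertices of some simplex of the decomposition. -/
theorem exists_controlling_simplex (hw : IsSimplicialData Δ w) :
    ∃ C : ℝ, 1 ≤ C ∧ ∀ T : ℝ, 0 < T → ∀ (g : (Fin l → ℝ) →ᵃ[ℝ] ℝ) (D : (Fin l → ℤ) → ℝ),
      (∀ m ∈ Δ, D m = T * w m + g (toReal m)) → (∀ m ∈ Δ, 0 ≤ D m) →
      ∃ S ∈ Ztop Δ w, (∀ m ∈ Δ, m ∉ S → T ≤ C * D m) ∧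
        ∀ s ∈ S, ∀ m ∈ Δ, bary Δ w S s (toReal m) ≠ 0 → D s ≤ C * D m := by
  obtain ⟨m', hm'⟩ := hw.nonempty
  let coef : Ztop Δ w × Δ × Δ → ℝ := fun x => bary Δ w x.1 x.2.1 (toReal (x.2.2 : Fin l → ℤ))
  let exc : Ztop Δ w × Δ → ℝ := fun x =>
    w x.2 - ∑ s ∈ x.1.1, bary Δ w x.1 s (toReal (x.2 : Fin l → ℤ)) * w s
  obtain ⟨A, hA1, hA⟩ := exists_abs_le coef
  obtain ⟨c, hc, hca⟩ := exists_pos_le_abs coef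
  obtain ⟨d, hd, hde⟩ := exists_pos_le_abs exc
  set ε := min (1 / 2) (c / (4 * A)) with hεdef
  have hε : 0 < ε := by positivity
  have hε2 : ε ≤ 1 / 2 := min_le_left _ _
  have hεA : ε * (2 * A) ≤ c / 2 := by
    calc ε * (2 * A) ≤ c / (4 * A) * (2 * A) := by gcongr; exact min_le_right _ _
      _ = c / 2 := by field_simp; ring
  set N := Δ.card with hN
  have hNpos : 0 < N := Finset.card_pos.2 ⟨m', hm'⟩
  set C := max 1 (N / (ε ^ N * min d (c / 2))) with hC
  have hmin : 0 < ε ^ N * min d (c / 2) := by positivity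
  have hCN : (N : ℝ) ≤ C * (ε ^ N * min d (c / 2)) := by
    rw [← div_le_iff₀ hmin]
    exact le_max_right _ _
  refine ⟨C, le_max_left _ _, fun T hT g D hD hD0 => ?_⟩
  -- enumerate `Δ` by increasing values
  let e : Fin N ≃ Δ := Δ.equivFin.symm
  let τ := Tuple.sort fun i => D (e i)
  have hmono : Monotone ((fun i => D (e i)) ∘ τ) := Tuple.monotone_sort _
  let f : ℕ → (Fin l → ℤ) := fun i => if h : i < N then e (τ ⟨i, h⟩) else m'
  have hfΔ : ∀ i, f i ∈ Δ := by
    intro i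
    simp only [f]
    split_ifs
    · exact (e _).2
    · exact hm'
  have hfsurj : ∀ m ∈ Δ, ∃ k < N, f k = m := by
    intro m hm
    refine ⟨τ.symm (e.symm ⟨m, hm⟩), Fin.is_lt _, ?_⟩
    simp [f]
  have hfmono : ∀ i k, i ≤ k → k < N → D (f i) ≤ D (f k) := by
    intro i k hik hk
    simp only [f, dif_pos hk, dif_pos (hik.trans_lt hk)]
    exact hmono (a := ⟨i, _⟩) (b := ⟨k, _⟩) hik
  set σ := ∑ i ∈ Finset.range N, ε ^ i with hσ
  have hσpos : 0 < σ := Finset.sum_pos (fun i _ => by positivity) ⟨0, by simpa using hNpos⟩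
  have hsum1 : ∑ i ∈ Finset.range N, ε ^ i / σ = 1 := by
    rw [← Finset.sum_div, div_self hσpos.ne']
  obtain ⟨S, hS, hpS⟩ := hw.cover (∑ i ∈ Finset.range N, (ε ^ i / σ) • toReal (f i))
    ((convex_convexHull ℝ _).sum_mem (fun i _ => by positivity) hsum1
      fun i _ => subset_convexHull ℝ _ ⟨f i, hfΔ i, rfl⟩)
  have hSΔ := (mem_Ztop.1 hS).1
  have htr : ∀ s ∈ S, ∀ k ≤ N, 0 ≤ ∑ i ∈ Finset.range k, ε ^ i * bary Δ w S s (toReal (f i)) ∧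
      ∀ i < k, bary Δ w S s (toReal (f i)) ≠ 0 →
        ε ^ N * (c / 2) ≤ ∑ i ∈ Finset.range k, ε ^ i * bary Δ w S s (toReal (f i)) := by
    intro s hs
    refine truncated_sum_nonneg hc hε hε2 hεA N (fun i => bary Δ w S s (toReal (f i)))
      (fun i => hA (⟨S, hS⟩, ⟨s, hSΔ hs⟩, ⟨f i, hfΔ i⟩))
      (fun i => hca (⟨S, hS⟩, ⟨s, hSΔ hs⟩, ⟨f i, hfΔ i⟩)) ?_
    have h1 := (bary_spec hS).2.2.2 _ hpS s hs
    rw [affineMap_sum_of_sum_eq_one _ hsum1] at h1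
    have h2 : ∑ i ∈ Finset.range N, ε ^ i / σ * bary Δ w S s (toReal (f i)) =
        (∑ i ∈ Finset.range N, ε ^ i * bary Δ w S s (toReal (f i))) / σ := by
      rw [Finset.sum_div]
      exact Finset.sum_congr rfl fun i _ => by ring
    rw [h2] at h1
    rwa [le_div_iff₀ hσpos, zero_mul] at h1
  have hexc : ∀ m ∈ Δ, 0 ≤ w m - ∑ s ∈ S, bary Δ w S s (toReal m) * w s := by
    intro m hm
    by_cases h : m ∈ S
    · rw [(sum_bary_mul hS hm).1 h, sub_self]
    · exact (sub_pos.2 ((sum_bary_mul hS hm).2 h)).le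
  have hdec : ∀ m ∈ Δ, D m = T * (w m - ∑ s ∈ S, bary Δ w S s (toReal m) * w s) +
      ∑ s ∈ S, bary Δ w S s (toReal m) * D s := by
    intro m hm
    have h1 : ∑ s ∈ S, bary Δ w S s (toReal m) * D s =
        T * (∑ s ∈ S, bary Δ w S s (toReal m) * w s) + g (toReal m) := by
      rw [affineMap_eq_sum_bary hS g, Finset.mul_sum, ← Finset.sum_add_distrib]
      refine Finset.sum_congr rfl fun s hs => ?_
      rw [hD s (hSΔ hs)]
      ring
    rw [h1, hD m hm]
    ring
  have hkey : ∀ k < N,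
      T * ∑ i ∈ Finset.range (k + 1), ε ^ i *
        (w (f i) - ∑ s ∈ S, bary Δ w S s (toReal (f i)) * w s) +
      ∑ s ∈ S, (∑ i ∈ Finset.range (k + 1), ε ^ i * bary Δ w S s (toReal (f i))) * D s ≤
        N * D (f k) := by
    intro k hk
    calc _ = ∑ i ∈ Finset.range (k + 1), ε ^ i * D (f i) := by
          simp only [Finset.sum_mul]
          rw [Finset.sum_comm, Finset.mul_sum, ← Finset.sum_add_distrib]
          refine Finset.sum_congr rfl fun i _ => ?_
          rw [hdec (f i) (hfΔ i), mul_add, Finset.mul_sum]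
          congr 1
          · ring
          · exact Finset.sum_congr rfl fun s _ => by ring
      _ ≤ ∑ i ∈ Finset.range (k + 1), D (f k) := by
          refine Finset.sum_le_sum fun i hi => ?_
          have h1 : i ≤ k := by simpa [Nat.lt_succ_iff] using hi
          have h2 : ε ^ i ≤ 1 := pow_le_one₀ hε.le (by linarith)
          nlinarith [hfmono i k h1 hk, hD0 _ (hfΔ i)]
      _ = ((k + 1 : ℕ) : ℝ) * D (f k) := by rw [Finset.sum_const, Finset.card_range, nsmul_eq_mul]
      _ ≤ N * D (f k) := by
          gcongr
          · exact hD0 _ (hfΔ k)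
          · omega
  refine ⟨S, hS, ?_, ?_⟩
  · intro m hm hmS
    obtain ⟨k, hk, rfl⟩ := hfsurj m hm
    have h1 := hkey k hk
    have h2 : 0 ≤ ∑ s ∈ S, (∑ i ∈ Finset.range (k + 1), ε ^ i * bary Δ w S s (toReal (f i))) *
        D s := Finset.sum_nonneg fun s hs =>
      mul_nonneg (htr s hs (k + 1) (by omega)).1 (hD0 s (hSΔ hs))
    have h3 : ε ^ N * d ≤ ∑ i ∈ Finset.range (k + 1), ε ^ i *
        (w (f i) - ∑ s ∈ S, bary Δ w S s (toReal (f i)) * w s) := by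
      refine le_trans ?_ (Finset.single_le_sum (f := fun i => ε ^ i *
        (w (f i) - ∑ s ∈ S, bary Δ w S s (toReal (f i)) * w s))
        (fun i _ => mul_nonneg (by positivity) (hexc _ (hfΔ i))) (Finset.self_mem_range_succ k))
      have h4 := hde (⟨S, hS⟩, ⟨f k, hm⟩) (sub_pos.2 ((sum_bary_mul hS hm).2 hmS)).ne'
      rw [abs_of_nonneg (hexc _ hm)] at h4
      exact mul_le_mul (pow_le_pow_of_le_one hε.le (by linarith) hk.le) h4 hd.le (by positivity)
    have h5 : T * (ε ^ N * min d (c / 2)) ≤ C * (ε ^ N * min d (c / 2)) * D (f k) := by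
      calc T * (ε ^ N * min d (c / 2)) ≤ T * (ε ^ N * d) := by gcongr; exact min_le_left _ _
        _ ≤ N * D (f k) := by nlinarith
        _ ≤ _ := mul_le_mul_of_nonneg_right hCN (hD0 _ hm)
    have h6 : T * (ε ^ N * min d (c / 2)) ≤ C * D (f k) * (ε ^ N * min d (c / 2)) := by linarith
    exact le_of_mul_le_mul_right h6 hmin
  · intro s hs m hm hb
    obtain ⟨k, hk, rfl⟩ := hfsurj m hm
    have h1 := hkey k hk
    have h2 : 0 ≤ T * ∑ i ∈ Finset.range (k + 1), ε ^ i *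
        (w (f i) - ∑ s ∈ S, bary Δ w S s (toReal (f i)) * w s) :=
      mul_nonneg hT.le (Finset.sum_nonneg fun i _ => mul_nonneg (by positivity) (hexc _ (hfΔ i)))
    have h3 : ε ^ N * (c / 2) * D s ≤ ∑ s ∈ S,
        (∑ i ∈ Finset.range (k + 1), ε ^ i * bary Δ w S s (toReal (f i))) * D s := by
      refine le_trans ?_ (Finset.single_le_sum (f := fun s =>
        (∑ i ∈ Finset.range (k + 1), ε ^ i * bary Δ w S s (toReal (f i))) * D s) (fun s hs =>
        mul_nonneg (htr s hs (k + 1) (by omega)).1 (hD0 s (hSΔ hs))) hs)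
      exact mul_le_mul_of_nonneg_right ((htr s hs (k + 1) (by omega)).2 k (by omega) hb)
        (hD0 s (hSΔ hs))
    have h5 : D s * (ε ^ N * min d (c / 2)) ≤ C * (ε ^ N * min d (c / 2)) * D (f k) := by
      calc D s * (ε ^ N * min d (c / 2)) ≤ D s * (ε ^ N * (c / 2)) := by
            gcongr
            · exact hD0 s (hSΔ hs)
            · exact min_le_right _ _
        _ ≤ N * D (f k) := by linarith
        _ ≤ _ := mul_le_mul_of_nonneg_right hCN (hD0 _ hm)
    have h6 : D s * (ε ^ N * min d (c / 2)) ≤ C * D (f k) * (ε ^ N * min d (c / 2)) := by linarith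
    exact le_of_mul_le_mul_right h6 hmin

/-- The product over the controlling simplex is minimal up to a constant. -/
lemma prod_le_of_bary_control (hS : S ∈ Ztop Δ w) (hS' : S' ∈ Ztop Δ w) {C : ℝ}
    {α : (Fin l → ℤ) → ℝ} (hα : ∀ m ∈ Δ, 0 ≤ α m)
    (h : ∀ s ∈ S, ∀ m ∈ Δ, bary Δ w S s (toReal m) ≠ 0 → α s ≤ C * α m) :
    ∏ m ∈ S, α m ≤ C ^ (l + 1) * ∏ m ∈ S', α m := by
  obtain ⟨e, he⟩ := exists_perm_bary_ne_zero hS hS'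
  have hSΔ := (mem_Ztop.1 hS).1
  have hSΔ' := (mem_Ztop.1 hS').1
  calc ∏ m ∈ S, α m = ∏ m : S', α (e m) := by
        rw [← Finset.prod_coe_sort S, ← Equiv.prod_comp e]
    _ ≤ ∏ m : S', C * α m := Finset.prod_le_prod (fun m _ => hα _ (hSΔ (e m).2))
        fun m _ => h _ (e m).2 _ (hSΔ' m.2) (he m)
    _ = C ^ (l + 1) * ∏ m ∈ S', α m := by
        rw [Finset.prod_mul_distrib, Finset.prod_coe_sort S' α]
        simp [(mem_Ztop.1 hS').2.1]

end Combinatorics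

section Monomials

variable {l : ℕ} {Δ : Finset (Fin l → ℤ)} {w : (Fin l → ℤ) → ℝ} {ζ : ℂ} {x : Fin l → ℂ}

/-- The pairing of an exponent with a vector. -/
def pairing (m : Fin l → ℤ) (a : Fin l → ℂ) : ℂ := ∑ i, (m i : ℂ) * a i

/-- The monomial `t^{w_m} s_m`. -/
def monoTerm (w : (Fin l → ℤ) → ℝ) (ζ : ℂ) (m : Fin l → ℤ) (x : Fin l → ℂ) : ℂ :=
  tpow ζ (w m) * mono m x

lemma mono_ne_zero (hx : ∀ i, x i ≠ 0) (m : Fin l → ℤ) : mono m x ≠ 0 :=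
  Finset.prod_ne_zero_iff.2 fun i _ => zpow_ne_zero _ (hx i)

lemma monoTerm_ne_zero (hx : ∀ i, x i ≠ 0) (m : Fin l → ℤ) : monoTerm w ζ m x ≠ 0 :=
  mul_ne_zero (Complex.exp_ne_zero _) (mono_ne_zero hx m)

lemma mono_mul_exp (m : Fin l → ℤ) (x a : Fin l → ℂ) :
    mono m (fun i => x i * Complex.exp (a i)) = mono m x * Complex.exp (pairing m a) := by
  unfold mono pairing
  rw [Complex.exp_sum, ← Finset.prod_mul_distrib]
  refine Finset.prod_congr rfl fun i _ => ?_
  rw [mul_zpow, ← Complex.exp_int_mul]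

lemma monoTerm_mul_exp (m : Fin l → ℤ) (x a : Fin l → ℂ) :
    monoTerm w ζ m (fun i => x i * Complex.exp (a i)) =
      monoTerm w ζ m x * Complex.exp (pairing m a) := by
  rw [monoTerm, monoTerm, mono_mul_exp, mul_assoc]

lemma differentiableAt_mono (hx : ∀ i, x i ≠ 0) (m : Fin l → ℤ) :
    DifferentiableAt ℂ (mono m) x := by
  unfold mono
  exact (HasFDerivAt.finsetProd (g := fun i (x : Fin l → ℂ) => x i ^ m i) fun i _ =>
    (DifferentiableAt.zpow (differentiableAt_apply i x)
      (Or.inl (hx i))).hasFDerivAt).differentiableAt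

lemma differentiableAt_poly (hx : ∀ i, x i ≠ 0) : DifferentiableAt ℂ (poly Δ w ζ) x := by
  unfold poly
  exact DifferentiableAt.fun_sum fun m _ => (differentiableAt_mono hx m).const_mul _

lemma pairing_smul (m : Fin l → ℤ) (τ : ℂ) (a : Fin l → ℂ) :
    pairing m (fun i => τ * a i) = τ * pairing m a := by
  unfold pairing
  rw [Finset.mul_sum]
  exact Finset.sum_congr rfl fun i _ => by ring

/-- The logarithmic derivative of the defining polynomial. -/
lemma fderiv_poly_mul (hx : ∀ i, x i ≠ 0) (a : Fin l → ℂ) :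
    fderiv ℂ (poly Δ w ζ) x (fun i => x i * a i) =
      ∑ m ∈ Δ, monoTerm w ζ m x * pairing m a := by
  set γ : ℂ → Fin l → ℂ := fun τ i => x i * Complex.exp (τ * a i) with hγ
  have hγ0 : γ 0 = x := by
    ext i
    simp [hγ]
  have h1 : HasDerivAt γ (fun i => x i * a i) 0 := by
    rw [hasDerivAt_pi]
    intro i
    have := (((hasDerivAt_id (0 : ℂ)).mul_const (a i)).cexp).const_mul (x i)
    simpa using this
  have h2 : HasFDerivAt (poly Δ w ζ) (fderiv ℂ (poly Δ w ζ) x) (γ 0) := by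
    rw [hγ0]
    exact (differentiableAt_poly hx).hasFDerivAt
  have h3 := h2.comp_hasDerivAt (0 : ℂ) h1
  have h4 : HasDerivAt (fun τ => ∑ m ∈ Δ, monoTerm w ζ m x * Complex.exp (τ * pairing m a))
      (∑ m ∈ Δ, monoTerm w ζ m x * pairing m a) 0 := by
    refine HasDerivAt.fun_sum fun m _ => ?_
    have := (((hasDerivAt_id (0 : ℂ)).mul_const (pairing m a)).cexp).const_mul
      (monoTerm w ζ m x)
    simpa using this
  refine h3.unique (h4.congr_of_eventuallyEq (Filter.Eventually.of_forall fun τ => ?_))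
  refine Finset.sum_congr rfl fun m _ => ?_
  rw [← pairing_smul, ← monoTerm_mul_exp]
  rfl

lemma fderiv_poly_div_mono (hx : x ∈ hypersurface Δ w ζ) (m : Fin l → ℤ) :
    fderiv ℂ (fun y => poly Δ w ζ y / mono m y) x =
      (mono m x)⁻¹ • fderiv ℂ (poly Δ w ζ) x := by
  have h1 := (differentiableAt_poly (Δ := Δ) (w := w) (ζ := ζ) hx.1).hasFDerivAt
  have h2 := ((differentiableAt_mono hx.1 m).inv (mono_ne_zero hx.1 m)).hasFDerivAt
  have h3 := h1.mul h2
  refine Eq.trans h3.fderiv ?_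
  ext v
  simp [hx.2]

lemma norm_monoTerm_sq (hx : ∀ i, x i ≠ 0) (m : Fin l → ℤ) :
    ‖monoTerm w ζ m x‖ ^ 2 =
      Real.exp (2 * ζ.re * w m + ∑ i, (m i : ℝ) * (2 * Real.log ‖x i‖)) := by
  have h1 : ‖mono m x‖ = Real.exp (∑ i, (m i : ℝ) * Real.log ‖x i‖) := by
    rw [mono, norm_prod, Real.exp_sum]
    refine Finset.prod_congr rfl fun i _ => ?_
    rw [norm_zpow, ← Real.log_zpow, Real.exp_log (zpow_pos (norm_pos_iff.2 (hx i)) _)]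
  have h2 : ‖tpow ζ (w m)‖ = Real.exp (w m * ζ.re) := by
    rw [tpow, Complex.norm_exp, Complex.re_ofReal_mul]
  rw [monoTerm, norm_mul, h1, h2, ← Real.exp_add, sq, ← Real.exp_add]
  congr 1
  rw [show ∑ i, (m i : ℝ) * (2 * Real.log ‖x i‖) = 2 * ∑ i, (m i : ℝ) * Real.log ‖x i‖ by
    rw [Finset.mul_sum]; exact Finset.sum_congr rfl fun i _ => by ring]
  ring

/-- The sum of the squared norms of the monomials. -/
def monoNormSum (Δ : Finset (Fin l → ℤ)) (w : (Fin l → ℤ) → ℝ) (ζ : ℂ) (x : Fin l → ℂ) : ℝ :=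
  ∑ m ∈ Δ, ‖monoTerm w ζ m x‖ ^ 2

lemma eta_eq (m : Fin l → ℤ) :
    eta Δ w ζ m x = ‖monoTerm w ζ m x‖ ^ 2 / monoNormSum Δ w ζ x := rfl

lemma monoNormSum_pos (hΔ : Δ.Nonempty) (hx : ∀ i, x i ≠ 0) : 0 < monoNormSum Δ w ζ x := by
  refine Finset.sum_pos (fun m _ => ?_) hΔ
  have := norm_pos_iff.2 (monoTerm_ne_zero (w := w) (ζ := ζ) hx m)
  positivity

lemma eta_pos (hΔ : Δ.Nonempty) (hx : ∀ i, x i ≠ 0) (m : Fin l → ℤ) : 0 < eta Δ w ζ m x := by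
  have := norm_pos_iff.2 (monoTerm_ne_zero (w := w) (ζ := ζ) hx m)
  rw [eta_eq]
  exact div_pos (by positivity) (monoNormSum_pos hΔ hx)

lemma sum_eta (hΔ : Δ.Nonempty) (hx : ∀ i, x i ≠ 0) : ∑ m ∈ Δ, eta Δ w ζ m x = 1 := by
  simp only [eta_eq]
  rw [← Finset.sum_div]
  exact div_self (monoNormSum_pos hΔ hx).ne'

lemma eta_le_one (hΔ : Δ.Nonempty) (hx : ∀ i, x i ≠ 0) {m : Fin l → ℤ} (hm : m ∈ Δ) :
    eta Δ w ζ m x ≤ 1 := by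
  rw [← sum_eta hΔ hx (w := w) (ζ := ζ)]
  exact Finset.single_le_sum (fun m _ => (eta_pos hΔ hx m).le) hm

lemma le_aFun (hΔ : Δ.Nonempty) (hx : ∀ i, x i ≠ 0) {m : Fin l → ℤ} (hm : m ∈ Δ) (κ : ℝ) :
    κ ≤ aFun Δ w κ ζ m x := by
  have := Real.log_nonpos (eta_pos hΔ hx m).le (eta_le_one (w := w) (ζ := ζ) hΔ hx hm)
  unfold aFun
  linarith

/-- The functions `-log η_m` are a multiple of `w` up to an affine function. -/
lemma exists_affineMap_neg_log_eta (hΔ : Δ.Nonempty) (hx : ∀ i, x i ≠ 0) :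
    ∃ g : (Fin l → ℝ) →ᵃ[ℝ] ℝ, ∀ m : Fin l → ℤ,
      -Real.log (eta Δ w ζ m x) = (-2 * ζ.re) * w m + g (toReal m) := by
  obtain ⟨g, hg⟩ := exists_affineMap_eq (fun i => -(2 * Real.log ‖x i‖))
    (Real.log (monoNormSum Δ w ζ x))
  refine ⟨g, fun m => ?_⟩
  rw [eta_eq, norm_monoTerm_sq hx, Real.log_div (Real.exp_pos _).ne'
    (monoNormSum_pos hΔ hx).ne', Real.log_exp, hg]
  have h : ∑ i, (-(2 * Real.log ‖x i‖)) * toReal m i =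
      -∑ i, (m i : ℝ) * (2 * Real.log ‖x i‖) := by
    rw [← Finset.sum_neg_distrib]
    exact Finset.sum_congr rfl fun i _ => by rw [toReal]; ring
  rw [h]
  ring

/-- There are two monomials of comparable maximal size at each point of the hypersurface. -/
lemma exists_two_large_monomials (hΔ : Δ.Nonempty) (hx : x ∈ hypersurface Δ w ζ) :
    ∃ m₀ ∈ Δ, ∃ m₁ ∈ Δ, m₀ ≠ m₁ ∧ -Real.log (eta Δ w ζ m₀ x) ≤ 3 * Real.log Δ.card ∧
      -Real.log (eta Δ w ζ m₁ x) ≤ 3 * Real.log Δ.card := by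
  classical
  have hcard : (0 : ℝ) < Δ.card := by exact_mod_cast hΔ.card_pos
  have hcard1 : (1 : ℝ) ≤ Δ.card := by exact_mod_cast hΔ.card_pos
  have hlog := Real.log_nonneg hcard1
  obtain ⟨m₀, hm₀, hmax⟩ := Δ.exists_max_image (fun m => ‖monoTerm w ζ m x‖) hΔ
  have hη₀ : 1 / Δ.card ≤ eta Δ w ζ m₀ x := by
    rw [div_le_iff₀ hcard, mul_comm, ← sum_eta hΔ hx.1 (w := w) (ζ := ζ), ← nsmul_eq_mul]
    refine Finset.sum_le_card_nsmul _ _ _ fun m hm => ?_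
    rw [eta_eq, eta_eq]
    have h1 := monoNormSum_pos (w := w) (ζ := ζ) hΔ hx.1
    have h2 := hmax m hm
    gcongr
  have hz : monoTerm w ζ m₀ x = -∑ m ∈ Δ.erase m₀, monoTerm w ζ m x := by
    rw [eq_neg_iff_add_eq_zero, Finset.add_sum_erase _ (fun m => monoTerm w ζ m x) hm₀]
    exact hx.2
  have hz0 := norm_pos_iff.2 (monoTerm_ne_zero (w := w) (ζ := ζ) hx.1 m₀)
  have hne : (Δ.erase m₀).Nonempty := by
    by_contra h
    rw [Finset.not_nonempty_iff_eq_empty] at h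
    rw [hz, h] at hz0
    simp at hz0
  obtain ⟨m₁, hm₁, hmax₁⟩ := (Δ.erase m₀).exists_max_image (fun m => ‖monoTerm w ζ m x‖) hne
  have h3 : ‖monoTerm w ζ m₀ x‖ ≤ Δ.card * ‖monoTerm w ζ m₁ x‖ := by
    calc ‖monoTerm w ζ m₀ x‖ ≤ ∑ m ∈ Δ.erase m₀, ‖monoTerm w ζ m x‖ := by
          rw [hz, norm_neg]
          exact norm_sum_le _ _
      _ ≤ (Δ.erase m₀).card • ‖monoTerm w ζ m₁ x‖ := Finset.sum_le_card_nsmul _ _ _ hmax₁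
      _ ≤ Δ.card * ‖monoTerm w ζ m₁ x‖ := by
          rw [nsmul_eq_mul]
          gcongr
          exact Finset.erase_subset _ _
  have hη₁ : 1 / Δ.card ^ 3 ≤ eta Δ w ζ m₁ x := by
    have h4 : eta Δ w ζ m₀ x ≤ Δ.card ^ 2 * eta Δ w ζ m₁ x := by
      have h1 := monoNormSum_pos (w := w) (ζ := ζ) hΔ hx.1
      rw [eta_eq, eta_eq, ← mul_div_assoc, ← mul_pow]
      gcongr
    rw [div_le_iff₀ (by positivity)]
    rw [div_le_iff₀ hcard] at hη₀
    nlinarith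
  have h5 := Real.log_le_log (by positivity) hη₀
  have h6 := Real.log_le_log (by positivity) hη₁
  rw [one_div, Real.log_inv] at h5 h6
  rw [Real.log_pow] at h6
  push_cast at h6
  exact ⟨m₀, hm₀, m₁, Finset.mem_of_mem_erase hm₁, (Finset.ne_of_mem_erase hm₁).symm,
    by linarith, by linarith⟩

end Monomials

section Model

variable {n : ℕ} {Δ : Finset (Fin (n + 1) → ℤ)} {w : (Fin (n + 1) → ℤ) → ℝ}

/-- A simplex of the decomposition together with an ordering of its vertices. -/
abbrev Config (Δ : Finset (Fin (n + 1) → ℤ)) (w : (Fin (n + 1) → ℤ) → ℝ) : Type :=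
  (S : Ztop Δ w) × (Fin (n + 2) ≃ (S : Finset (Fin (n + 1) → ℤ)))

namespace Config

variable (c : Config Δ w)

/-- The vertices. -/
def vertex (k : Fin (n + 2)) : Δ := ⟨c.2 k, (mem_Ztop.1 c.1.2).1 (c.2 k).2⟩

/-- The barycentric coordinates. -/
def coord (k : Fin (n + 2)) (m : Fin (n + 1) → ℤ) : ℝ := bary Δ w c.1 (c.2 k) (toReal m)

/-- The edges of the simplex that contain the first vertex. -/
def edgeMatrix : Matrix (Fin (n + 1)) (Fin (n + 1)) ℝ :=
  Matrix.of fun k i => ((c.vertex k.succ).1 i : ℝ) - ((c.vertex 0).1 i : ℝ)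

lemma coord_vertex (k k' : Fin (n + 2)) :
    c.coord k (c.vertex k') = if k = k' then 1 else 0 := by
  unfold coord vertex
  rw [(bary_spec c.1.2).1 _ (c.2 k).2 _ (c.2 k').2]
  simp only [Subtype.coe_inj, EmbeddingLike.apply_eq_iff_eq]

lemma sum_bary_vertex {M : Type*} [AddCommMonoid M] (f : (Fin (n + 1) → ℤ) → M) :
    ∑ s ∈ c.1.1, f s = ∑ k, f (c.vertex k) := by
  rw [← Finset.sum_coe_sort c.1.1, ← Equiv.sum_comp c.2]
  rfl

lemma sum_coord (m : Fin (n + 1) → ℤ) : ∑ k, c.coord k m = 1 := by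
  rw [← (bary_spec c.1.2).2.1 (toReal m), c.sum_bary_vertex]
  rfl

lemma sum_coord_mul (m : Fin (n + 1) → ℤ) (i : Fin (n + 1)) :
    ∑ k, c.coord k m * ((c.vertex k).1 i : ℝ) = m i := by
  have h := congrFun ((bary_spec c.1.2).2.2.1 (toReal m)) i
  rw [c.sum_bary_vertex (fun s => bary Δ w c.1 s (toReal m) • toReal s), Finset.sum_apply] at h
  exact h

lemma det_edgeMatrix_ne_zero : c.edgeMatrix.det ≠ 0 := by
  intro h0
  obtain ⟨v, hv, hEv⟩ := Matrix.exists_mulVec_eq_zero_iff.2 h0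
  obtain ⟨f, hf⟩ := exists_affineMap_eq v 0
  have h1 : ∀ k, f (toReal (c.vertex k : Fin (n + 1) → ℤ)) =
      f (toReal (c.vertex 0 : Fin (n + 1) → ℤ)) := by
    intro k
    refine Fin.cases rfl (fun k => ?_) k
    have h2 := congrFun hEv k
    rw [hf, hf, ← sub_eq_zero, add_zero, add_zero]
    simp only [Matrix.mulVec, dotProduct, edgeMatrix, Matrix.of_apply, Pi.zero_apply] at h2
    rw [← h2, ← Finset.sum_sub_distrib]
    exact Finset.sum_congr rfl fun i _ => by simp only [toReal]; ring
  have h3 : ∀ x, f x = f (toReal (c.vertex 0 : Fin (n + 1) → ℤ)) := by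
    intro x
    rw [affineMap_eq_sum_bary c.1.2 f x, c.sum_bary_vertex (fun s => bary Δ w c.1 s x *
      f (toReal s)), Finset.sum_congr rfl fun k _ => by rw [h1 k], ← Finset.sum_mul,
      ← c.sum_bary_vertex (fun s => bary Δ w c.1 s x), (bary_spec c.1.2).2.1, one_mul]
  have h4 : f v = f 0 := (h3 v).trans (h3 0).symm
  rw [hf, hf] at h4
  simp only [Pi.zero_apply, mul_zero, Finset.sum_const_zero, add_zero] at h4
  apply hv
  ext i
  have h5 := (Finset.sum_eq_zero_iff_of_nonneg fun i _ => mul_self_nonneg (v i)).1 h4 i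
    (Finset.mem_univ i)
  exact mul_self_eq_zero.1 h5

/-- The complexified edge matrix. -/
def edgeMatrixC : Matrix (Fin (n + 1)) (Fin (n + 1)) ℂ := c.edgeMatrix.map Complex.ofReal

lemma det_edgeMatrixC : c.edgeMatrixC.det = (c.edgeMatrix.det : ℂ) :=
  (RingHom.map_det Complex.ofRealHom c.edgeMatrix).symm

lemma edgeMatrixC_mulVec (a : Fin (n + 1) → ℂ) (k : Fin (n + 1)) :
    c.edgeMatrixC.mulVec a k = pairing (c.vertex k.succ) a - pairing (c.vertex 0) a := by
  simp only [Matrix.mulVec, dotProduct, edgeMatrixC, edgeMatrix, Matrix.map_apply,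
    Matrix.of_apply, pairing]
  rw [← Finset.sum_sub_distrib]
  refine Finset.sum_congr rfl fun i _ => ?_
  push_cast
  ring

lemma pairing_sub_pairing (m : Fin (n + 1) → ℤ) (a : Fin (n + 1) → ℂ) :
    pairing m a - pairing (c.vertex 0) a =
      ∑ k : Fin (n + 1), (c.coord k.succ m : ℂ) * c.edgeMatrixC.mulVec a k := by
  have h1 : pairing m a = ∑ k, (c.coord k m : ℂ) * pairing (c.vertex k) a := by
    simp only [pairing, Finset.mul_sum]
    rw [Finset.sum_comm]
    refine Finset.sum_congr rfl fun i _ => ?_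
    have := congrArg Complex.ofReal (c.sum_coord_mul m i)
    push_cast at this
    rw [← this, Finset.sum_mul]
    exact Finset.sum_congr rfl fun k _ => by ring
  have h2 : ∑ k, (c.coord k m : ℂ) = 1 := by
    have := congrArg Complex.ofReal (c.sum_coord m)
    push_cast at this
    exact this
  have h3 : pairing m a - pairing (c.vertex 0) a =
      ∑ k, (c.coord k m : ℂ) * (pairing (c.vertex k) a - pairing (c.vertex 0) a) := by
    simp only [mul_sub, Finset.sum_sub_distrib]
    rw [← h1, ← Finset.sum_mul, h2, one_mul]
  rw [h3, Fin.sum_univ_succ, sub_self, mul_zero, zero_add]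
  exact Finset.sum_congr rfl fun k _ => by rw [edgeMatrixC_mulVec]

/-- The direction that moves the second vertex only. -/
def direction : Fin (n + 1) → ℂ := c.edgeMatrixC⁻¹.mulVec (Pi.single 0 1)

lemma edgeMatrixC_mulVec_direction : c.edgeMatrixC.mulVec c.direction = Pi.single 0 1 := by
  have h : IsUnit c.edgeMatrixC.det := by
    rw [det_edgeMatrixC, isUnit_iff_ne_zero]
    exact_mod_cast c.det_edgeMatrix_ne_zero
  rw [direction, Matrix.mulVec_mulVec, Matrix.mul_nonsing_inv _ h, Matrix.one_mulVec]

lemma pairing_direction (m : Fin (n + 1) → ℤ) :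
    pairing m c.direction = c.coord 1 m + pairing (c.vertex 0) c.direction := by
  have h := c.pairing_sub_pairing m c.direction
  rw [edgeMatrixC_mulVec_direction, Fin.sum_univ_succ] at h
  simp only [Pi.single_eq_same, mul_one, Fin.succ_zero_eq_one] at h
  rw [Finset.sum_eq_zero fun k _ => by simp, add_zero] at h
  rw [← h]
  ring

/-- The discrete data of the local model at a simplex with ordered vertices. -/
def model {κ : ℝ} (hκ : 4 * ((n : ℝ) + 2) ≤ κ) : ModelData Δ (Ztop Δ w) n where
  κ := κ
  b m := c.coord 1 m
  S j := (j : Finset (Fin (n + 1) → ℤ)).subtype (· ∈ Δ)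
  m₀ := c.vertex 0
  m₁ := c.vertex 1
  σ s := c.vertex s.succ.succ
  j₀ := c.1
  c₀ := κ ^ 2 / c.edgeMatrix.det ^ 2
  κ_le := hκ
  b_m₀ := by rw [coord_vertex]; simp
  b_σ s := by
    rw [coord_vertex, if_neg]
    intro h
    rw [← Fin.succ_zero_eq_one] at h
    exact Fin.succ_ne_zero s (Fin.succ_injective _ h).symm
  σ_mem s := by
    rw [Finset.mem_subtype]
    exact (c.2 _).2
  card_le j := by
    rw [Finset.card_subtype]
    exact (Finset.card_filter_le _ _).trans (mem_Ztop.1 j.2).2.1.le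
  c₀_pos := by
    have h1 := c.det_edgeMatrix_ne_zero
    have h2 : 0 < κ := lt_of_lt_of_le (by positivity) hκ
    positivity

lemma prod_model_S {κ : ℝ} (hκ : 4 * ((n : ℝ) + 2) ≤ κ) (j : Ztop Δ w)
    (f : (Fin (n + 1) → ℤ) → ℝ) : ∏ m ∈ (c.model hκ).S j, f m = ∏ m ∈ j.1, f m :=
  Finset.prod_subtype_of_mem f (mem_Ztop.1 j.2).1

lemma prod_vertex (f : (Fin (n + 1) → ℤ) → ℝ) :
    ∏ m ∈ c.1.1, f m = f (c.vertex 0) * (f (c.vertex 1) * ∏ s : Fin n, f (c.vertex s.succ.succ)) := by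
  rw [← Finset.prod_coe_sort c.1.1, ← Equiv.prod_comp c.2, Fin.prod_univ_succ, Fin.prod_univ_succ]
  rfl

/-- The parameters of the local model at the point `x`. -/
def paramAt (κ : ℝ) (ζ : ℂ) (x : Fin (n + 1) → ℂ) : ModelParam Δ (Ztop Δ w) n :=
  (fun m => (aFun Δ w κ ζ m x)⁻¹,
    fun m => monoTerm w ζ m x / ‖monoTerm w ζ m x‖,
    fun m s => aFun Δ w κ ζ (c.vertex s.succ.succ) x * c.coord s.succ.succ m / aFun Δ w κ ζ m x,
    fun j => ((∏ m ∈ c.1.1, aFun Δ w κ ζ m x) / ∏ m ∈ j.1, aFun Δ w κ ζ m x) ^ 2)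

variable {κ : ℝ} (hκ : 4 * ((n : ℝ) + 2) ≤ κ) {ζ : ℂ} {x : Fin (n + 1) → ℂ}

lemma aFun_pos {Δ : Finset (Fin (n + 1) → ℤ)} {w : (Fin (n + 1) → ℤ) → ℝ}
    (hκ : 4 * ((n : ℝ) + 2) ≤ κ) (hx : ∀ i, x i ≠ 0) {m : Fin (n + 1) → ℤ} (hm : m ∈ Δ) :
    0 < aFun Δ w κ ζ m x :=
  lt_of_lt_of_le (lt_of_lt_of_le (by positivity) hκ) (le_aFun ⟨m, hm⟩ hx hm κ)

lemma logTerm_paramAt (hx : ∀ i, x i ≠ 0) (u : Fin n → ℂ) (v : ℂ) (m : Δ) :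
    ModelData.logTerm (c.model hκ) (c.paramAt κ ζ x) u v m =
      c.coord 1 m * v + ∑ s : Fin n,
        (c.coord s.succ.succ m : ℂ) * (aFun Δ w κ ζ (c.vertex s.succ.succ) x * u s) := by
  have h : (aFun Δ w κ ζ m x : ℂ) ≠ 0 := by exact_mod_cast (aFun_pos hκ hx m.2).ne'
  simp only [ModelData.logTerm, ModelData.lin, paramAt, model]
  rw [add_comm, Finset.mul_sum]
  congr 1
  refine Finset.sum_congr rfl fun s _ => ?_
  push_cast
  field_simp

lemma term_paramAt (hx : ∀ i, x i ≠ 0) (u : Fin n → ℂ) (v : ℂ) (m : Δ) :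
    (c.model hκ).term m (c.paramAt κ ζ x) u v =
      monoTerm w ζ m x / Real.sqrt (monoNormSum Δ w ζ x) *
        Complex.exp (ModelData.logTerm (c.model hκ) (c.paramAt κ ζ x) u v m) := by
  have hα := aFun_pos (w := w) (ζ := ζ) hκ hx m.2
  have hΔ : Δ.Nonempty := ⟨m, m.2⟩
  have hN := monoNormSum_pos (w := w) (ζ := ζ) hΔ hx
  have hz := norm_pos_iff.2 (monoTerm_ne_zero (w := w) (ζ := ζ) hx m)
  have h1 : Real.exp ((κ - aFun Δ w κ ζ m x) / 2) =
      ‖monoTerm w ζ m x‖ / Real.sqrt (monoNormSum Δ w ζ x) := by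
    have h2 : κ - aFun Δ w κ ζ m x = Real.log (eta Δ w ζ m x) := by
      unfold aFun
      ring
    rw [h2, Real.exp_half, Real.exp_log (eta_pos hΔ hx m), eta_eq,
      Real.sqrt_div (by positivity), Real.sqrt_sq hz.le]
  rw [ModelData.term_eq_of_pos m (inv_pos.2 hα)]
  have h3 : ((c.model hκ).κ / 2 - (1 / 2 - ModelData.lin m (c.paramAt κ ζ x) u) *
      (((c.paramAt κ ζ x).1 m : ℝ) : ℂ)⁻¹ + (c.model hκ).b m * v : ℂ) =
      (((κ - aFun Δ w κ ζ m x) / 2 : ℝ) : ℂ) +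
        ModelData.logTerm (c.model hκ) (c.paramAt κ ζ x) u v m := by
    simp only [ModelData.logTerm, paramAt, model]
    push_cast
    rw [inv_inv]
    ring
  rw [h3, Complex.exp_add, ← Complex.ofReal_exp, h1]
  simp only [paramAt]
  have hzc : (‖monoTerm w ζ m x‖ : ℂ) ≠ 0 := by exact_mod_cast hz.ne'
  push_cast
  field_simp

end Config

end Model

section Admissible

variable {n : ℕ} {Δ : Finset (Fin (n + 1) → ℤ)} {w : (Fin (n + 1) → ℤ) → ℝ} {κ : ℝ} {ζ : ℂ}
  {x : Fin (n + 1) → ℂ}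

namespace Config

lemma term_paramAt_zero (c : Config Δ w) (hκ : 4 * ((n : ℝ) + 2) ≤ κ) (hx : ∀ i, x i ≠ 0)
    (m : Δ) : (c.model hκ).term m (c.paramAt κ ζ x) 0 0 =
      monoTerm w ζ m x / Real.sqrt (monoNormSum Δ w ζ x) := by
  rw [c.term_paramAt hκ hx, c.logTerm_paramAt hκ hx]
  simp

lemma norm_monoTerm_div (hΔ : Δ.Nonempty) (hx : ∀ i, x i ≠ 0) (m : Fin (n + 1) → ℤ) :
    ‖monoTerm w ζ m x / (Real.sqrt (monoNormSum Δ w ζ x) : ℂ)‖ =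
      Real.exp (-(-Real.log (eta Δ w ζ m x)) / 2) := by
  have hz := norm_pos_iff.2 (monoTerm_ne_zero (w := w) (ζ := ζ) hx m)
  rw [neg_neg, Real.exp_half, Real.exp_log (eta_pos hΔ hx m), eta_eq,
    Real.sqrt_div (by positivity), Real.sqrt_sq hz.le, norm_div, Complex.norm_real,
    Real.norm_of_nonneg (Real.sqrt_nonneg _)]

lemma isAdmissible_paramAt (c : Config Δ w) (hκ : 4 * ((n : ℝ) + 2) ≤ κ) {A B L T : ℝ}
    (hA : 0 ≤ A) (hB : 1 ≤ B)
    (hcoord : ∀ k, ∀ m ∈ Δ, |c.coord k m| ≤ A)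
    (hx : x ∈ hypersurface Δ w ζ)
    (hfar : ∀ m ∈ Δ, m ∉ c.1.1 → T ≤ B * -Real.log (eta Δ w ζ m x))
    (hctrl : ∀ s ∈ c.1.1, ∀ m ∈ Δ, bary Δ w c.1 s (toReal m) ≠ 0 →
      -Real.log (eta Δ w ζ s x) ≤ B * -Real.log (eta Δ w ζ m x))
    (h0 : -Real.log (eta Δ w ζ (c.vertex 0) x) ≤ L)
    (h1 : -Real.log (eta Δ w ζ (c.vertex 1) x) ≤ L)
    (hT : Δ.card * (A * Real.exp (-(T / B) / 2)) ≤ Real.exp (-L / 2) / 2) :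
    (c.model hκ).IsAdmissible (max (A * B) ((B ^ (n + 2)) ^ 2))
      (min (1 / (κ + L)) (Real.exp (-L / 2) / 2)) (c.paramAt κ ζ x) := by
  have hΔ : Δ.Nonempty := ⟨_, (c.vertex 0).2⟩
  have hκ0 : 0 < κ := lt_of_lt_of_le (by positivity) hκ
  have hα : ∀ m ∈ Δ, 0 < aFun Δ w κ ζ m x := fun m hm => aFun_pos hκ hx.1 hm
  have hSΔ := (mem_Ztop.1 c.1.2).1
  have hctrl' : ∀ s ∈ c.1.1, ∀ m ∈ Δ, bary Δ w c.1 s (toReal m) ≠ 0 →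
      aFun Δ w κ ζ s x ≤ B * aFun Δ w κ ζ m x := by
    intro s hs m hm hb
    have := hctrl s hs m hm hb
    unfold aFun
    nlinarith
  have hZ : (Real.sqrt (monoNormSum Δ w ζ x) : ℂ) ≠ 0 := by
    exact_mod_cast (Real.sqrt_pos.2 (monoNormSum_pos hΔ hx.1)).ne'
  have hprod : ∀ j ∈ Ztop Δ w, 0 < ∏ m ∈ j, aFun Δ w κ ζ m x := fun j hj =>
    Finset.prod_pos fun m hm => hα m ((mem_Ztop.1 hj).1 hm)
  have hβ : ∀ k, -Real.log (eta Δ w ζ (c.vertex k) x) ≤ L →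
      1 / (κ + L) ≤ (aFun Δ w κ ζ (c.vertex k) x)⁻¹ := by
    intro k hk
    rw [← one_div]
    refine one_div_le_one_div_of_le (hα _ (c.vertex k).2) ?_
    unfold aFun
    linarith
  refine ⟨fun m => inv_pos.2 (hα m m.2), fun m => ?_, fun m => ?_, fun m s => ?_, fun s => ?_,
    fun s s' => ?_, fun j => sq_nonneg _, fun j => ?_, ?_, ?_, ?_, ?_,
    (min_le_left _ _).trans (hβ 0 h0), (min_le_left _ _).trans (hβ 1 h1)⟩
  · rw [one_div]
    exact inv_anti₀ hκ0 (le_aFun hΔ hx.1 m.2 κ)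
  · have hz := norm_pos_iff.2 (monoTerm_ne_zero (w := w) (ζ := ζ) hx.1 m)
    simp only [paramAt]
    rw [norm_div, Complex.norm_real, norm_norm, div_self hz.ne']
  · simp only [paramAt]
    by_cases hb : c.coord s.succ.succ m = 0
    · rw [hb]
      simp only [mul_zero, zero_div, abs_zero]
      exact le_max_of_le_left (by positivity)
    · have h2 := hctrl' _ (c.2 s.succ.succ).2 m m.2 hb
      have h3 := hcoord s.succ.succ m m.2
      have h4 := hα m m.2
      have h5 := hα _ (c.vertex s.succ.succ).2
      rw [abs_div, abs_mul, abs_of_pos h4, abs_of_pos h5, div_le_iff₀ h4]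
      refine le_trans ?_ (mul_le_mul_of_nonneg_right (le_max_left _ _) h4.le)
      calc aFun Δ w κ ζ (c.vertex s.succ.succ) x * |c.coord s.succ.succ m|
          ≤ (B * aFun Δ w κ ζ m x) * A := by
            refine mul_le_mul h2 h3 (abs_nonneg _) (by positivity)
        _ = A * B * aFun Δ w κ ζ m x := by ring
  · simp only [paramAt, model, coord_vertex]
    rw [if_neg (Fin.succ_ne_zero _)]
    simp
  · simp only [paramAt, model, coord_vertex]
    have h5 := hα _ (c.vertex s.succ.succ).2
    by_cases hs : s' = s
    · subst hs
      simp [h5.ne']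
    · rw [if_neg hs, if_neg fun h => hs (Fin.succ_injective _ (Fin.succ_injective _ h))]
      simp
  · simp only [paramAt]
    refine le_max_of_le_right ?_
    have h2 := hprod c.1.1 c.1.2
    have h3 := hprod j.1 j.2
    have h4 := prod_le_of_bary_control c.1.2 j.2 (fun m hm => (hα m hm).le) hctrl'
    have h5 : (∏ m ∈ c.1.1, aFun Δ w κ ζ m x) / ∏ m ∈ j.1, aFun Δ w κ ζ m x ≤ B ^ (n + 2) := by
      rw [div_le_iff₀ h3]
      exact h4
    gcongr
  · simp only [paramAt, model]
    rw [div_self (hprod c.1.1 c.1.2).ne', one_pow]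
  · simp only [ModelData.eqn, c.term_paramAt_zero hκ hx.1]
    rw [← Finset.sum_div, Finset.sum_coe_sort Δ (fun m => monoTerm w ζ m x)]
    rw [div_eq_zero_iff]
    exact Or.inl hx.2
  · simp only [ModelData.normSum, c.term_paramAt_zero hκ hx.1]
    rw [Finset.sum_coe_sort Δ
      (fun m => ‖monoTerm w ζ m x / (Real.sqrt (monoNormSum Δ w ζ x) : ℂ)‖ ^ 2),
      ← sum_eta hΔ hx.1 (w := w) (ζ := ζ)]
    refine Finset.sum_congr rfl fun m _ => ?_
    rw [eta_eq, norm_div, div_pow, Complex.norm_real, Real.norm_of_nonneg (Real.sqrt_nonneg _),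
      Real.sq_sqrt (monoNormSum_pos hΔ hx.1).le]
  · refine (min_le_right _ _).trans ?_
    simp only [ModelData.eqnDeriv, c.term_paramAt_zero hκ hx.1]
    set f : Δ → ℂ := fun m => ((c.model hκ).b m : ℂ) *
      (monoTerm w ζ m x / (Real.sqrt (monoNormSum Δ w ζ x) : ℂ)) with hf
    have hb1 : (c.model hκ).b (c.vertex 1) = 1 := by
      simp only [model, coord_vertex, if_true]
    have hlow : Real.exp (-L / 2) ≤ ‖f (c.vertex 1)‖ := by
      rw [hf]
      simp only [hb1, Complex.ofReal_one, one_mul]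
      rw [norm_monoTerm_div hΔ hx.1]
      exact Real.exp_le_exp.2 (by linarith)
    have hrest : ∀ m ∈ Finset.univ.erase (c.vertex 1),
        ‖f m‖ ≤ A * Real.exp (-(T / B) / 2) := by
      intro m hm
      rw [hf]
      simp only [norm_mul, Complex.norm_real, Real.norm_eq_abs]
      rw [norm_monoTerm_div hΔ hx.1]
      by_cases hmS : (m : Fin (n + 1) → ℤ) ∈ c.1.1
      · obtain ⟨k, hk⟩ := c.2.surjective ⟨m, hmS⟩
        have hmk : m = c.vertex k := by
          apply Subtype.ext
          simp only [vertex, hk]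
        have h2 : (c.model hκ).b m = 0 := by
          simp only [model, hmk, coord_vertex]
          rw [if_neg]
          rintro rfl
          exact Finset.ne_of_mem_erase hm hmk
        rw [h2, abs_zero, zero_mul]
        positivity
      · have h2 := hfar m m.2 hmS
        have h3 : T / B ≤ -Real.log (eta Δ w ζ m x) := by
          rw [div_le_iff₀ (by linarith)]
          linarith
        refine mul_le_mul (hcoord 1 m m.2) (Real.exp_le_exp.2 (by linarith)) (Real.exp_pos _).le hA
    have hsum : ‖∑ m ∈ Finset.univ.erase (c.vertex 1), f m‖ ≤
        Δ.card * (A * Real.exp (-(T / B) / 2)) := by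
      calc _ ≤ ∑ m ∈ Finset.univ.erase (c.vertex 1), ‖f m‖ := norm_sum_le _ _
        _ ≤ (Finset.univ.erase (c.vertex 1)).card • (A * Real.exp (-(T / B) / 2)) :=
            Finset.sum_le_card_nsmul _ _ _ hrest
        _ ≤ Δ.card * (A * Real.exp (-(T / B) / 2)) := by
            rw [nsmul_eq_mul]
            gcongr
            refine (Finset.card_le_card (Finset.erase_subset _ _)).trans ?_
            simp
    rw [← Finset.add_sum_erase _ f (Finset.mem_univ (c.vertex 1))]
    have h3 := norm_sub_norm_le (f (c.vertex 1)) (-∑ m ∈ Finset.univ.erase (c.vertex 1), f m)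
    rw [norm_neg, sub_neg_eq_add] at h3
    linarith

lemma exists_config (S : Ztop Δ w) {m₀ m₁ : Fin (n + 1) → ℤ} (h0 : m₀ ∈ S.1) (h1 : m₁ ∈ S.1)
    (hne : m₀ ≠ m₁) : ∃ c : Config Δ w, c.1 = S ∧ (c.vertex 0 : Fin (n + 1) → ℤ) = m₀ ∧
      (c.vertex 1 : Fin (n + 1) → ℤ) = m₁ := by
  have hc : Fintype.card (Fin (n + 2)) = Fintype.card S.1 := by
    rw [Fintype.card_coe, (mem_Ztop.1 S.2).2.1, Fintype.card_fin]
  let e := Fintype.equivOfCardEq hc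
  let e₁ := (Equiv.swap 0 (e.symm ⟨m₀, h0⟩)).trans e
  have he₁ : e₁ 0 = ⟨m₀, h0⟩ := by simp [e₁]
  let e₂ := (Equiv.swap 1 (e₁.symm ⟨m₁, h1⟩)).trans e₁
  have he₂ : e₂ 1 = ⟨m₁, h1⟩ := by simp [e₂]
  have he₂' : e₂ 0 = ⟨m₀, h0⟩ := by
    simp only [e₂, Equiv.trans_apply]
    rw [Equiv.swap_apply_of_ne_of_ne (by simp), he₁]
    intro h
    have h2 := congrArg e₁ h
    rw [Equiv.apply_symm_apply, he₁] at h2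
    exact hne (congrArg Subtype.val h2)
  exact ⟨⟨S, e₂⟩, rfl, congrArg Subtype.val he₂', congrArg Subtype.val he₂⟩

/-- For small `t`, each point of the hypersurface belongs to a local model with parameters in
a fixed bounded set. -/
theorem exists_isAdmissible (hw : IsSimplicialData Δ w) (hκ : 4 * ((n : ℝ) + 2) ≤ κ) :
    ∃ C b t₀ : ℝ, 0 < b ∧ 0 < t₀ ∧ ∀ ζ : ℂ, ‖Complex.exp ζ‖ < t₀ →
      ∀ x ∈ hypersurface Δ w ζ, ∃ c : Config Δ w,
        (c.model hκ).IsAdmissible C b (c.paramAt κ ζ x) := by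
  have hκ0 : 0 < κ := lt_of_lt_of_le (by positivity) hκ
  have hΔ := hw.nonempty
  obtain ⟨B, hB, hctrl⟩ := exists_controlling_simplex hw
  obtain ⟨A, hA, hcoord⟩ := exists_abs_le
    (fun y : Config Δ w × Fin (n + 2) × Δ => y.1.coord y.2.1 y.2.2)
  have hcard1 : (1 : ℝ) ≤ Δ.card := by exact_mod_cast hΔ.card_pos
  set L := 3 * Real.log Δ.card with hLdef
  have hL : 0 ≤ L := by
    have := Real.log_nonneg hcard1
    positivity
  set T₀ := 2 * B * (L + Real.log (2 * (Δ.card * A))) with hT₀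
  have hlog : 0 ≤ Real.log (2 * (Δ.card * A)) := Real.log_nonneg (by nlinarith)
  refine ⟨max (A * B) ((B ^ (n + 2)) ^ 2), min (1 / (κ + L)) (Real.exp (-L / 2) / 2), Real.exp (-T₀ / 2),
    by positivity, Real.exp_pos _, fun ζ hζ x hx => ?_⟩
  rw [Complex.norm_exp, Real.exp_lt_exp] at hζ
  set T := -2 * ζ.re with hT
  have hTT₀ : T₀ < T := by rw [hT]; linarith
  have hT₀0 : 0 ≤ T₀ := by rw [hT₀]; positivity
  obtain ⟨g, hg⟩ := exists_affineMap_neg_log_eta (w := w) (ζ := ζ) hΔ hx.1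
  obtain ⟨S, hS, hfar, hc⟩ := hctrl T (by linarith) g (fun m => -Real.log (eta Δ w ζ m x))
    (fun m _ => hg m) (fun m hm => by
      have := Real.log_nonpos (eta_pos hΔ hx.1 m).le (eta_le_one (w := w) (ζ := ζ) hΔ hx.1 hm)
      linarith)
  obtain ⟨m₀, hm₀, m₁, hm₁, hne, hl₀, hl₁⟩ := exists_two_large_monomials hΔ hx
  have hmem : ∀ m ∈ Δ, -Real.log (eta Δ w ζ m x) ≤ L → m ∈ S := by
    intro m hm hl
    by_contra hmS
    have h1 := hfar m hm hmS
    have h2 : B * -Real.log (eta Δ w ζ m x) ≤ B * L := by gcongr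
    have h3 : B * L ≤ T₀ := by
      rw [hT₀]
      nlinarith [mul_nonneg (zero_le_one.trans hB) hL, mul_nonneg (zero_le_one.trans hB) hlog]
    linarith
  obtain ⟨c, hcS, hc0, hc1⟩ := exists_config ⟨S, hS⟩ (hmem m₀ hm₀ hl₀) (hmem m₁ hm₁ hl₁) hne
  have hcS' : c.1.1 = S := by rw [hcS]
  refine ⟨c, c.isAdmissible_paramAt hκ (T := T) (zero_le_one.trans hA) hB
    (fun k m hm => hcoord (c, k, ⟨m, hm⟩)) hx (by rw [hcS']; exact hfar) (by rw [hcS']; exact hc)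
    (by rw [hc0]; exact hl₀) (by rw [hc1]; exact hl₁) ?_⟩
  have hB0 : 0 < B := by linarith
  have h1 : Real.exp (-(T / B) / 2) ≤ Real.exp (-(L + Real.log (2 * (Δ.card * A)))) := by
    rw [Real.exp_le_exp]
    have : 2 * (L + Real.log (2 * (Δ.card * A))) ≤ T / B := by
      rw [le_div_iff₀ hB0]
      rw [hT₀] at hTT₀
      linarith
    linarith
  have hcA : (0 : ℝ) < 2 * (Δ.card * A) := by nlinarith
  rw [neg_add, Real.exp_add, Real.exp_neg (Real.log _), Real.exp_log hcA] at h1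
  calc Δ.card * (A * Real.exp (-(T / B) / 2))
      ≤ Δ.card * (A * (Real.exp (-L) * (2 * (Δ.card * A))⁻¹)) :=
        mul_le_mul_of_nonneg_left (mul_le_mul_of_nonneg_left h1 (by linarith)) (by linarith)
    _ = Real.exp (-L) / 2 := by
        have : (Δ.card : ℝ) ≠ 0 := by linarith
        have : A ≠ 0 := by linarith
        field_simp
    _ ≤ Real.exp (-L / 2) / 2 := by
        have : Real.exp (-L) ≤ Real.exp (-L / 2) := Real.exp_le_exp.2 (by linarith)
        linarith

end Config

end Admissible

section Charts

variable {n : ℕ} {Δ : Finset (Fin (n + 1) → ℤ)} {w : (Fin (n + 1) → ℤ) → ℝ} {κ : ℝ} {ζ : ℂ}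
  {C b : ℝ}

namespace LocalParam

variable (F : LocalParam n (hypersurface Δ w ζ)) (u₀ : Fin n → ℂ)

/-- Logarithmic coordinates centered at `u₀`. -/
def logCoord (y : Fin n → ℂ) : Fin (n + 1) → ℂ :=
  fun i => Complex.log (F.toFun y i / F.toFun u₀ i)

variable {F u₀} {y : Fin n → ℂ}

lemma ne_zero (hy : y ∈ F.domain) (i : Fin (n + 1)) : F.toFun y i ≠ 0 := (F.mapsTo hy).1 i

lemma differentiableAt (hy : y ∈ F.domain) : DifferentiableAt ℂ F.toFun y :=
  F.differentiableOn.differentiableAt (F.isOpen_domain.mem_nhds hy)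

variable (F u₀) in
/-- The domain of the logarithmic coordinates. -/
def IsNear (y : Fin n → ℂ) : Prop :=
  y ∈ F.domain ∧ ∀ i, F.toFun y i / F.toFun u₀ i ∈ Complex.slitPlane

lemma eventually_isNear (hu : u₀ ∈ F.domain) : ∀ᶠ y in 𝓝 u₀, F.IsNear u₀ y := by
  have h1 : ∀ᶠ y in 𝓝 u₀, y ∈ F.domain := F.isOpen_domain.mem_nhds hu
  refine h1.and (Filter.eventually_all.2 fun i => ?_)
  have hc : ContinuousAt (fun y => F.toFun y i / F.toFun u₀ i) u₀ :=
    (continuousAt_pi.1 (differentiableAt hu).continuousAt i).div_const _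
  refine hc.eventually (Complex.isOpen_slitPlane.mem_nhds ?_)
  simp only [div_self (ne_zero hu i)]
  exact Complex.one_mem_slitPlane

lemma toFun_eq (hu : u₀ ∈ F.domain) (hy : F.IsNear u₀ y) :
    F.toFun y = fun i => F.toFun u₀ i * Complex.exp (F.logCoord u₀ y i) := by
  ext i
  rw [logCoord, Complex.exp_log (div_ne_zero (ne_zero hy.1 i) (ne_zero hu i)),
    mul_div_cancel₀ _ (ne_zero hu i)]

lemma logCoord_self (hu : u₀ ∈ F.domain) : F.logCoord u₀ u₀ = 0 := by
  ext i
  rw [logCoord, div_self (ne_zero hu i), Complex.log_one]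
  rfl

lemma hasFDerivAt_logCoord (hu : u₀ ∈ F.domain) (hy : F.IsNear u₀ y) :
    HasFDerivAt (F.logCoord u₀) (ContinuousLinearMap.pi fun i =>
      (F.toFun y i)⁻¹ • (ContinuousLinearMap.proj i).comp (fderiv ℂ F.toFun y)) y := by
  rw [hasFDerivAt_pi]
  intro i
  have h1 : HasFDerivAt (fun y => F.toFun y i)
      ((ContinuousLinearMap.proj i).comp (fderiv ℂ F.toFun y)) y :=
    hasFDerivAt_pi'.1 (differentiableAt hy.1).hasFDerivAt i
  have h2 := (h1.mul_const (F.toFun u₀ i)⁻¹).clog (hy.2 i)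
  refine h2.congr_fderiv ?_
  rw [smul_smul]
  congr 1
  have := ne_zero hy.1 i
  have := ne_zero hu i
  field_simp

lemma fderiv_poly_eq_zero (hy : y ∈ F.domain) (X : Fin n → ℂ) :
    fderiv ℂ (poly Δ w ζ) (F.toFun y) (fderiv ℂ F.toFun y X) = 0 := by
  have h1 := (differentiableAt_poly (Δ := Δ) (w := w) (ζ := ζ)
    (fun i => ne_zero hy i)).hasFDerivAt.comp y (differentiableAt hy).hasFDerivAt
  have h2 : HasFDerivAt (poly Δ w ζ ∘ F.toFun) (0 : (Fin n → ℂ) →L[ℂ] ℂ) y := by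
    refine (hasFDerivAt_const (0 : ℂ) y).congr_of_eventuallyEq ?_
    filter_upwards [F.isOpen_domain.mem_nhds hy] with y' hy' using (F.mapsTo hy').2
  exact congrArg (fun L : (Fin n → ℂ) →L[ℂ] ℂ => L X) (h1.unique h2)

end LocalParam

namespace Config

variable (c : Config Δ w) (κ : ℝ) (F : LocalParam n (hypersurface Δ w ζ)) (u₀ : Fin n → ℂ)

/-- The coordinates `u` of the local model. -/
def chartU (y : Fin n → ℂ) : Fin n → ℂ := fun s =>
  c.edgeMatrixC.mulVec (F.logCoord u₀ y) s.succ /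
    (aFun Δ w κ ζ (c.vertex s.succ.succ) (F.toFun u₀) : ℂ)

/-- The coordinate `v` of the local model. -/
def chartV (y : Fin n → ℂ) : ℂ := c.edgeMatrixC.mulVec (F.logCoord u₀ y) 0

variable {κ F u₀} {y : Fin n → ℂ} (hκ : 4 * ((n : ℝ) + 2) ≤ κ)

open LocalParam

lemma logTerm_chart (hu : u₀ ∈ F.domain) (m : Δ) :
    ModelData.logTerm (c.model hκ) (c.paramAt κ ζ (F.toFun u₀)) (c.chartU κ F u₀ y)
      (c.chartV F u₀ y) m =
      pairing m (F.logCoord u₀ y) - pairing (c.vertex 0) (F.logCoord u₀ y) := by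
  rw [c.logTerm_paramAt hκ (ne_zero hu), c.pairing_sub_pairing, Fin.sum_univ_succ]
  simp only [chartU, chartV, Fin.succ_zero_eq_one]
  congr 1
  refine Finset.sum_congr rfl fun s _ => ?_
  have h : (aFun Δ w κ ζ (c.vertex s.succ.succ) (F.toFun u₀) : ℂ) ≠ 0 := by
    exact_mod_cast (aFun_pos hκ (ne_zero hu) (c.vertex s.succ.succ).2).ne'
  rw [mul_div_cancel₀ _ h]

variable (F u₀) in
/-- The factor that normalizes the monomials. -/
def scale (y : Fin n → ℂ) : ℂ :=
  Real.sqrt (monoNormSum Δ w ζ (F.toFun u₀)) *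
    Complex.exp (pairing (c.vertex 0) (F.logCoord u₀ y))

lemma sqrt_monoNormSum_ne_zero (c : Config Δ w) (hu : u₀ ∈ F.domain) :
    (Real.sqrt (monoNormSum Δ w ζ (F.toFun u₀)) : ℂ) ≠ 0 := by
  exact_mod_cast (Real.sqrt_pos.2 (monoNormSum_pos ⟨_, (c.vertex 0).2⟩ (ne_zero hu))).ne'

lemma scale_ne_zero (hu : u₀ ∈ F.domain) : c.scale F u₀ y ≠ 0 :=
  mul_ne_zero (c.sqrt_monoNormSum_ne_zero hu) (Complex.exp_ne_zero _)

lemma monoTerm_eq (hu : u₀ ∈ F.domain) (hy : F.IsNear u₀ y) (m : Δ) :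
    monoTerm w ζ m (F.toFun y) = c.scale F u₀ y *
      (c.model hκ).term m (c.paramAt κ ζ (F.toFun u₀)) (c.chartU κ F u₀ y)
        (c.chartV F u₀ y) := by
  rw [c.term_paramAt hκ (ne_zero hu), c.logTerm_chart hκ hu, toFun_eq hu hy, monoTerm_mul_exp,
    Complex.exp_sub, scale]
  have h1 := c.sqrt_monoNormSum_ne_zero hu
  have h2 := Complex.exp_ne_zero (pairing (c.vertex 0) (F.logCoord u₀ y))
  field_simp

lemma eqn_chart (hu : u₀ ∈ F.domain) (hy : F.IsNear u₀ y) :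
    (c.model hκ).eqn (c.paramAt κ ζ (F.toFun u₀)) (c.chartU κ F u₀ y) (c.chartV F u₀ y) = 0 := by
  have h1 : c.scale F u₀ y * (c.model hκ).eqn (c.paramAt κ ζ (F.toFun u₀)) (c.chartU κ F u₀ y)
      (c.chartV F u₀ y) = 0 := by
    rw [ModelData.eqn, Finset.mul_sum]
    simp only [← c.monoTerm_eq hκ hu hy]
    rw [Finset.sum_coe_sort Δ (fun m => monoTerm w ζ m (F.toFun y))]
    exact (F.mapsTo hy.1).2
  exact (mul_eq_zero.1 h1).resolve_left (c.scale_ne_zero hu)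

lemma fderiv_poly_direction {x : Fin (n + 1) → ℂ} (hx : x ∈ hypersurface Δ w ζ) :
    fderiv ℂ (poly Δ w ζ) x (fun i => x i * c.direction i) =
      ∑ m : Δ, (c.coord 1 m : ℂ) * monoTerm w ζ m x := by
  rw [fderiv_poly_mul hx.1, Finset.sum_coe_sort Δ (fun m => (c.coord 1 m : ℂ) * monoTerm w ζ m x)]
  rw [Finset.sum_congr rfl fun m _ => by rw [c.pairing_direction m, mul_add],
    Finset.sum_add_distrib, ← Finset.sum_mul, show ∑ m ∈ Δ, monoTerm w ζ m x = 0 from hx.2, zero_mul, add_zero]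
  exact Finset.sum_congr rfl fun m _ => mul_comm _ _

lemma fderiv_poly_direction_chart (hu : u₀ ∈ F.domain) (hy : F.IsNear u₀ y) :
    fderiv ℂ (poly Δ w ζ) (F.toFun y) (fun i => F.toFun y i * c.direction i) =
      c.scale F u₀ y * (c.model hκ).eqnDeriv (c.paramAt κ ζ (F.toFun u₀)) (c.chartU κ F u₀ y)
        (c.chartV F u₀ y) := by
  rw [c.fderiv_poly_direction (F.mapsTo hy.1), ModelData.eqnDeriv, Finset.mul_sum]
  refine Finset.sum_congr rfl fun m _ => ?_
  rw [c.monoTerm_eq hκ hu hy]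
  simp only [model]
  ring

lemma fderiv_poly_ne_zero {x : Fin (n + 1) → ℂ} (hb : 0 < b) (hx : x ∈ hypersurface Δ w ζ)
    (hp : (c.model hκ).IsAdmissible C b (c.paramAt κ ζ x)) : fderiv ℂ (poly Δ w ζ) x ≠ 0 := by
  intro h0
  have h1 := c.fderiv_poly_direction hx
  rw [h0, zero_apply] at h1
  have h2 : (c.model hκ).eqnDeriv (c.paramAt κ ζ x) 0 0 = 0 := by
    simp only [ModelData.eqnDeriv, c.term_paramAt_zero hκ hx.1]
    simp only [← mul_div_assoc]
    rw [← Finset.sum_div, show ∑ m : Δ, ((c.model hκ).b m : ℂ) * monoTerm w ζ m x = 0 from h1.symm,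
      zero_div]
  have h3 := hp.le_eqnDeriv
  rw [h2, norm_zero] at h3
  linarith

/-- A row of the edge matrix as a linear form. -/
def edgeForm (k : Fin (n + 1)) : (Fin (n + 1) → ℂ) →L[ℂ] ℂ :=
  (ContinuousLinearMap.proj k).comp (Matrix.mulVecLin c.edgeMatrixC).toContinuousLinearMap

lemma hasFDerivAt_chartU (hu : u₀ ∈ F.domain) (hy : F.IsNear u₀ y) :
    HasFDerivAt (c.chartU κ F u₀) (ContinuousLinearMap.pi fun s =>
      (aFun Δ w κ ζ (c.vertex s.succ.succ) (F.toFun u₀) : ℂ)⁻¹ •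
        (c.edgeForm s.succ).comp (fderiv ℂ (F.logCoord u₀) y)) y := by
  rw [hasFDerivAt_pi]
  intro s
  have h := (hasFDerivAt_logCoord hu hy).differentiableAt.hasFDerivAt
  exact (((c.edgeForm s.succ).hasFDerivAt.comp y h).mul_const _)

lemma hasFDerivAt_chartV (hu : u₀ ∈ F.domain) (hy : F.IsNear u₀ y) :
    HasFDerivAt (c.chartV F u₀) ((c.edgeForm 0).comp (fderiv ℂ (F.logCoord u₀) y)) y :=
  (c.edgeForm 0).hasFDerivAt.comp y (hasFDerivAt_logCoord hu hy).differentiableAt.hasFDerivAt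

/-- The derivative of the coordinates of the local model. -/
lemma fderiv_chartU (hκ : 4 * ((n : ℝ) + 2) ≤ κ) (hu : u₀ ∈ F.domain) (hy : F.IsNear u₀ y)
    (X : Fin n → ℂ) (s : Fin n) :
    c.edgeMatrixC.mulVec (fderiv ℂ (F.logCoord u₀) y X) s.succ =
      (aFun Δ w κ ζ (c.vertex s.succ.succ) (F.toFun u₀) : ℂ) *
        fderiv ℂ (c.chartU κ F u₀) y X s := by
  have h : (aFun Δ w κ ζ (c.vertex s.succ.succ) (F.toFun u₀) : ℂ) ≠ 0 := by
    exact_mod_cast (aFun_pos hκ (ne_zero hu) (c.vertex s.succ.succ).2).ne'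
  rw [(c.hasFDerivAt_chartU hu hy).fderiv]
  exact (mul_inv_cancel_left₀ h _).symm

lemma Omega_chart (hκ : 4 * ((n : ℝ) + 2) ≤ κ) (hu : u₀ ∈ F.domain) (hy : F.IsNear u₀ y) :
    Omega (F.toFun y) (Fin.cons (fun i => F.toFun y i * c.direction i)
      (fun j => fderiv ℂ F.toFun y (Pi.single j 1)) : Fin (n + 1) → Fin (n + 1) → ℂ) =
      (∏ s : Fin n, (aFun Δ w κ ζ (c.vertex s.succ.succ) (F.toFun u₀) : ℂ)) *
        ModelData.jac (c.chartU κ F u₀) y / c.edgeMatrix.det := by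
  have hE : (c.edgeMatrix.det : ℂ) ≠ 0 := by exact_mod_cast c.det_edgeMatrix_ne_zero
  set dl : Fin n → Fin (n + 1) → ℂ := fun j => fderiv ℂ (F.logCoord u₀) y (Pi.single j 1) with hdl
  set A : Matrix (Fin (n + 1)) (Fin (n + 1)) ℂ :=
    Matrix.of (Fin.cons c.direction dl : Fin (n + 1) → Fin (n + 1) → ℂ) with hA
  have h1 : Matrix.of (Fin.cons (fun i => F.toFun y i * c.direction i)
      (fun j => fderiv ℂ F.toFun y (Pi.single j 1)) : Fin (n + 1) → Fin (n + 1) → ℂ) =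
      Matrix.of fun k i => F.toFun y i * A k i := by
    ext k i
    refine Fin.cases ?_ (fun j => ?_) k
    · simp [hA]
    · simp only [hA, Matrix.of_apply, Fin.cons_succ, hdl, (hasFDerivAt_logCoord hu hy).fderiv]
      simp [ne_zero hy.1 i]
  have h2 : Omega (F.toFun y) (Fin.cons (fun i => F.toFun y i * c.direction i)
      (fun j => fderiv ℂ F.toFun y (Pi.single j 1)) : Fin (n + 1) → Fin (n + 1) → ℂ) = A.det := by
    rw [Omega, h1, Matrix.det_mul_row, mul_div_cancel_left₀]
    exact Finset.prod_ne_zero_iff.2 fun i _ => ne_zero hy.1 i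
  have h3 : (A * c.edgeMatrixC.transpose).det =
      (∏ s : Fin n, (aFun Δ w κ ζ (c.vertex s.succ.succ) (F.toFun u₀) : ℂ)) *
        ModelData.jac (c.chartU κ F u₀) y := by
    have hrow : ∀ k i, (A * c.edgeMatrixC.transpose) k i = c.edgeMatrixC.mulVec (A k) i := by
      intro k i
      simp only [Matrix.mul_apply, Matrix.transpose_apply, Matrix.mulVec, dotProduct]
      exact Finset.sum_congr rfl fun _ _ => mul_comm _ _
    have hrow0 : ∀ i, (A * c.edgeMatrixC.transpose) 0 i =
        (Pi.single 0 1 : Fin (n + 1) → ℂ) i := by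
      intro i
      rw [hrow, ← c.edgeMatrixC_mulVec_direction]
      rfl
    rw [Matrix.det_succ_row_zero, Finset.sum_eq_single 0]
    · rw [hrow0, ModelData.jac, ← Matrix.det_mul_row]
      simp only [Fin.val_zero, pow_zero, one_mul, Pi.single_eq_same]
      congr 1
      ext j s
      simp only [Matrix.submatrix_apply, Fin.succAbove_zero, Matrix.of_apply]
      rw [hrow, ← c.fderiv_chartU hκ hu hy]
      rfl
    · intro i _ hi
      rw [hrow0, Pi.single_eq_of_ne hi]
      simp
    · simp
  rw [h2, eq_div_iff hE, ← h3, Matrix.det_mul, Matrix.det_transpose, det_edgeMatrixC]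

lemma jac_chartU_ne_zero (hu : u₀ ∈ F.domain) (hy : F.IsNear u₀ y)
    (hd : (c.model hκ).eqnDeriv (c.paramAt κ ζ (F.toFun u₀)) (c.chartU κ F u₀ y)
        (c.chartV F u₀ y) ≠ 0) : ModelData.jac (c.chartU κ F u₀) y ≠ 0 := by
  intro h0
  have h1 := c.Omega_chart hκ hu hy
  rw [h0, mul_zero, zero_div, Omega, div_eq_zero_iff] at h1
  have h2 := h1.resolve_right (Finset.prod_ne_zero_iff.2 fun i _ => ne_zero hy.1 i)
  have hind : LinearIndependent ℂ (Fin.cons (fun i => F.toFun y i * c.direction i)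
      (fun j => fderiv ℂ F.toFun y (Pi.single j 1)) : Fin (n + 1) → Fin (n + 1) → ℂ) := by
    rw [linearIndependent_finCons]
    constructor
    · have h3 := (Pi.basisFun ℂ (Fin n)).linearIndependent.map'
        (fderiv ℂ F.toFun y : (Fin n → ℂ) →ₗ[ℂ] (Fin (n + 1) → ℂ))
        (LinearMap.ker_eq_bot.2 (F.immersion y hy.1))
      have h4 : (fderiv ℂ F.toFun y : (Fin n → ℂ) →ₗ[ℂ] (Fin (n + 1) → ℂ)) ∘
          Pi.basisFun ℂ (Fin n) = fun j => fderiv ℂ F.toFun y (Pi.single j 1) := by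
        ext j i
        simp
      rwa [h4] at h3
    · intro hmem
      have h4 : Submodule.span ℂ (Set.range fun j => fderiv ℂ F.toFun y (Pi.single j 1)) ≤
          LinearMap.ker (fderiv ℂ (poly Δ w ζ) (F.toFun y) : (Fin (n + 1) → ℂ) →ₗ[ℂ] ℂ) := by
        rw [Submodule.span_le]
        rintro _ ⟨j, rfl⟩
        exact fderiv_poly_eq_zero hy.1 _
      have h5 := h4 hmem
      rw [LinearMap.mem_ker, ContinuousLinearMap.coe_coe,
        c.fderiv_poly_direction_chart hκ hu hy] at h5
      exact mul_ne_zero (c.scale_ne_zero hu) hd h5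
  have h6 := (Matrix.linearIndependent_rows_iff_isUnit (A := Matrix.of
    (Fin.cons (fun i => F.toFun y i * c.direction i)
      (fun j => fderiv ℂ F.toFun y (Pi.single j 1)) : Fin (n + 1) → Fin (n + 1) → ℂ))).1 hind
  rw [Matrix.isUnit_iff_isUnit_det, h2] at h6
  exact not_isUnit_zero h6

end Config

end Charts

section Density

variable {n : ℕ} {Δ : Finset (Fin (n + 1) → ℤ)} {w : (Fin (n + 1) → ℤ) → ℝ} {κ : ℝ} {ζ : ℂ}
  {C b : ℝ}

namespace Config

open LocalParam

variable (c : Config Δ w) {F : LocalParam n (hypersurface Δ w ζ)} {u₀ y : Fin n → ℂ}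
  (hκ : 4 * ((n : ℝ) + 2) ≤ κ)

lemma monoNormSum_eq (hu : u₀ ∈ F.domain) (hy : F.IsNear u₀ y) :
    monoNormSum Δ w ζ (F.toFun y) = ‖c.scale F u₀ y‖ ^ 2 *
      (c.model hκ).normSum (c.paramAt κ ζ (F.toFun u₀)) (c.chartU κ F u₀ y)
        (c.chartV F u₀ y) := by
  rw [monoNormSum, ModelData.normSum, Finset.mul_sum,
    ← Finset.sum_coe_sort Δ (fun m => ‖monoTerm w ζ m (F.toFun y)‖ ^ 2)]
  refine Finset.sum_congr rfl fun m _ => ?_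
  rw [c.monoTerm_eq hκ hu hy, norm_mul, mul_pow]

lemma aFun_chart (hu : u₀ ∈ F.domain) (hy : F.IsNear u₀ y)
    (hp : (c.model hκ).IsAdmissible C b (c.paramAt κ ζ (F.toFun u₀))) (m : Δ) :
    aFun Δ w κ ζ m (F.toFun y) = aFun Δ w κ ζ m (F.toFun u₀) *
      (c.model hκ).scaled m (c.paramAt κ ζ (F.toFun u₀)) (c.chartU κ F u₀ y)
        (c.chartV F u₀ y) := by
  set p := c.paramAt κ ζ (F.toFun u₀) with hpdef
  set D := c.model hκ with hD
  set u := c.chartU κ F u₀ y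
  set v := c.chartV F u₀ y
  have hsc := norm_pos_iff.2 (c.scale_ne_zero (y := y) hu)
  have hα := aFun_pos (w := w) (ζ := ζ) hκ (ne_zero hu) m.2
  have hNpos := monoNormSum_pos (w := w) (ζ := ζ) ⟨m, m.2⟩ (ne_zero hy.1)
  have hN := c.monoNormSum_eq hκ hu hy
  have hN' : 0 < D.normSum p u v := by
    rw [hN] at hNpos
    exact pos_of_mul_pos_right hNpos (by positivity)
  have hη : eta Δ w ζ m (F.toFun y) = ‖D.term m p u v‖ ^ 2 / D.normSum p u v := by
    rw [eta_eq, hN, c.monoTerm_eq hκ hu hy, norm_mul, mul_pow,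
      mul_div_mul_left _ _ (by positivity)]
  have hlin : (ModelData.logTerm D p u v m).re =
      aFun Δ w κ ζ m (F.toFun u₀) * (ModelData.lin m p u).re + D.b m * v.re := by
    rw [ModelData.logTerm, Complex.add_re, Complex.re_ofReal_mul, hpdef]
    simp only [paramAt, Complex.ofReal_inv, inv_inv, Complex.re_ofReal_mul]
  have hβ : p.1 m = (aFun Δ w κ ζ m (F.toFun u₀))⁻¹ := rfl
  have hκ' : D.κ = κ := rfl
  rw [aFun, hη, ModelData.norm_term_sq hp, ← Real.exp_add,
    Real.log_div (Real.exp_pos _).ne' hN'.ne', Real.log_exp, hlin, hβ, inv_inv, hκ',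
    ModelData.scaled, hβ]
  field_simp
  ring

lemma hFun_chart (hu : u₀ ∈ F.domain) (hy : F.IsNear u₀ y)
    (hp : (c.model hκ).IsAdmissible C b (c.paramAt κ ζ (F.toFun u₀))) :
    hFun Δ w κ ζ (F.toFun y) = κ ^ 2 * ((∏ m ∈ c.1.1, aFun Δ w κ ζ m (F.toFun u₀))⁻¹) ^ 2 *
      (c.model hκ).hsum (c.paramAt κ ζ (F.toFun u₀)) (c.chartU κ F u₀ y)
        (c.chartV F u₀ y) := by
  have hprod : ∀ j ∈ Ztop Δ w, 0 < ∏ m ∈ j, aFun Δ w κ ζ m (F.toFun u₀) := fun j hj =>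
    Finset.prod_pos fun m hm => aFun_pos hκ (ne_zero hu) ((mem_Ztop.1 hj).1 hm)
  rw [hFun, ModelData.hsum, mul_assoc,
    ← Finset.sum_coe_sort (Ztop Δ w) (fun S => ((∏ m ∈ S, aFun Δ w κ ζ m (F.toFun y))⁻¹) ^ 2)]
  congr 1
  rw [Finset.mul_sum]
  refine Finset.sum_congr rfl fun j _ => ?_
  have h1 : ∏ m ∈ j.1, aFun Δ w κ ζ m (F.toFun y) =
      (∏ m ∈ j.1, aFun Δ w κ ζ m (F.toFun u₀)) * ∏ m ∈ (c.model hκ).S j, (c.model hκ).scaled m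
        (c.paramAt κ ζ (F.toFun u₀)) (c.chartU κ F u₀ y) (c.chartV F u₀ y) := by
    rw [← c.prod_model_S hκ j, ← c.prod_model_S hκ j, ← Finset.prod_mul_distrib]
    exact Finset.prod_congr rfl fun m _ => c.aFun_chart hκ hu hy hp m
  have h2 := (hprod c.1.1 c.1.2).ne'
  have h3 := (hprod j.1 j.2).ne'
  rw [h1]
  simp only [paramAt]
  rw [mul_inv, mul_pow, ← mul_assoc]
  congr 1
  field_simp

lemma OmegaT_chart (hu : u₀ ∈ F.domain) (hy : F.IsNear u₀ y)
    (hd : (c.model hκ).eqnDeriv (c.paramAt κ ζ (F.toFun u₀)) (c.chartU κ F u₀ y)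
        (c.chartV F u₀ y) ≠ 0) (m : Δ) :
    OmegaT Δ w ζ m (F.toFun y) (fun j => fderiv ℂ F.toFun y (Pi.single j 1)) =
      (c.model hκ).term m (c.paramAt κ ζ (F.toFun u₀)) (c.chartU κ F u₀ y) (c.chartV F u₀ y) *
      ((∏ s : Fin n, (aFun Δ w κ ζ (c.vertex s.succ.succ) (F.toFun u₀) : ℂ)) *
        ModelData.jac (c.chartU κ F u₀) y / c.edgeMatrix.det) /
      (c.model hκ).eqnDeriv (c.paramAt κ ζ (F.toFun u₀)) (c.chartU κ F u₀ y)
        (c.chartV F u₀ y) := by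
  have hx := F.mapsTo hy.1
  have hsc := c.scale_ne_zero (y := y) hu
  have hmono := mono_ne_zero hx.1 m
  have hdir := c.fderiv_poly_direction_chart hκ hu hy
  have hfd := fderiv_poly_div_mono hx m
  have hpoly : fderiv ℂ (poly Δ w ζ) (F.toFun y) ≠ 0 := by
    intro h0
    rw [h0, zero_apply] at hdir
    exact mul_ne_zero hsc hd hdir.symm
  have hne : fderiv ℂ (fun z => poly Δ w ζ z / mono m z) (F.toFun y) ≠ 0 := by
    rw [hfd]
    exact smul_ne_zero (inv_ne_zero hmono) hpoly
  have hq := Omega_cons_eq_quotForm_mul hne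
    (v := fun j => fderiv ℂ F.toFun y (Pi.single j 1)) (fun j => by
      rw [hfd, FunLike.coe_smul, Pi.smul_apply, fderiv_poly_eq_zero hy.1, smul_zero])
    (fun i => F.toFun y i * c.direction i)
  rw [c.Omega_chart hκ hu hy, hfd, FunLike.coe_smul, Pi.smul_apply, hdir, smul_eq_mul] at hq
  rw [eq_div_iff hd, hq]
  have hm := c.monoTerm_eq hκ hu hy m
  rw [monoTerm] at hm
  unfold OmegaT
  set Q := quotForm (fun z => poly Δ w ζ z / mono m z) (F.toFun y)
    (fun j => fderiv ℂ F.toFun y (Pi.single j 1))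
  set d := (c.model hκ).eqnDeriv (c.paramAt κ ζ (F.toFun u₀)) (c.chartU κ F u₀ y)
    (c.chartV F u₀ y)
  set τ := (c.model hκ).term m (c.paramAt κ ζ (F.toFun u₀)) (c.chartU κ F u₀ y)
    (c.chartV F u₀ y)
  calc tpow ζ (w m) * Q * d = (tpow ζ (w m) * mono m (F.toFun y)) * (mono m (F.toFun y))⁻¹ * Q *
        d := by field_simp
    _ = τ * (Q * ((mono m (F.toFun y))⁻¹ * (c.scale F u₀ y * d))) := by rw [hm]; ring

lemma volDensity_chart (hu : u₀ ∈ F.domain) (hy : F.IsNear u₀ y)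
    (hp : (c.model hκ).IsAdmissible C b (c.paramAt κ ζ (F.toFun u₀)))
    (hd : (c.model hκ).eqnDeriv (c.paramAt κ ζ (F.toFun u₀)) (c.chartU κ F u₀ y)
        (c.chartV F u₀ y) ≠ 0) :
    volDensity Δ w κ ζ F y = (c.model hκ).dens (c.paramAt κ ζ (F.toFun u₀)) (c.chartU κ F u₀ y)
        (c.chartV F u₀ y) * ‖ModelData.jac (c.chartU κ F u₀) y‖ ^ 2 := by
  have hE := c.det_edgeMatrix_ne_zero
  have hd' := norm_pos_iff.2 hd
  have hα : ∀ k, 0 < aFun Δ w κ ζ (c.vertex k) (F.toFun u₀) := fun k =>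
    aFun_pos hκ (ne_zero hu) (c.vertex k).2
  have hP : 0 < ∏ s : Fin n, aFun Δ w κ ζ (c.vertex s.succ.succ) (F.toFun u₀) :=
    Finset.prod_pos fun s _ => hα _
  have hsum : ∑ m ∈ Δ, ‖OmegaT Δ w ζ m (F.toFun y)
      (fun j => fderiv ℂ F.toFun y (Pi.single j 1))‖ ^ 2 =
      (c.model hκ).normSum (c.paramAt κ ζ (F.toFun u₀)) (c.chartU κ F u₀ y) (c.chartV F u₀ y) *
      ((∏ s : Fin n, aFun Δ w κ ζ (c.vertex s.succ.succ) (F.toFun u₀)) *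
        ‖ModelData.jac (c.chartU κ F u₀) y‖) ^ 2 / c.edgeMatrix.det ^ 2 /
      ‖(c.model hκ).eqnDeriv (c.paramAt κ ζ (F.toFun u₀)) (c.chartU κ F u₀ y)
        (c.chartV F u₀ y)‖ ^ 2 := by
    rw [← Finset.sum_coe_sort Δ, ModelData.normSum, Finset.sum_mul, Finset.sum_div,
      Finset.sum_div]
    refine Finset.sum_congr rfl fun m _ => ?_
    rw [c.OmegaT_chart hκ hu hy hd, norm_div, norm_mul, norm_div, norm_mul, ← Complex.ofReal_prod,
      Complex.norm_real, Complex.norm_real, Real.norm_of_nonneg hP.le, div_pow, mul_pow, div_pow,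
      Real.norm_eq_abs, sq_abs]
    ring
  rw [volDensity, hsum, c.hFun_chart hκ hu hy hp, ModelData.dens, c.prod_vertex]
  have h0 := (hα 0).ne'
  have h1 := (hα 1).ne'
  have hc0 : (c.model hκ).c₀ = κ ^ 2 / c.edgeMatrix.det ^ 2 := rfl
  have hb0 : (c.paramAt κ ζ (F.toFun u₀)).1 (c.model hκ).m₀ =
      (aFun Δ w κ ζ (c.vertex 0) (F.toFun u₀))⁻¹ := rfl
  have hb1 : (c.paramAt κ ζ (F.toFun u₀)).1 (c.model hκ).m₁ =
      (aFun Δ w κ ζ (c.vertex 1) (F.toFun u₀))⁻¹ := rfl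
  rw [hc0, hb0, hb1]
  field_simp

/-- The coordinates of the local model restricted to the hypersurface. -/
lemma isChart (hb : 0 < b) (hu : u₀ ∈ F.domain)
    (hp : (c.model hκ).IsAdmissible C b (c.paramAt κ ζ (F.toFun u₀))) :
    (c.model hκ).IsChart (c.paramAt κ ζ (F.toFun u₀)) (c.chartU κ F u₀) (c.chartV F u₀) u₀ := by
  have hnear := eventually_isNear hu
  have hU0 : c.chartU κ F u₀ u₀ = 0 := by
    ext s
    simp [chartU, logCoord_self hu]
  have hV0 : c.chartV F u₀ u₀ = 0 := by simp [chartV, logCoord_self hu]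
  refine ⟨?_, ?_, hU0, hV0, ?_, ?_⟩
  · filter_upwards [hnear] with y hy using (c.hasFDerivAt_chartU hu hy).differentiableAt
  · filter_upwards [hnear] with y hy using (c.hasFDerivAt_chartV hu hy).differentiableAt
  · filter_upwards [hnear] with y hy using c.eqn_chart hκ hu hy
  · refine ModelData.jac_ne_zero_iff.1 (c.jac_chartU_ne_zero hκ hu hnear.self_of_nhds ?_)
    rw [hU0, hV0]
    exact norm_pos_iff.1 (hb.trans_le hp.le_eqnDeriv)

lemma isChartDensity (hb : 0 < b) (hu : u₀ ∈ F.domain)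
    (hp : (c.model hκ).IsAdmissible C b (c.paramAt κ ζ (F.toFun u₀))) :
    (c.model hκ).IsChartDensity (c.paramAt κ ζ (F.toFun u₀)) (c.chartU κ F u₀) (c.chartV F u₀) u₀
      (volDensity Δ w κ ζ F) := by
  have hch := c.isChart hκ hb hu hp
  have hcont := (ModelData.contDiffAt_eqnDeriv (D := c.model hκ) hp.β_pos hch.contDiffAt_ψ
    hch.contDiffAt_v).continuousAt
  have hne : (c.model hκ).eqnDeriv (c.paramAt κ ζ (F.toFun u₀)) (c.chartU κ F u₀ u₀)
      (c.chartV F u₀ u₀) ≠ 0 := by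
    rw [hch.ψ_zero, hch.v_zero]
    exact norm_pos_iff.1 (hb.trans_le hp.le_eqnDeriv)
  filter_upwards [eventually_isNear hu, hcont.eventually_ne hne] with y hy hd
  exact c.volDensity_chart hκ hu hy hp hd

end Config

end Density

section RicciPotential

variable {n : ℕ} {Δ : Finset (Fin (n + 1) → ℤ)} {w : (Fin (n + 1) → ℤ) → ℝ} {κ : ℝ} {ζ : ℂ}
  {C b : ℝ}

open Classical in
/-- The Ricci potential, computed in any chart. -/
def ricciPotential (Δ : Finset (Fin (n + 1) → ℤ)) (w : (Fin (n + 1) → ℤ) → ℝ) (κ : ℝ) (ζ : ℂ)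
    (x : Fin (n + 1) → ℂ) : ℝ :=
  if h : ∃ Fu : LocalParam n (hypersurface Δ w ζ) × (Fin n → ℂ),
      Fu.2 ∈ Fu.1.domain ∧ Fu.1.toFun Fu.2 = x then
    -Real.log (volRatio Δ w κ ζ h.choose.1 h.choose.2)
  else 0

/-- Every point of the hypersurface belongs to a local model with bounded parameters. -/
def HasModels (Δ : Finset (Fin (n + 1) → ℤ)) (w : (Fin (n + 1) → ℤ) → ℝ)
    (hκ : 4 * ((n : ℝ) + 2) ≤ κ) (C b : ℝ) (ζ : ℂ) : Prop :=
  ∀ x ∈ hypersurface Δ w ζ, ∃ c : Config Δ w,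
    (c.model hκ).IsAdmissible C b (c.paramAt κ ζ x)

variable {hκ : 4 * ((n : ℝ) + 2) ≤ κ}

namespace HasModels

variable {F : LocalParam n (hypersurface Δ w ζ)} {u : Fin n → ℂ}

lemma metric_pos (h : HasModels Δ w hκ C b ζ) (hb : 0 < b) (hu : u ∈ F.domain) {X : Fin n → ℂ}
    (hX : X ≠ 0) : 0 < metric Δ w κ ζ F u X X := by
  obtain ⟨c, hc⟩ := h _ (F.mapsTo hu)
  exact (c.isChart hκ hb hu hc).metric_pos hb hc (c.isChartDensity hκ hb hu hc) hX

lemma volRatio_pos (h : HasModels Δ w hκ C b ζ) (hb : 0 < b) (hu : u ∈ F.domain) :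
    0 < volRatio Δ w κ ζ F u := by
  obtain ⟨c, hc⟩ := h _ (F.mapsTo hu)
  exact (c.isChart hκ hb hu hc).densRatio_pos hb hc (c.isChartDensity hκ hb hu hc)

lemma contDiffAt_volRatio (h : HasModels Δ w hκ C b ζ) (hb : 0 < b) (hu : u ∈ F.domain) :
    ContDiffAt ℝ ∞ (volRatio Δ w κ ζ F) u := by
  obtain ⟨c, hc⟩ := h _ (F.mapsTo hu)
  exact (c.isChart hκ hb hu hc).contDiffAt_densRatio hb hc (c.isChartDensity hκ hb hu hc)

lemma volRatio_eq (h : HasModels Δ w hκ C b ζ) (hb : 0 < b) (hu : u ∈ F.domain)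
    {F' : LocalParam n (hypersurface Δ w ζ)} {u' : Fin n → ℂ} (hu' : u' ∈ F'.domain)
    (heq : F'.toFun u' = F.toFun u) : volRatio Δ w κ ζ F' u' = volRatio Δ w κ ζ F u := by
  obtain ⟨c, hc⟩ := h _ (F.mapsTo hu)
  have hc' := hc
  rw [← heq] at hc'
  have hch' := c.isChart hκ hb hu' hc'
  have hd' := c.isChartDensity hκ hb hu' hc'
  rw [heq] at hch' hd'
  exact hch'.densRatio_eq hb hc hd' (c.isChart hκ hb hu hc) (c.isChartDensity hκ hb hu hc)

lemma ricciPotential_eq (h : HasModels Δ w hκ C b ζ) (hb : 0 < b) (hu : u ∈ F.domain) :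
    ricciPotential Δ w κ ζ (F.toFun u) = -Real.log (volRatio Δ w κ ζ F u) := by
  have hex : ∃ Fu : LocalParam n (hypersurface Δ w ζ) × (Fin n → ℂ),
      Fu.2 ∈ Fu.1.domain ∧ Fu.1.toFun Fu.2 = F.toFun u := ⟨(F, u), hu, rfl⟩
  rw [ricciPotential, dif_pos hex,
    h.volRatio_eq hb hu hex.choose_spec.1 hex.choose_spec.2]

lemma isRicciPotential (h : HasModels Δ w hκ C b ζ) (hb : 0 < b) :
    IsRicciPotential Δ w κ ζ (ricciPotential Δ w κ ζ) := by
  intro F u hu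
  rw [h.ricciPotential_eq hb hu, neg_neg, Real.exp_log (h.volRatio_pos hb hu)]

lemma contDiffOn_ricciPotential (h : HasModels Δ w hκ C b ζ) (hb : 0 < b)
    (F : LocalParam n (hypersurface Δ w ζ)) :
    ContDiffOn ℝ ∞ (fun u => ricciPotential Δ w κ ζ (F.toFun u)) F.domain := by
  refine ContDiffOn.congr (f := fun u => -Real.log (volRatio Δ w κ ζ F u)) (fun u hu => ?_)
    fun u hu => h.ricciPotential_eq hb hu
  exact ((h.contDiffAt_volRatio hb hu).log (h.volRatio_pos hb hu).ne').neg.contDiffWithinAt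

end HasModels

/-- Bounds for the Ricci potential and its covariant derivatives, uniform in `t`. -/
lemma exists_ricciPotential_bound (hκ : 4 * ((n : ℝ) + 2) ≤ κ) (C : ℝ) (hb : 0 < b) (k : ℕ) :
    ∃ K : ℝ, 0 ≤ K ∧ ∀ ζ : ℂ, HasModels Δ w hκ C b ζ →
      ∀ (F : LocalParam n (hypersurface Δ w ζ)), ∀ u ∈ F.domain,
        |ricciPotential Δ w κ ζ (F.toFun u)| ≤ K ∧ ∀ e : Fin (2 * n) → Fin n → ℂ,
          IsOrthonormalFrame (metric Δ w κ ζ F) u e →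
          frameNorm e (iterNabla (metric Δ w κ ζ F)
            (fun v => ricciPotential Δ w κ ζ (F.toFun v)) k u) ≤ K := by
  choose K hK using fun c : Config Δ w => (c.model hκ).exists_isRicciBound C hb k
  obtain ⟨M, hM1, hM⟩ := exists_abs_le K
  refine ⟨M, by linarith, fun ζ h F u hu => ?_⟩
  obtain ⟨c, hc⟩ := h _ (F.mapsTo hu)
  refine ((hK c).mono ((le_abs_self _).trans (hM c))) _ (Set.mem_univ _) hc _ _ u
    (volDensity Δ w κ ζ F) (fun v => ricciPotential Δ w κ ζ (F.toFun v))
    (c.isChart hκ hb hu hc) (c.isChartDensity hκ hb hu hc) ?_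
  filter_upwards [F.isOpen_domain.mem_nhds hu] with y hy using h.ricciPotential_eq hb hy

end RicciPotential

end ToricHypersurface

end

open ToricHypersurface in
theorem proposition5p7 (n : ℕ) (Δ : Finset (Fin (n + 1) → ℤ)) (w : (Fin (n + 1) → ℤ) → ℝ)
    (hw : IsSimplicialData Δ w) :
    ∃ κ₀ : ℝ, 0 < κ₀ ∧ ∀ κ : ℝ, κ₀ ≤ κ →
      ∃ t₀ : ℝ, 0 < t₀ ∧ ∃ φ : ℂ → (Fin (n + 1) → ℂ) → ℝ,
        (∀ ζ : ℂ, ‖Complex.exp ζ‖ < t₀ →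
          -- `X_t` is smooth and `g_t` is a Riemannian metric on it
          (∀ x ∈ hypersurface Δ w ζ, fderiv ℂ (poly Δ w ζ) x ≠ 0) ∧
          (∀ F : LocalParam n (hypersurface Δ w ζ), ∀ u ∈ F.domain, ∀ X : Fin n → ℂ, X ≠ 0 →
            0 < metric Δ w κ ζ F u X X) ∧
          -- `φ_t` is a smooth function on `X_t` with `exp (-φ_t) = ω_t^{l-1} / V_t`
          IsRicciPotential Δ w κ ζ (φ ζ) ∧
          (∀ F : LocalParam n (hypersurface Δ w ζ),
            ContDiffOn ℝ ∞ (fun u => φ ζ (F.toFun u)) F.domain)) ∧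
        -- `|φ_t|` is bounded independently of `t`
        (∃ C : ℝ, ∀ ζ : ℂ, ‖Complex.exp ζ‖ < t₀ → ∀ x ∈ hypersurface Δ w ζ, |φ ζ x| ≤ C) ∧
        -- all `C^k` norms with respect to `g_t` are bounded independently of `t`
        (∀ k : ℕ, ∃ C : ℝ, ∀ ζ : ℂ, ‖Complex.exp ζ‖ < t₀ →
          ckNorm Δ w κ ζ k (φ ζ) ≤ ENNReal.ofReal C) := by
  refine ⟨4 * ((n : ℝ) + 2), by positivity, fun κ hκ => ?_⟩
  obtain ⟨C, b, t₀, hb, ht₀, hadm⟩ := Config.exists_isAdmissible hw hκ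
  choose K hK0 hK using fun k => exists_ricciPotential_bound (Δ := Δ) (w := w) hκ C hb k
  refine ⟨t₀, ht₀, ricciPotential Δ w κ, fun ζ hζ => ?_, ⟨K 0, fun ζ hζ x hx => ?_⟩,
    fun k => ⟨∑ j ∈ Finset.range (k + 1), K j, fun ζ hζ => ?_⟩⟩
  · have h : HasModels Δ w hκ C b ζ := hadm ζ hζ
    refine ⟨fun x hx => ?_, fun F u hu X hX => h.metric_pos hb hu hX, h.isRicciPotential hb,
      h.contDiffOn_ricciPotential hb⟩
    obtain ⟨c, hc⟩ := h x hx
    exact c.fderiv_poly_ne_zero hκ hb hx hc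
  · by_cases hex : ∃ Fu : LocalParam n (hypersurface Δ w ζ) × (Fin n → ℂ),
        Fu.2 ∈ Fu.1.domain ∧ Fu.1.toFun Fu.2 = x
    · obtain ⟨⟨F, u⟩, hu, rfl⟩ := hex
      exact (hK 0 ζ (hadm ζ hζ) F u hu).1
    · rw [ricciPotential, dif_neg hex, abs_zero]
      exact hK0 0
  · refine iSup_le fun F => iSup_le fun u => iSup_le fun hu => iSup_le fun e => iSup_le fun he => ?_
    rw [ENNReal.ofReal_sum_of_nonneg fun j _ => hK0 j]
    exact Finset.sum_le_sum fun j _ =>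
      ENNReal.ofReal_le_ofReal ((hK j ζ (hadm ζ hζ) F u hu).2 e he)
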